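/- Let $P\subset\mathbb R^2$ be a compact simply connected polygon: a compact region that is the closure of its connected interior and whose boundary $\partial P$ is a simple closed polygonal curve with angles $\neq\pi$ at its corners. Let $D$ be the group generated by the reflections in the lines through the origin parallel to the sides of $P$, and suppose that $P$ is irrational, i.e. that $D$ is infinite. The phase space $V_P$ of the billiard map $T$ consists of the pairs $(x,\theta)$, where $x\in\partial P$ is not a corner and $\theta\in S^1$ points strictly into $P$ at $x$; $T(x,\theta)=(y,\theta')$, where $y$ is the first boundary point hit by the ray from $x$ in direction $\theta$ and $\theta'$ is the elastically reflected direction; $T$ is undefined if $y$ is a corner. A generalized diagonal is a billiard trajectory (moving through the interior of $P$ between successive boundary points) from a corner to a corner. A direction $\theta$ is exceptional if it is the direction of a generalized diagonal, where directions of trajectories are taken modulo $D$: some link of some generalized diagonal has its direction in the orbit $D\theta$. A flat strip is a set $A\subset V_P$ that is invariant under $T$ in forward and backward time (wherever $T$ is defined) and such that: (1) only finitely many directions occur in $A$, i.e. $A$ lies in finitely many floors; (2) every forward $T$-orbit that starts in $A$ and never hits a corner is dense in $A$; (3) its boundary is non-empty and is a finite union of generalized diagonals. Here the boundary is taken in the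 phase space of the billiard flow, floor by floor: it is the set of pairs $(z,\theta)$ such that $z\in\operatorname{int}P$ lies in the topological boundary of the closure of the union of all open links that start at a point $(x,\theta)\in A$ with this direction $\theta$; and a generalized diagonal is the set of all $(z,\psi)$ with $z$ in one of its open links and $\psi$ the direction of that link. Let $u=(x,\theta)\in V_P$ be a point whose forward orbit $\{T^k(u):k\ge 0\}$ never hits a corner. (i) If $\theta$ is non-exceptional, then the set of directions of the points $T^k(u)$, $k\ge0$, is infinite. (ii) If $u$ is not periodic (that is, $T^k(u)\ne u$ for all $k\ge1$), but the set of directions of the points $T^k(u)$, $k\ge 0$, is finite, then $u$ is recurrent (every neighbourhood of $u$ contains $T^k(u)$ for arbitrarily large $k$), and the closure in $V_P$ of its forward orbit is a flat strip. -/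

import Mathlib

open Set Filter Topology

noncomputable section

/-- A polygonal billiard table in the plane `ℂ`: a compact region, equal to the closure of its
(connected) interior, whose boundary is a simple closed polygonal curve.  Consecutive triples of
vertices are not collinear, so that the vertices are exactly the corners of the table.
(The boundary being a single Jordan curve, the region is simply connected.) -/
structure BilliardTable (n : ℕ) [NeZero n] where
  /-- the cyclically ordered corners -/
  poly : Polygon ℂ n
  nondegenerate : poly.HasNondegenerateVertices ℝ
  vertices_injective : Function.Injective poly.vertices
  /-- the boundary curve is simple: a side without its endpoints meets no other side -/
  simple : ∀ i j : Fin n, i ≠ j →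
    Disjoint (openSegment ℝ (poly i) (poly (finRotate n i))) (poly.edgeSet ℝ j)
  /-- the table itself -/
  region : Set ℂ
  isCompact_region : IsCompact region
  closure_interior_region : closure (interior region) = region
  isConnected_interior_region : IsConnected (interior region)
  frontier_region : frontier region = poly.boundary ℝ

namespace BilliardTable

variable {n : ℕ} [NeZero n] (P : BilliardTable n)

/-- The set of corners of the table. -/
def corners : Set ℂ := range P.poly.vertices

/-- The `i`-th side without its two corners. -/
def openSide (i : Fin n) : Set ℂ := openSegment ℝ (P.poly i) (P.poly (finRotate n i))

/-- The orthogonal reflection in the line through the origin parallel to the `i`-th side. -/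
def sideReflection (i : Fin n) : ℂ ≃ₗᵢ[ℝ] ℂ :=
  (Submodule.span ℝ {P.poly (finRotate n i) - P.poly i}).reflection

/-- The group `D` generated by the reflections in the lines through the origin that are parallel
to the sides. -/
def dihedralGroup : Subgroup (ℂ ≃ₗᵢ[ℝ] ℂ) := Subgroup.closure (range P.sideReflection)

/-- The table is irrational if the group `D` is infinite. -/
def IsIrrational : Prop := Infinite P.dihedralGroup

/-- The phase space of the billiard map: pairs `(x, θ)` where `x` is a boundary point that is not
a corner and `θ` is a direction pointing (strictly) into the table at `x`. -/
def phaseSpace : Set (ℂ × Circle) :=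
  {u | (∃ i, u.1 ∈ P.openSide i) ∧
    ∃ ε : ℝ, 0 < ε ∧ ∀ s ∈ Ioo 0 ε, u.1 + (s : ℂ) * (u.2 : ℂ) ∈ interior P.region}

/-- The point mass starting at `x` in direction `θ` moves through the interior of the table until
it arrives at `y`. -/
def IsChord (x : ℂ) (θ : Circle) (y : ℂ) : Prop :=
  ∃ t : ℝ, 0 < t ∧ y = x + (t : ℂ) * (θ : ℂ) ∧
    ∀ s ∈ Ioo 0 t, x + (s : ℂ) * (θ : ℂ) ∈ interior P.region

/-- At the boundary point `y`, which is not a corner, the direction of incidence `θ` is turned by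
elastic reflection into the direction `θ'`. -/
def Reflects (y : ℂ) (θ θ' : Circle) : Prop :=
  ∃ i, y ∈ P.openSide i ∧ (θ' : ℂ) = P.sideReflection i (θ : ℂ)

/-- The graph of the billiard map `T`: `T u` is defined and equal to `v`.  The map is not defined
at `u` when the motion starting at `u` hits a corner. -/
def Step (u v : ℂ × Circle) : Prop :=
  P.IsChord u.1 u.2 v.1 ∧ P.Reflects v.1 u.2 v.2

/-- `o` is the sequence `u, T u, T² u, …` for a point `u` of the phase space whose forward orbit
never hits a corner. -/
def IsForwardOrbit (u : ℂ × Circle) (o : ℕ → ℂ × Circle) : Prop :=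
  u ∈ P.phaseSpace ∧ o 0 = u ∧ ∀ k, P.Step (o k) (o (k + 1))

/-- A generalized diagonal: a billiard trajectory consisting of `m + 1` links that starts in a
corner, ends in a corner, and is reflected at non-corner boundary points in between. -/
structure GeneralizedDiagonal where
  /-- the number of reflections -/
  m : ℕ
  /-- the successive boundary points -/
  foot : Fin (m + 2) → ℂ
  /-- the successive directions -/
  dir : Fin (m + 1) → Circle
  foot_first : foot 0 ∈ P.corners
  foot_last : foot (Fin.last (m + 1)) ∈ P.corners
  link : ∀ k : Fin (m + 1), P.IsChord (foot k.castSucc) (dir k) (foot k.succ)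
  bounce : ∀ k : Fin m, P.Reflects (foot k.succ.castSucc) (dir k.castSucc) (dir k.succ)

variable {P} in
/-- The points of the phase space of the billiard flow (over the interior of the table) that lie
on a generalized diagonal. -/
def GeneralizedDiagonal.trace (d : P.GeneralizedDiagonal) : Set (ℂ × Circle) :=
  {p | ∃ k : Fin (d.m + 1), p.2 = d.dir k ∧
    p.1 ∈ openSegment ℝ (d.foot k.castSucc) (d.foot k.succ)}

/-- A direction is exceptional if it is the direction of a generalized diagonal.  As the direction
of a billiard trajectory changes under reflection by elements of `D`, it is understood modulo the
action of `D`. -/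
def IsExceptional (θ : Circle) : Prop :=
  ∃ (d : P.GeneralizedDiagonal) (k : Fin (d.m + 1)), ∃ g ∈ P.dihedralGroup,
    (d.dir k : ℂ) = g (θ : ℂ)

/-- The points `(z, θ)` of the phase space of the billiard flow, `z` in the interior of the table,
that lie on the link starting at some `(x, θ)` in the subset `A` of the phase space of the
billiard map. -/
def flowSet (A : Set (ℂ × Circle)) : Set (ℂ × Circle) :=
  {p | ∃ x : ℂ, (x, p.2) ∈ A ∧ P.IsChord x p.2 p.1 ∧ p.1 ∈ interior P.region}

/-- The boundary of the flow set of `A` taken in every floor (interior of the table) `× {θ}`: the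
boundary, relative to the interior of the table, of the closure of the slice in direction `θ`. -/
def flowBoundary (A : Set (ℂ × Circle)) : Set (ℂ × Circle) :=
  {p | p.1 ∈ interior P.region ∧ p.1 ∈ frontier (closure {z : ℂ | (z, p.2) ∈ P.flowSet A})}

/-- A flat strip (as a subset of the phase space of the billiard map). -/
structure IsFlatStrip (A : Set (ℂ × Circle)) : Prop where
  subset_phaseSpace : A ⊆ P.phaseSpace
  /-- invariance in forward and backward time -/
  invariant : ∀ u ∈ P.phaseSpace, ∀ v ∈ P.phaseSpace, P.Step u v → (u ∈ A ↔ v ∈ A)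
  /-- the set lies in finitely many floors -/
  finite_floors : (Prod.snd '' A).Finite
  /-- every orbit in the set that does not hit a corner is dense in it -/
  minimal : ∀ u ∈ A, ∀ o, P.IsForwardOrbit u o → A ⊆ closure (range o)
  /-- the boundary is non-empty and a finite union of generalized diagonals -/
  boundary : (P.flowBoundary A).Nonempty ∧
    ∃ S : Set P.GeneralizedDiagonal, S.Finite ∧ P.flowBoundary A = ⋃ d ∈ S, d.trace

/-- A forward orbit is periodic if it returns to its initial point. -/
def IsPeriodicOrbit (o : ℕ → ℂ × Circle) : Prop := ∃ k : ℕ, 0 < k ∧ o k = o 0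

/-- The initial point is recurrent: it is an accumulation point of its forward orbit in time. -/
def IsRecurrentOrbit (o : ℕ → ℂ × Circle) : Prop := MapClusterPt (o 0) atTop o

end BilliardTable

end

/-! The engine is a recurrence argument for strips. Take a point with an infinite forward orbit in
finitely many directions, and follow the parallel trajectories issuing from a small interval beside
it. While no trajectory hits a corner, the strip moves isometrically, its orientation reversed at
each bounce. If it is never cut, its positive width forces overlaps, by pigeonhole. If it is cut at
arbitrarily late times, two cuts share corner and direction, so the two trajectories coincide.
Either way a point of the interval returns to the interval (`exists_return`), and
`exists_isometric_return` describes the return as a translation or a flip.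

Let `C` be invariant, in finitely many floors, floorwise closed and free of periodic points
(`IsAperiodic`). The return map sends a point of `C` with infinite forward orbit into any gap beside
it, or is the inverse of such a motion, so such a point borders no gap; by time reversal the same
holds for backward orbits. Thus gap-adjacent points lie on trajectories from corner to corner. Only
finitely many of these are relevant, because a generalized diagonal is determined by its initial
corner and direction. Finiteness then shows that every boundary point is gap-adjacent
(`gapAdjacent_of_boundary`).

`IsTame` keeps what is needed to describe the flow boundary. Its points lie on generalized
diagonals, and being a boundary point propagates along links and across bounces, so whole diagonals
belong to it (`flowBoundary_eq`). Irrationality enters once: with an empty flow boundary every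
occurring slice would be dense in the table, the finite set of directions would be stable under all
side reflections, and `D` would be finite (`flowBoundary_nonempty`).

For (ii), the closure of a non-periodic orbit with finitely many directions is aperiodic and tame.
It is minimal: a point `v` in it with infinite orbit is not a boundary point of its own orbit
closure, which therefore contains a neighbourhood of `v`, visited by the original orbit. For (i),
argue by contraposition: besides orbit closures, the sets of points of a fixed even period with
directions in a finite set are tame, so in both cases a flow boundary supplies a generalized
diagonal in a direction of `D θ`. -/

noncomputable section

/-! ### Transversal coordinates and a connectedness tool -/

/-- The cross product of two plane vectors. -/
def cross (u v : ℂ) : ℝ := u.re * v.im - u.im * v.re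

theorem cross_add_right (u v w : ℂ) : cross u (v + w) = cross u v + cross u w := by
  simp [cross]; ring

theorem cross_sub_right (u v w : ℂ) : cross u (v - w) = cross u v - cross u w := by
  simp [cross]; ring

theorem cross_mul_right (u : ℂ) (t : ℝ) (v : ℂ) : cross u (t * v) = t * cross u v := by
  simp [cross]; ring

theorem cross_neg_right (u v : ℂ) : cross u (-v) = - cross u v := by
  simp [cross]; ring

theorem cross_same (u : ℂ) : cross u u = 0 := by
  simp [cross]; ring

theorem cross_comm (u v : ℂ) : cross u v = - cross v u := by
  simp [cross]; ring

theorem continuous_cross (u : ℂ) : Continuous (cross u) := by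
  unfold cross; fun_prop

theorem exists_real_mul_of_cross_eq_zero {u v : ℂ} (hu : u ≠ 0) (h : cross u v = 0) :
    ∃ t : ℝ, v = t * u := by
  have hn : u.re ^ 2 + u.im ^ 2 ≠ 0 := by
    intro h0
    apply hu
    apply Complex.ext <;> simp <;> nlinarith [sq_nonneg u.re, sq_nonneg u.im]
  refine ⟨(u.re * v.re + u.im * v.im) / (u.re ^ 2 + u.im ^ 2), ?_⟩
  unfold cross at h
  apply Complex.ext
  · simp only [Complex.mul_re, Complex.ofReal_re, Complex.ofReal_im]
    field_simp
    linear_combination (-u.im) * h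
  · simp only [Complex.mul_im, Complex.ofReal_re, Complex.ofReal_im]
    field_simp
    linear_combination u.re * h

/-- Applied to the two half-discs at a side point, and later to the whole interior of the table when
a flow boundary is empty. -/
theorem IsPreconnected.subset_interior_or_subset_compl {X : Type*} [TopologicalSpace X]
    {s t : Set X} (hs : IsPreconnected s) (hd : ∀ x ∈ s, x ∉ frontier t) :
    s ⊆ interior t ∨ s ⊆ tᶜ := by
  have hcov : s ⊆ interior t ∪ (closure t)ᶜ := by
    intro x hx
    by_cases hxi : x ∈ interior t
    · exact Or.inl hxi
    · exact Or.inr fun hc => hd x hx ⟨hc, hxi⟩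
  have := isPreconnected_iff_subset_of_disjoint.1 hs _ _ isOpen_interior
    isClosed_closure.isOpen_compl hcov (by
      ext x
      simp only [mem_inter_iff, mem_compl_iff, mem_empty_iff_false, iff_false, not_and, not_not]
      exact fun _ h => subset_closure (interior_subset h))
  rcases this with h | h
  · exact Or.inl h
  · exact Or.inr (h.trans (compl_subset_compl.2 subset_closure))

/-- The coordinate `cross θ` is constant along trajectories in direction `θ`, and it separates the
points of a line transversal to `θ`. Positions on sides are identified this way throughout. -/
theorem eq_of_line_of_cross_eq {e θ x y : ℂ} (he : e ≠ 0) (h : cross θ e ≠ 0)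
    (h1 : cross e (y - x) = 0) (h2 : cross θ (y - x) = 0) : y = x := by
  obtain ⟨t, ht⟩ := exists_real_mul_of_cross_eq_zero he h1
  rw [ht, cross_mul_right] at h2
  have : t = 0 := by simpa [h] using h2
  rw [this] at ht
  simpa [sub_eq_zero] using ht

/-! ### The shape of the table near a side -/

namespace BilliardTable

variable {n : ℕ} [NeZero n] (P : BilliardTable n)

/-- The `i`-th side as a vector. -/
def edge (i : Fin n) : ℂ := P.poly (finRotate n i) - P.poly i

theorem edge_ne_zero (i : Fin n) : P.edge i ≠ 0 := fun h =>
  P.nondegenerate.hasNondegenerateEdges i (sub_eq_zero.1 h).symm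

theorem mem_openSide_iff {x : ℂ} {i : Fin n} :
    x ∈ P.openSide i ↔ ∃ t ∈ Ioo (0 : ℝ) 1, x = P.poly i + t * P.edge i := by
  unfold openSide
  rw [openSegment_eq_image']
  simp only [mem_image, Complex.real_smul, edge, eq_comm]

theorem cross_edge_eq_zero {x y : ℂ} {i : Fin n} (hx : x ∈ P.openSide i) (hy : y ∈ P.openSide i) :
    cross (P.edge i) (y - x) = 0 := by
  obtain ⟨t, -, rfl⟩ := P.mem_openSide_iff.1 hx
  obtain ⟨s, -, rfl⟩ := P.mem_openSide_iff.1 hy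
  simp [cross]; ring

theorem edgeSet_eq (i : Fin n) :
    P.poly.edgeSet ℝ i = segment ℝ (P.poly i) (P.poly (finRotate n i)) :=
  affineSegment_eq_segment ..

theorem openSide_subset_edgeSet (i : Fin n) : P.openSide i ⊆ P.poly.edgeSet ℝ i := by
  rw [edgeSet_eq]; exact openSegment_subset_segment ..

theorem mem_edgeSet_iff {x : ℂ} {i : Fin n} : x ∈ P.poly.edgeSet ℝ i ↔
    x ∈ P.openSide i ∨ x = P.poly i ∨ x = P.poly (finRotate n i) := by
  rw [edgeSet_eq, ← insert_endpoints_openSegment, openSide]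
  simp only [mem_insert_iff]; tauto

theorem mem_frontier_iff {x : ℂ} :
    x ∈ frontier P.region ↔ (∃ i, x ∈ P.openSide i) ∨ x ∈ P.corners := by
  rw [P.frontier_region, Polygon.boundary, mem_iUnion]
  simp only [mem_edgeSet_iff, corners, mem_range]
  constructor
  · rintro ⟨i, h | h | h⟩
    · exact Or.inl ⟨i, h⟩
    · exact Or.inr ⟨i, h.symm⟩
    · exact Or.inr ⟨_, h.symm⟩
  · rintro (⟨i, h⟩ | ⟨i, h⟩)
    · exact ⟨i, Or.inl h⟩
    · exact ⟨i, Or.inr (Or.inl h.symm)⟩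

theorem openSide_subset_frontier (i : Fin n) : P.openSide i ⊆ frontier P.region :=
  fun _ h => P.mem_frontier_iff.2 (Or.inl ⟨i, h⟩)

theorem corners_subset_frontier : P.corners ⊆ frontier P.region :=
  fun _ h => P.mem_frontier_iff.2 (Or.inr h)

theorem not_mem_interior_of_mem_frontier {x : ℂ} (h : x ∈ frontier P.region) :
    x ∉ interior P.region := h.2

theorem openSide_inj {x : ℂ} {i j : Fin n} (hi : x ∈ P.openSide i) (hj : x ∈ P.openSide j) :
    i = j := by
  by_contra hij
  exact disjoint_left.1 (P.simple i j hij) hi (P.openSide_subset_edgeSet j hj)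

theorem not_mem_corners {x : ℂ} {i : Fin n} (hi : x ∈ P.openSide i) : x ∉ P.corners := by
  rintro ⟨k, rfl⟩
  by_cases hk : i = k
  · subst hk
    obtain ⟨t, ht, h⟩ := P.mem_openSide_iff.1 hi
    have : (t : ℂ) * P.edge i = 0 := by linear_combination -h
    rcases mul_eq_zero.1 this with h | h
    · exact ht.1.ne' (by exact_mod_cast h)
    · exact P.edge_ne_zero i h
  · exact disjoint_left.1 (P.simple i k hk) hi (P.mem_edgeSet_iff.2 (Or.inr (Or.inl rfl)))

theorem finite_corners : P.corners.Finite := finite_range _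

theorem isClosed_region : IsClosed P.region := P.isCompact_region.isClosed

/-- The corners and the other closed sides form a closed set that misses `x`. -/
theorem exists_ball_frontier {x : ℂ} {i : Fin n} (hx : x ∈ P.openSide i) :
    ∃ r > 0, ∀ z, dist z x < r →
      (z ∈ frontier P.region → z ∈ P.openSide i) ∧
      (cross (P.edge i) (z - x) = 0 → z ∈ P.openSide i) := by
  set Z : Set ℂ := P.corners ∪ ⋃ j ∈ {j | j ≠ i}, P.poly.edgeSet ℝ j with hZ
  have hZc : IsClosed Z := by
    refine P.finite_corners.isClosed.union (Set.Finite.isClosed_biUnion (toFinite _) fun j _ => ?_)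
    rw [edgeSet_eq, segment_eq_image']
    exact (isCompact_Icc.image (by fun_prop)).isClosed
  have hxZ : x ∈ Zᶜ := by
    rintro (h | h)
    · exact P.not_mem_corners hx h
    · simp only [mem_iUnion] at h
      obtain ⟨j, hj, h⟩ := h
      exact disjoint_left.1 (P.simple i j (Ne.symm hj)) hx h
  obtain ⟨r, hr, hrZ⟩ := Metric.isOpen_iff.1 hZc.isOpen_compl x hxZ
  obtain ⟨t, ht, hxt⟩ := P.mem_openSide_iff.1 hx
  have hen : 0 < ‖P.edge i‖ := norm_pos_iff.2 (P.edge_ne_zero i)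
  have hm : 0 < min t (1 - t) := lt_min ht.1 (by linarith [ht.2])
  refine ⟨min r (min t (1 - t) * ‖P.edge i‖), lt_min hr (mul_pos hm hen), fun z hz => ⟨?_, ?_⟩⟩
  · intro hzf
    have hzZ : z ∉ Z := hrZ (Metric.mem_ball.2 (hz.trans_le (min_le_left _ _)))
    rcases P.mem_frontier_iff.1 hzf with ⟨j, hj⟩ | hc
    · by_cases hji : j = i
      · exact hji ▸ hj
      · exact absurd (Or.inr (mem_biUnion (show j ∈ {j | j ≠ i} from hji)
          (P.openSide_subset_edgeSet j hj))) hzZ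
    · exact absurd (Or.inl hc) hzZ
  · intro hc
    obtain ⟨s, hs⟩ := exists_real_mul_of_cross_eq_zero (P.edge_ne_zero i) hc
    have h1 : |s| * ‖P.edge i‖ < min t (1 - t) * ‖P.edge i‖ := by
      have := hz.trans_le (min_le_right _ _)
      rwa [dist_eq_norm, hs, norm_mul, Complex.norm_real, Real.norm_eq_abs] at this
    have h2 : |s| < min t (1 - t) := lt_of_mul_lt_mul_right h1 hen.le
    have h3 := h2.trans_le (min_le_left _ _)
    have h4 := h2.trans_le (min_le_right _ _)
    refine P.mem_openSide_iff.2 ⟨t + s, ⟨?_, ?_⟩, ?_⟩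
    · linarith [neg_abs_le s]
    · linarith [le_abs_self s]
    · push_cast; linear_combination hs + hxt

/-- Near `x` the table is the half-disc lying on the side of the `i`-th side given by the sign `σ`. -/
def HalfDisc (i : Fin n) (σ : ℝ) (x : ℂ) (r : ℝ) : Prop :=
  ∀ z, dist z x < r →
    (0 < σ * cross (P.edge i) (z - x) → z ∈ interior P.region) ∧
    (σ * cross (P.edge i) (z - x) < 0 → z ∉ P.region) ∧
    (cross (P.edge i) (z - x) = 0 → z ∈ P.openSide i)

theorem convex_cross_pos (σ : ℝ) (e x : ℂ) : Convex ℝ {z : ℂ | 0 < σ * cross e (z - x)} := by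
  intro a ha b hb s t hs ht hst
  simp only [mem_ofPred_eq, Complex.real_smul] at *
  have : (s : ℂ) * a + t * b - x = s * (a - x) + t * (b - x) := by
    have : (s : ℂ) + t = 1 := by exact_mod_cast hst
    linear_combination x * this
  rw [this, cross_add_right, cross_mul_right, cross_mul_right]
  rcases hs.eq_or_lt with rfl | hs'
  · have : t = 1 := by linarith
    subst this; simpa using hb
  · have := mul_pos hs' ha
    have := mul_nonneg ht hb.le
    nlinarith

theorem cross_I_mul_self_pos {e : ℂ} (he : e ≠ 0) : 0 < cross e (Complex.I * e) := by
  have : cross e (Complex.I * e) = Complex.normSq e := by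
    simp [cross, Complex.normSq_apply]
  rw [this]; exact Complex.normSq_pos.2 he

theorem exists_dist_lt_cross (e x : ℂ) (he : e ≠ 0) {r : ℝ} (hr : 0 < r) (σ : ℝ) (hσ : σ ≠ 0) :
    ∃ z, dist z x < r ∧ 0 < σ * cross e (z - x) := by
  have hc := cross_I_mul_self_pos he
  have hen : 0 < ‖e‖ := norm_pos_iff.2 he
  have hσ' : 0 < |σ| := abs_pos.2 hσ
  set s : ℝ := r / (2 * |σ| * ‖e‖) * σ with hs
  refine ⟨x + s * (Complex.I * e), ?_, ?_⟩
  · rw [dist_eq_norm, add_sub_cancel_left, norm_mul, norm_mul, Complex.norm_I, Complex.norm_real,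
      Real.norm_eq_abs, hs, abs_mul, abs_of_pos (by positivity), one_mul]
    have : r / (2 * |σ| * ‖e‖) * |σ| * ‖e‖ = r / 2 := by field_simp
    rw [this]; linarith
  · rw [add_sub_cancel_left, cross_mul_right, hs]
    have : σ * (r / (2 * |σ| * ‖e‖) * σ * cross e (Complex.I * e)) =
      r / (2 * |σ| * ‖e‖) * (σ * σ) * cross e (Complex.I * e) := by ring
    rw [this]
    have := mul_self_pos.2 hσ
    positivity

/-- Neither half of a small disc meets the frontier, so each is inside or outside. Both inside would
make `x` an interior point; both outside would contradict that the region is the closure of its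
interior. -/
theorem exists_halfDisc {x : ℂ} {i : Fin n} (hx : x ∈ P.openSide i) :
    ∃ σ : ℝ, (σ = 1 ∨ σ = -1) ∧ ∃ r > 0, P.HalfDisc i σ x r := by
  obtain ⟨r, hr, h⟩ := P.exists_ball_frontier hx
  have hside : ∀ σ : ℝ, (Metric.ball x r ∩ {z | 0 < σ * cross (P.edge i) (z - x)} ⊆ interior P.region)
      ∨ (Metric.ball x r ∩ {z | 0 < σ * cross (P.edge i) (z - x)} ⊆ P.regionᶜ) := by
    intro σ
    refine IsPreconnected.subset_interior_or_subset_compl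
      ((convex_ball x r).inter (convex_cross_pos σ _ x)).isPreconnected ?_
    rintro z ⟨hz, hz'⟩ hf
    have := P.cross_edge_eq_zero hx ((h z hz).1 hf)
    simp [this] at hz'
  have hzero : ∀ z, dist z x < r → cross (P.edge i) (z - x) = 0 → z ∈ P.openSide i :=
    fun z hz => (h z hz).2
  have hneg : ∀ z, (0 : ℝ) < -1 * cross (P.edge i) (z - x) ↔ cross (P.edge i) (z - x) < 0 := by
    intro z; constructor <;> intro h <;> linarith
  have hxr : x ∈ P.region := P.isClosed_region.frontier_subset (P.openSide_subset_frontier i hx)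
  rcases hside 1 with h1 | h1 <;> rcases hside (-1) with h2 | h2
  · exfalso
    refine P.not_mem_interior_of_mem_frontier (P.openSide_subset_frontier i hx)
      (mem_interior.2 ⟨Metric.ball x r, fun z hz => ?_, Metric.isOpen_ball, Metric.mem_ball_self hr⟩)
    rcases lt_trichotomy (cross (P.edge i) (z - x)) 0 with hc | hc | hc
    · exact interior_subset (h2 ⟨hz, (hneg z).2 hc⟩)
    · exact P.isClosed_region.frontier_subset (P.openSide_subset_frontier i (hzero z hz hc))
    · exact interior_subset (h1 ⟨hz, by simpa using hc⟩)
  · refine ⟨1, Or.inl rfl, r, hr, fun z hz => ⟨fun hc => h1 ⟨hz, hc⟩, fun hc => h2 ⟨hz, ?_⟩,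
      hzero z hz⟩⟩
    simpa using hc
  · refine ⟨-1, Or.inr rfl, r, hr, fun z hz => ⟨fun hc => h2 ⟨hz, hc⟩, fun hc => h1 ⟨hz, ?_⟩,
      hzero z hz⟩⟩
    simpa using hc
  · exfalso
    rw [← P.closure_interior_region] at hxr
    obtain ⟨z, hz, hzx⟩ := Metric.mem_closure_iff.1 hxr r hr
    rw [dist_comm] at hzx
    rcases lt_trichotomy (cross (P.edge i) (z - x)) 0 with hc | hc | hc
    · exact h2 ⟨hzx, (hneg z).2 hc⟩ (interior_subset hz)
    · exact P.not_mem_interior_of_mem_frontier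
        (P.openSide_subset_frontier i (hzero z hzx hc)) hz
    · exact h1 ⟨hzx, by simpa using hc⟩ (interior_subset hz)

/-- The sign found at each point is locally constant, and an open side is connected. -/
theorem exists_sign (i : Fin n) :
    ∃ σ : ℝ, (σ = 1 ∨ σ = -1) ∧ ∀ x ∈ P.openSide i, ∃ r > 0, P.HalfDisc i σ x r := by
  let U : ℝ → Set ℂ := fun σ => {z | ∃ x ∈ P.openSide i, ∃ r > 0, P.HalfDisc i σ x r ∧ dist z x < r}
  have hU : ∀ σ, IsOpen (U σ) := by
    intro σ
    have : U σ = ⋃ x ∈ P.openSide i, ⋃ r ∈ {r | 0 < r ∧ P.HalfDisc i σ x r}, Metric.ball x r := by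
      ext z; simp only [U, mem_ofPred_eq, mem_iUnion, Metric.mem_ball, exists_prop, gt_iff_lt,
        and_assoc]
    rw [this]
    exact isOpen_biUnion fun x _ => isOpen_biUnion fun r _ => Metric.isOpen_ball
  have hshift : ∀ σ : ℝ, ∀ x ∈ P.openSide i, ∀ z ∈ P.openSide i, ∀ r, P.HalfDisc i σ x r →
      dist z x < r → ∃ r > 0, P.HalfDisc i σ z r := by
    intro σ x hx z hz r h hzr
    refine ⟨r - dist z x, by linarith, fun w hw => ?_⟩
    have : cross (P.edge i) (w - z) = cross (P.edge i) (w - x) := by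
      have := P.cross_edge_eq_zero hx hz
      rw [cross_sub_right] at this ⊢
      rw [cross_sub_right]; linarith
    rw [this]
    exact h w (by linarith [dist_triangle w z x])
  have hpre : IsPreconnected (P.openSide i) := (convex_openSegment _ _).isPreconnected
  have hcov : P.openSide i ⊆ U 1 ∪ U (-1) := by
    intro x hx
    obtain ⟨σ, hσ | hσ, r, hr, h⟩ := P.exists_halfDisc hx
    · exact Or.inl ⟨x, hx, r, hr, hσ ▸ h, by simpa using hr⟩
    · exact Or.inr ⟨x, hx, r, hr, hσ ▸ h, by simpa using hr⟩
  have hdis : P.openSide i ∩ (U 1 ∩ U (-1)) = ∅ := by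
    ext z
    simp only [mem_inter_iff, mem_empty_iff_false, iff_false, not_and]
    rintro hz ⟨x, hx, r, -, h, hzr⟩ ⟨x', hx', r', -, h', hzr'⟩
    obtain ⟨a, ha, H⟩ := hshift 1 x hx z hz r h hzr
    obtain ⟨a', ha', H'⟩ := hshift (-1) x' hx' z hz r' h' hzr'
    obtain ⟨w, hw, hc⟩ := exists_dist_lt_cross (P.edge i) z (P.edge_ne_zero i)
      (lt_min ha ha') 1 one_ne_zero
    exact (H' w (hw.trans_le (min_le_right _ _))).2.1 (by linarith)
      (interior_subset ((H w (hw.trans_le (min_le_left _ _))).1 hc))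
  rcases isPreconnected_iff_subset_of_disjoint.1 hpre _ _ (hU 1) (hU (-1)) hcov hdis with h | h
  · refine ⟨1, Or.inl rfl, fun z hz => ?_⟩
    obtain ⟨x, hx, r, -, h, hzr⟩ := h hz
    exact hshift 1 x hx z hz r h hzr
  · refine ⟨-1, Or.inr rfl, fun z hz => ?_⟩
    obtain ⟨x, hx, r, -, h, hzr⟩ := h hz
    exact hshift (-1) x hx z hz r h hzr

/-- The sign telling on which side of the `i`-th side the table lies. -/
def sign (i : Fin n) : ℝ := (P.exists_sign i).choose

theorem sign_eq (i : Fin n) : P.sign i = 1 ∨ P.sign i = -1 := (P.exists_sign i).choose_spec.1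

theorem sign_ne_zero (i : Fin n) : P.sign i ≠ 0 := by
  rcases P.sign_eq i with h | h <;> rw [h] <;> norm_num

theorem exists_halfDisc_sign {x : ℂ} {i : Fin n} (hx : x ∈ P.openSide i) :
    ∃ r > 0, P.HalfDisc i (P.sign i) x r := (P.exists_sign i).choose_spec.2 x hx

/-- The inward component of a vector at the `i`-th side. -/
def inward (i : Fin n) (v : ℂ) : ℝ := P.sign i * cross (P.edge i) v

theorem inward_mul (i : Fin n) (t : ℝ) (v : ℂ) : P.inward i (t * v) = t * P.inward i v := by
  unfold inward; rw [cross_mul_right]; ring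

theorem inward_neg (i : Fin n) (v : ℂ) : P.inward i (-v) = - P.inward i v := by
  unfold inward; rw [cross_neg_right]; ring

theorem inward_ne_zero_iff {i : Fin n} {v : ℂ} : P.inward i v ≠ 0 ↔ cross v (P.edge i) ≠ 0 := by
  unfold inward; rw [cross_comm v]; simp [P.sign_ne_zero i]

theorem dist_add_mul_circle (x : ℂ) (s : ℝ) (θ : Circle) : dist (x + s * (θ : ℂ)) x = |s| := by
  rw [dist_eq_norm, add_sub_cancel_left, norm_mul, Complex.norm_real, Circle.norm_coe, mul_one,
    Real.norm_eq_abs]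

theorem inward_pos_of_mem_interior {x : ℂ} {i : Fin n} (hx : x ∈ P.openSide i) {θ : Circle} {ε : ℝ}
    (hε : 0 < ε) (h : ∀ s ∈ Ioo 0 ε, x + (s : ℂ) * (θ : ℂ) ∈ interior P.region) :
    0 < P.inward i θ := by
  obtain ⟨r, hr, H⟩ := P.exists_halfDisc_sign hx
  set s := min ε r / 2 with hs
  have hs0 : 0 < s := by have := lt_min hε hr; positivity
  have hs1 : s < ε := by have := min_le_left ε r; linarith
  have hs2 : s < r := by have := min_le_right ε r; linarith
  have hi := h s ⟨hs0, hs1⟩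
  have hd := H (x + s * (θ : ℂ)) (by rwa [dist_add_mul_circle, abs_of_pos hs0])
  rw [add_sub_cancel_left] at hd
  by_contra hneg
  rcases (not_lt.1 hneg).lt_or_eq with h0 | h0
  · refine hd.2.1 ?_ (interior_subset hi)
    have := P.inward_mul i s θ
    unfold inward at this h0
    rw [this]; exact mul_neg_of_pos_of_neg hs0 h0
  · have h0' : cross (P.edge i) (s * (θ : ℂ)) = 0 := by
      rw [cross_mul_right]
      unfold inward at h0
      rcases mul_eq_zero.1 h0 with h0 | h0
      · exact absurd h0 (P.sign_ne_zero i)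
      · rw [h0, mul_zero]
    exact P.not_mem_interior_of_mem_frontier (P.openSide_subset_frontier i (hd.2.2 h0')) hi

/-- Near `x`, the points of `S` move into the interior of the table in direction `θ`, for a time
that is bounded below. -/
def StartsAt (S : Set ℂ) (x : ℂ) (θ : Circle) : Prop :=
  ∃ r > 0, ∀ x' ∈ S, dist x' x < r → ∀ s ∈ Ioo 0 r, x' + (s : ℂ) * (θ : ℂ) ∈ interior P.region

theorem startsAt_openSide {x : ℂ} {i : Fin n} (hx : x ∈ P.openSide i) {θ : Circle}
    (h : 0 < P.inward i θ) : P.StartsAt (P.openSide i) x θ := by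
  obtain ⟨r, hr, H⟩ := P.exists_halfDisc_sign hx
  refine ⟨r / 2, by positivity, fun x' hx' hd s hs => (H _ ?_).1 ?_⟩
  · have := dist_add_mul_circle x' s θ
    rw [abs_of_pos hs.1] at this
    linarith [dist_triangle (x' + s * (θ : ℂ)) x' x, hs.2]
  · have e : x' + s * (θ : ℂ) - x = (x' - x) + s * (θ : ℂ) := by ring
    rw [e, cross_add_right, P.cross_edge_eq_zero hx hx', zero_add]
    have := P.inward_mul i s θ
    rw [inward] at this
    rw [this]; exact mul_pos hs.1 h

theorem startsAt_interior {x : ℂ} (hx : x ∈ interior P.region) (θ : Circle) :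
    P.StartsAt (interior P.region) x θ := by
  obtain ⟨r, hr, H⟩ := Metric.isOpen_iff.1 isOpen_interior x hx
  refine ⟨r / 2, by positivity, fun x' _ hd s hs => H ?_⟩
  have := dist_add_mul_circle x' s θ
  rw [abs_of_pos hs.1] at this
  rw [Metric.mem_ball]
  linarith [dist_triangle (x' + s * (θ : ℂ)) x' x, hs.2]

theorem mem_phaseSpace_iff {u : ℂ × Circle} :
    u ∈ P.phaseSpace ↔ ∃ i, u.1 ∈ P.openSide i ∧ 0 < P.inward i u.2 := by
  constructor
  · rintro ⟨⟨i, hi⟩, ε, hε, h⟩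
    exact ⟨i, hi, P.inward_pos_of_mem_interior hi hε h⟩
  · rintro ⟨i, hi, h⟩
    obtain ⟨r, hr, H⟩ := P.startsAt_openSide hi h
    exact ⟨⟨i, hi⟩, r, hr, H _ hi (by simpa using hr)⟩

theorem mk_mem_phaseSpace_iff {x : ℂ} {θ : Circle} {i : Fin n} (hx : x ∈ P.openSide i) :
    (x, θ) ∈ P.phaseSpace ↔ 0 < P.inward i θ := by
  rw [mem_phaseSpace_iff]
  constructor
  · rintro ⟨j, hj, h⟩
    rwa [P.openSide_inj hx hj]
  · exact fun h => ⟨i, hx, h⟩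

/-! ### Chords and their persistence under small displacements -/

variable {P}

theorem IsChord.reverse {x y : ℂ} {θ : Circle} (h : P.IsChord x θ y) : P.IsChord y (-θ) x := by
  obtain ⟨t, ht, rfl, H⟩ := h
  refine ⟨t, ht, by simp, fun s hs => ?_⟩
  have := H (t - s) ⟨by linarith [hs.2], by linarith [hs.1]⟩
  convert this using 1
  simp; ring

theorem IsChord.inward_pos {x y : ℂ} {θ : Circle} (h : P.IsChord x θ y) {i : Fin n}
    (hx : x ∈ P.openSide i) : 0 < P.inward i θ := by
  obtain ⟨t, ht, -, H⟩ := h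
  exact P.inward_pos_of_mem_interior hx ht H

theorem IsChord.inward_neg {x y : ℂ} {θ : Circle} (h : P.IsChord x θ y) {i : Fin n}
    (hy : y ∈ P.openSide i) : P.inward i θ < 0 := by
  have := h.reverse.inward_pos hy
  rw [Circle.coe_neg, BilliardTable.inward_neg] at this
  linarith

theorem IsChord.eq_of_frontier {x y y' : ℂ} {θ : Circle} (h : P.IsChord x θ y)
    (h' : P.IsChord x θ y') (hy : y ∈ frontier P.region) (hy' : y' ∈ frontier P.region) :
    y = y' := by
  obtain ⟨t, ht, rfl, H⟩ := h
  obtain ⟨t', ht', rfl, H'⟩ := h'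
  rcases lt_trichotomy t t' with hlt | rfl | hlt
  · exact absurd (H' t ⟨ht, hlt⟩) (P.not_mem_interior_of_mem_frontier hy)
  · rfl
  · exact absurd (H t' ⟨ht', hlt⟩) (P.not_mem_interior_of_mem_frontier hy')

theorem IsChord.eq_of_frontier_left {x x' y : ℂ} {θ : Circle} (h : P.IsChord x θ y)
    (h' : P.IsChord x' θ y) (hx : x ∈ frontier P.region) (hx' : x' ∈ frontier P.region) :
    x = x' := h.reverse.eq_of_frontier h'.reverse hx hx'

theorem IsChord.cross_eq {x y : ℂ} {θ : Circle} (h : P.IsChord x θ y) :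
    cross θ y = cross θ x := by
  obtain ⟨t, -, rfl, -⟩ := h
  rw [cross_add_right, cross_mul_right, cross_same]; ring

/-- A chord issuing from `x` reaches every intermediate point. -/
theorem IsChord.of_mem_openSegment {x y z : ℂ} {θ : Circle} (h : P.IsChord x θ y)
    (hz : z ∈ openSegment ℝ x y) :
    P.IsChord x θ z ∧ P.IsChord z θ y ∧ z ∈ interior P.region := by
  obtain ⟨t, ht, rfl, H⟩ := h
  rw [openSegment_eq_image'] at hz
  obtain ⟨a, ha, rfl⟩ := hz
  have e : x + a • (x + t * (θ : ℂ) - x) = x + ((a * t : ℝ) : ℂ) * (θ : ℂ) := by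
    rw [add_sub_cancel_left, Complex.real_smul]; push_cast; ring
  simp only [e]
  have h1 : 0 < a * t := mul_pos ha.1 ht
  have h2 : a * t < t := by nlinarith [ha.2]
  refine ⟨⟨a * t, h1, rfl, fun s hs => H s ⟨hs.1, hs.2.trans h2⟩⟩,
    ⟨t - a * t, by linarith, by push_cast; ring, fun s hs => ?_⟩, H _ ⟨h1, h2⟩⟩
  have := H (a * t + s) ⟨by linarith [hs.1], by linarith [hs.2]⟩
  convert this using 1
  push_cast; ring

theorem IsChord.trans {x y z : ℂ} {θ : Circle} (h : P.IsChord x θ y) (h' : P.IsChord y θ z)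
    (hy : y ∈ interior P.region) : P.IsChord x θ z := by
  obtain ⟨t, ht, rfl, H⟩ := h
  obtain ⟨t', ht', rfl, H'⟩ := h'
  refine ⟨t + t', by linarith, by push_cast; ring, fun s hs => ?_⟩
  rcases lt_trichotomy s t with hlt | rfl | hlt
  · exact H s ⟨hs.1, hlt⟩
  · exact hy
  · have := H' (s - t) ⟨by linarith, by linarith [hs.2]⟩
    convert this using 1
    push_cast; ring

theorem IsChord.mem_openSegment {x y z : ℂ} {θ : Circle} (h : P.IsChord x θ y)
    (h' : P.IsChord y θ z) : y ∈ openSegment ℝ x z := by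
  obtain ⟨t, ht, rfl, H⟩ := h
  obtain ⟨t', ht', rfl, H'⟩ := h'
  rw [openSegment_eq_image']
  refine ⟨t / (t + t'), ⟨by positivity, by rw [div_lt_one (by positivity)]; linarith⟩, ?_⟩
  have : (t : ℂ) + t' ≠ 0 := by
    have : t + t' ≠ 0 := by positivity
    exact_mod_cast this
  simp only [Complex.real_smul]
  push_cast
  field_simp
  ring

variable (P)

theorem exists_chord {x : ℂ} {θ : Circle} {ε : ℝ} (hε : 0 < ε)
    (h : ∀ s ∈ Ioo 0 ε, x + (s : ℂ) * (θ : ℂ) ∈ interior P.region) :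
    ∃ y ∈ frontier P.region, P.IsChord x θ y := by
  set Z : Set ℝ := {t | ε ≤ t ∧ x + (t : ℂ) * (θ : ℂ) ∉ interior P.region} with hZ
  have hcont : Continuous fun t : ℝ => x + (t : ℂ) * (θ : ℂ) := by fun_prop
  have hZc : IsClosed Z :=
    isClosed_Ici.inter (isOpen_interior.isClosed_compl.preimage hcont)
  obtain ⟨R, hR⟩ := P.isCompact_region.isBounded.subset_ball x
  have hne : Z.Nonempty := by
    refine ⟨max ε R, le_max_left _ _, fun hi => ?_⟩
    have h1 := hR (interior_subset hi)
    rw [Metric.mem_ball, dist_add_mul_circle, abs_of_pos (lt_max_of_lt_left hε)] at h1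
    exact absurd h1 (not_lt.2 (le_max_right _ _))
  have hbd : BddBelow Z := ⟨ε, fun t ht => ht.1⟩
  have hm := hZc.csInf_mem hne hbd
  set t := sInf Z
  have ht : 0 < t := hε.trans_le hm.1
  have hin : ∀ s ∈ Ioo 0 t, x + (s : ℂ) * (θ : ℂ) ∈ interior P.region := by
    intro s hs
    by_contra hni
    by_cases hse : s < ε
    · exact hni (h s ⟨hs.1, hse⟩)
    · exact absurd (csInf_le hbd ⟨not_lt.1 hse, hni⟩) (not_le.2 hs.2)
  refine ⟨_, ⟨?_, hm.2⟩, t, ht, rfl, hin⟩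
  have hcl : t ∈ closure (Ioo 0 t) := by
    rw [closure_Ioo ht.ne]; exact ⟨ht.le, le_rfl⟩
  have := hcont.continuousAt.continuousWithinAt.mem_closure (s := Ioo 0 t) (t := interior P.region)
    hcl hin
  exact closure_mono interior_subset this

theorem exists_chord_of_interior {x : ℂ} (hx : x ∈ interior P.region) (θ : Circle) :
    ∃ y ∈ frontier P.region, P.IsChord x θ y := by
  obtain ⟨r, hr, H⟩ := P.startsAt_interior hx θ
  exact P.exists_chord hr (H x hx (by simpa using hr))

theorem exists_chord_of_phaseSpace {u : ℂ × Circle} (hu : u ∈ P.phaseSpace) :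
    ∃ y ∈ frontier P.region, P.IsChord u.1 u.2 y := by
  obtain ⟨-, ε, hε, h⟩ := hu
  exact P.exists_chord hε h

/-- The middle part of the chord is compact and has a tube around it inside the table; the two
`StartsAt` hypotheses take care of the ends. Equality of `cross θ` puts the new endpoints on one
line of direction `θ`. -/
theorem chord_stable {S S' : Set ℂ} {x y : ℂ} {θ : Circle} (h : P.IsChord x θ y)
    (hS : P.StartsAt S x θ) (hS' : P.StartsAt S' y (-θ)) :
    ∃ r > 0, ∀ x' ∈ S, ∀ y' ∈ S', dist x' x < r → dist y' y < r → cross θ x' = cross θ y' →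
      P.IsChord x' θ y' := by
  obtain ⟨t, ht, rfl, H⟩ := h
  obtain ⟨r₁, hr₁, H₁⟩ := hS
  obtain ⟨r₂, hr₂, H₂⟩ := hS'
  set a := min (min r₁ (r₂ / 2)) (t / 4) with ha
  have ha0 : 0 < a := by positivity
  have ha1 : a ≤ r₁ := (min_le_left _ _).trans (min_le_left _ _)
  have ha2 : a ≤ r₂ / 2 := (min_le_left _ _).trans (min_le_right _ _)
  have ha3 : a ≤ t / 4 := min_le_right _ _
  have hK : IsCompact ((fun s : ℝ => x + (s : ℂ) * (θ : ℂ)) '' Icc a (t - a)) :=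
    isCompact_Icc.image (by fun_prop)
  obtain ⟨δ, hδ, hthick⟩ := hK.exists_thickening_subset_open (isOpen_interior (s := P.region)) (by
    rintro _ ⟨s, hs, rfl⟩
    exact H s ⟨by linarith [hs.1], by linarith [hs.2]⟩)
  refine ⟨min δ (a / 4), by positivity, fun x' hx' y' hy' hdx hdy hc => ?_⟩
  have hdx1 : dist x' x < δ := hdx.trans_le (min_le_left _ _)
  have hdx2 : dist x' x < a / 4 := hdx.trans_le (min_le_right _ _)
  have hdy2 : dist y' (x + t * (θ : ℂ)) < a / 4 := hdy.trans_le (min_le_right _ _)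
  obtain ⟨t', ht'⟩ := exists_real_mul_of_cross_eq_zero (u := (θ : ℂ)) (v := y' - x') (by simp)
    (by rw [cross_sub_right, hc, sub_self])
  have hy'e : y' = x' + t' * (θ : ℂ) := by linear_combination ht'
  have htt : |t' - t| < a / 2 := by
    have e : ((t' - t : ℝ) : ℂ) * (θ : ℂ) = (y' - (x + t * (θ : ℂ))) - (x' - x) := by
      rw [hy'e]; push_cast; ring
    have e2 : |t' - t| = ‖((t' - t : ℝ) : ℂ) * (θ : ℂ)‖ := by
      rw [norm_mul, Circle.norm_coe, mul_one, Complex.norm_real, Real.norm_eq_abs]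
    rw [e2, e]
    refine (norm_sub_le _ _).trans_lt ?_
    rw [← dist_eq_norm, ← dist_eq_norm]; linarith
  obtain ⟨htt1, htt2⟩ := abs_lt.1 htt
  refine ⟨t', by linarith, hy'e, fun s hs => ?_⟩
  by_cases hs1 : s < r₁
  · exact H₁ x' hx' (by linarith) s ⟨hs.1, hs1⟩
  by_cases hs2 : t' - s < r₂
  · have := H₂ y' hy' (by linarith) (t' - s) ⟨by linarith [hs.2], hs2⟩
    convert this using 1
    rw [hy'e, Circle.coe_neg]; push_cast; ring
  apply hthick
  rw [Metric.mem_thickening_iff]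
  refine ⟨_, mem_image_of_mem _ ⟨by linarith, by linarith⟩ (x := s), ?_⟩
  simpa [dist_eq_norm] using hdx1

/-- The new endpoint is the projection of `x'` along `θ` to the line of the side, which is
continuous because an arriving chord is transversal to the side. -/
theorem chord_local {S : Set ℂ} {x y : ℂ} {θ : Circle} {j : Fin n} (h : P.IsChord x θ y)
    (hS : P.StartsAt S x θ) (hy : y ∈ P.openSide j) {ε : ℝ} (hε : 0 < ε) :
    ∃ r > 0, ∀ x' ∈ S, dist x' x < r → ∃ y' ∈ P.openSide j, dist y' y < ε ∧ P.IsChord x' θ y' := by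
  have hin := h.inward_neg hy
  have hc : cross θ (P.edge j) ≠ 0 := P.inward_ne_zero_iff.1 hin.ne
  obtain ⟨r₀, hr₀, H₀⟩ := P.exists_ball_frontier hy
  obtain ⟨r₁, hr₁, H₁⟩ := P.chord_stable h hS (P.startsAt_openSide hy (θ := -θ) (by
    rw [Circle.coe_neg, P.inward_neg]; linarith))
  let f : ℂ → ℂ := fun x' => y + ((cross θ (x' - x) / cross θ (P.edge j) : ℝ) : ℂ) * P.edge j
  have hf : Continuous f := by
    have := continuous_cross (θ : ℂ)
    fun_prop
  have hf0 : f x = y := by simp [f, cross]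
  have := Metric.continuousAt_iff.1 (hf.continuousAt (x := x)) (min ε (min r₀ r₁)) (by positivity)
  obtain ⟨δ, hδ, Hδ⟩ := this
  rw [hf0] at Hδ
  refine ⟨min δ r₁, by positivity, fun x' hx' hd => ?_⟩
  have hd' := Hδ (hd.trans_le (min_le_left _ _))
  have hmem : f x' ∈ P.openSide j := by
    refine (H₀ _ (hd'.trans_le ((min_le_right _ _).trans (min_le_left _ _)))).2 ?_
    simp only [f, add_sub_cancel_left, cross_mul_right, cross_same, mul_zero]
  refine ⟨f x', hmem, hd'.trans_le (min_le_left _ _), H₁ x' hx' _ hmem (hd.trans_le (min_le_right _ _))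
    (hd'.trans_le ((min_le_right _ _).trans (min_le_right _ _))) ?_⟩
  simp only [f, cross_add_right, cross_mul_right, h.cross_eq, cross_sub_right]
  field_simp
  ring

end BilliardTable

theorem abs_cross_le (u v : ℂ) : |cross u v| ≤ 2 * (‖u‖ * ‖v‖) := by
  unfold cross
  refine (abs_sub _ _).trans ?_
  rw [abs_mul, abs_mul]
  have h1 := mul_le_mul (Complex.abs_re_le_norm u) (Complex.abs_im_le_norm v) (abs_nonneg _)
    (norm_nonneg u)
  have h2 := mul_le_mul (Complex.abs_im_le_norm u) (Complex.abs_re_le_norm v) (abs_nonneg _)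
    (norm_nonneg u)
  linarith

theorem exists_lt_map_eq_of_finite {α : Type*} {s : Set ℕ} (hs : s.Infinite) {f : ℕ → α}
    {t : Set α} (ht : t.Finite) (h : ∀ k ∈ s, f k ∈ t) : ∃ k ∈ s, ∃ l ∈ s, k < l ∧ f k = f l := by
  obtain ⟨k, hk, l, hl, hne, he⟩ := hs.exists_ne_map_eq_of_mapsTo h ht
  rcases hne.lt_or_gt with hlt | hlt
  · exact ⟨k, hk, l, hl, hlt, he⟩
  · exact ⟨l, hl, k, hk, hlt, he.symm⟩

/-! ### The billiard map, its iterates and time reversal -/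

namespace BilliardTable

variable {n : ℕ} [NeZero n] (P : BilliardTable n)

/-- The reflection in the `i`-th side, acting on directions. -/
def reflect (i : Fin n) (θ : Circle) : Circle :=
  ⟨P.sideReflection i θ,
    mem_sphere_zero_iff_norm.2 (((P.sideReflection i).norm_map _).trans θ.norm_coe)⟩

theorem coe_reflect (i : Fin n) (θ : Circle) : (P.reflect i θ : ℂ) = P.sideReflection i θ := rfl

theorem reflect_reflect (i : Fin n) (θ : Circle) : P.reflect i (P.reflect i θ) = θ := by
  apply Circle.ext
  rw [coe_reflect, coe_reflect, sideReflection, Submodule.reflection_reflection]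

theorem reflect_neg (i : Fin n) (θ : Circle) : P.reflect i (-θ) = -P.reflect i θ := by
  apply Circle.ext
  rw [coe_reflect, Circle.coe_neg, Circle.coe_neg, map_neg, coe_reflect]

theorem cross_reflect (i : Fin n) (θ : Circle) :
    cross (P.edge i) (P.reflect i θ) = - cross (P.edge i) θ := by
  have : (P.reflect i θ : ℂ) =
      ((2 * (inner ℝ (P.edge i) (θ : ℂ) / ‖P.edge i‖ ^ 2) : ℝ) : ℂ) * P.edge i + -(θ : ℂ) := by
    rw [coe_reflect, sideReflection, Submodule.reflection_singleton_apply]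
    simp only [edge, Complex.real_smul, nsmul_eq_mul, RCLike.ofReal_real_eq_id, id_eq]
    push_cast; ring
  rw [this, cross_add_right, cross_mul_right, cross_same, cross_neg_right]; ring

theorem inward_reflect (i : Fin n) (θ : Circle) :
    P.inward i (P.reflect i θ) = - P.inward i θ := by
  unfold inward; rw [cross_reflect]; ring

/-- A bounce reverses the transversal orientation: the origin of the factor `(-1) ^ k` in
`iterate_strip`. -/
theorem cross_reflect_sub {i : Fin n} {x y : ℂ} (hx : x ∈ P.openSide i) (hy : y ∈ P.openSide i)
    (θ : Circle) : cross (P.reflect i θ) (y - x) = - cross θ (y - x) := by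
  obtain ⟨t, ht⟩ := exists_real_mul_of_cross_eq_zero (P.edge_ne_zero i) (P.cross_edge_eq_zero hx hy)
  rw [ht, cross_mul_right, cross_mul_right, cross_comm, cross_reflect, cross_comm (θ : ℂ)]; ring

theorem step_iff {u v : ℂ × Circle} : P.Step u v ↔
    ∃ j, v.1 ∈ P.openSide j ∧ v.2 = P.reflect j u.2 ∧ P.IsChord u.1 u.2 v.1 := by
  constructor
  · rintro ⟨hc, j, hj, h⟩
    exact ⟨j, hj, Circle.ext h, hc⟩
  · rintro ⟨j, hj, h, hc⟩
    exact ⟨hc, j, hj, by rw [h, coe_reflect]⟩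

variable {P}

theorem IsChord.step {x y : ℂ} {θ : Circle} {j : Fin n} (h : P.IsChord x θ y)
    (hy : y ∈ P.openSide j) : P.Step (x, θ) (y, P.reflect j θ) :=
  P.step_iff.2 ⟨j, hy, rfl, h⟩

theorem Step.eq_reflect {u v : ℂ × Circle} (h : P.Step u v) {j : Fin n} (hj : v.1 ∈ P.openSide j) :
    v.2 = P.reflect j u.2 := by
  obtain ⟨k, hk, h, -⟩ := P.step_iff.1 h
  rw [h, P.openSide_inj hj hk]

theorem Step.mem {u v : ℂ × Circle} (h : P.Step u v) : v ∈ P.phaseSpace := by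
  obtain ⟨k, hk, h, hc⟩ := P.step_iff.1 h
  refine P.mem_phaseSpace_iff.2 ⟨k, hk, ?_⟩
  rw [h, inward_reflect]
  linarith [hc.inward_neg hk]

theorem mem_frontier_of_mem {u : ℂ × Circle} (h : u ∈ P.phaseSpace) : u.1 ∈ frontier P.region := by
  obtain ⟨⟨i, hi⟩, -⟩ := h
  exact P.openSide_subset_frontier i hi

theorem Step.unique {u v v' : ℂ × Circle} (h : P.Step u v) (h' : P.Step u v') : v = v' := by
  have e : v.1 = v'.1 := h.1.eq_of_frontier h'.1 (mem_frontier_of_mem h.mem) (mem_frontier_of_mem h'.mem)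
  obtain ⟨j, hj, e1, -⟩ := P.step_iff.1 h
  exact Prod.ext e (by rw [e1, h'.eq_reflect (e ▸ hj)])

theorem Step.inj {u u' v : ℂ × Circle} (hu : u ∈ P.phaseSpace) (hu' : u' ∈ P.phaseSpace)
    (h : P.Step u v) (h' : P.Step u' v) : u = u' := by
  obtain ⟨j, hj, e1, hc⟩ := P.step_iff.1 h
  have e2 := h'.eq_reflect hj
  have e : u.2 = u'.2 := by
    rw [← P.reflect_reflect j u.2, ← e1, e2, reflect_reflect]
  have hc' := h'.1
  rw [← e] at hc'
  exact Prod.ext (hc.eq_of_frontier_left hc' (mem_frontier_of_mem hu) (mem_frontier_of_mem hu')) e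

theorem exists_corner_of_not_step {u : ℂ × Circle} (hu : u ∈ P.phaseSpace)
    (h : ¬ ∃ v, P.Step u v) : ∃ c ∈ P.corners, P.IsChord u.1 u.2 c := by
  obtain ⟨y, hy, hc⟩ := P.exists_chord_of_phaseSpace hu
  rcases P.mem_frontier_iff.1 hy with ⟨j, hj⟩ | hy
  · exact absurd ⟨_, hc.step hj⟩ h
  · exact ⟨y, hy, hc⟩

variable (P)

theorem step_local {x y : ℂ} {θ θ' : Circle} {i j : Fin n} (h : P.Step (x, θ) (y, θ'))
    (hx : x ∈ P.openSide i) (hy : y ∈ P.openSide j) {ε : ℝ} (hε : 0 < ε) :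
    ∃ r > 0, ∀ x' ∈ P.openSide i, dist x' x < r →
      ∃ y' ∈ P.openSide j, dist y' y < ε ∧ P.Step (x', θ) (y', θ') := by
  have e : θ' = P.reflect j θ := h.eq_reflect hy
  obtain ⟨r, hr, H⟩ := P.chord_local h.1 (P.startsAt_openSide hx (h.1.inward_pos hx)) hy hε
  refine ⟨r, hr, fun x' hx' hd => ?_⟩
  obtain ⟨y', hy', hd', hc⟩ := H x' hx' hd
  exact ⟨y', hy', hd', e ▸ hc.step hy'⟩

theorem step_local_backward {x y : ℂ} {θ θ' : Circle} {i j : Fin n} (h : P.Step (x, θ) (y, θ'))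
    (hx : x ∈ P.openSide i) (hy : y ∈ P.openSide j) {ε : ℝ} (hε : 0 < ε) :
    ∃ r > 0, ∀ y' ∈ P.openSide j, dist y' y < r →
      ∃ x' ∈ P.openSide i, dist x' x < ε ∧ P.Step (x', θ) (y', θ') := by
  have e : θ' = P.reflect j θ := h.eq_reflect hy
  obtain ⟨r, hr, H⟩ := P.chord_local h.1.reverse
    (P.startsAt_openSide hy (h.1.reverse.inward_pos hy)) hx hε
  refine ⟨r, hr, fun y' hy' hd => ?_⟩
  obtain ⟨x', hx', hd', hc⟩ := H y' hy' hd
  have := hc.reverse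
  rw [neg_neg] at this
  exact ⟨x', hx', hd', e ▸ this.step hy'⟩

/-- The involution of the phase space that reverses time. -/
def rev (u : ℂ × Circle) : ℂ × Circle :=
  open Classical in if h : ∃ i, u.1 ∈ P.openSide i then (u.1, -P.reflect h.choose u.2) else u

theorem rev_mk {x : ℂ} {i : Fin n} (hx : x ∈ P.openSide i) (θ : Circle) :
    P.rev (x, θ) = (x, -P.reflect i θ) := by
  have h : ∃ i, x ∈ P.openSide i := ⟨i, hx⟩
  unfold rev
  rw [dif_pos h, P.openSide_inj h.choose_spec hx]

theorem rev_rev {u : ℂ × Circle} (hu : u ∈ P.phaseSpace) : P.rev (P.rev u) = u := by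
  obtain ⟨x, θ⟩ := u
  obtain ⟨⟨i, hi⟩, -⟩ := hu
  rw [P.rev_mk hi, P.rev_mk hi, reflect_neg, reflect_reflect, neg_neg]

theorem rev_mem {u : ℂ × Circle} (hu : u ∈ P.phaseSpace) : P.rev u ∈ P.phaseSpace := by
  obtain ⟨x, θ⟩ := u
  obtain ⟨⟨i, hi⟩, -⟩ := id hu
  rw [P.rev_mk hi]
  rw [P.mk_mem_phaseSpace_iff hi] at hu ⊢
  rwa [Circle.coe_neg, inward_neg, inward_reflect, neg_neg]

variable {P} in
theorem Step.rev {u v : ℂ × Circle} (hu : u ∈ P.phaseSpace) (h : P.Step u v) :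
    P.Step (P.rev v) (P.rev u) := by
  obtain ⟨j, hj, e, hc⟩ := P.step_iff.1 h
  obtain ⟨⟨i, hi⟩, -⟩ := hu
  obtain ⟨x, θ⟩ := u
  obtain ⟨y, θ'⟩ := v
  simp only at e hj hc hi
  rw [P.rev_mk hj, P.rev_mk hi, e, reflect_reflect, ← reflect_neg]
  exact hc.reverse.step hi

/-- The billiard map, extended by the identity to the points where it is not defined. -/
def next (u : ℂ × Circle) : ℂ × Circle :=
  open Classical in if h : ∃ v, P.Step u v then h.choose else u

theorem step_next {u : ℂ × Circle} (h : ∃ v, P.Step u v) : P.Step u (P.next u) := by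
  unfold next; rw [dif_pos h]; exact h.choose_spec

variable {P} in
theorem Step.next_eq {u v : ℂ × Circle} (h : P.Step u v) : P.next u = v :=
  (P.step_next ⟨v, h⟩).unique h

/-- The first `k` iterates of the billiard map are defined at `u`. -/
def Alive (k : ℕ) (u : ℂ × Circle) : Prop := ∀ l < k, ∃ v, P.Step (P.next^[l] u) v

theorem alive_zero (u : ℂ × Circle) : P.Alive 0 u := fun _ h => absurd h (Nat.not_lt_zero _)

variable {P}

theorem Alive.mono {k l : ℕ} {u : ℂ × Circle} (h : P.Alive l u) (hkl : k ≤ l) : P.Alive k u :=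
  fun a ha => h a (ha.trans_le hkl)

theorem Alive.step {k l : ℕ} {u : ℂ × Circle} (h : P.Alive k u) (hl : l < k) :
    P.Step (P.next^[l] u) (P.next^[l + 1] u) := by
  rw [Function.iterate_succ_apply']
  exact P.step_next (h l hl)

theorem Alive.mem {k : ℕ} {u : ℂ × Circle} (hu : u ∈ P.phaseSpace) (h : P.Alive k u) :
    P.next^[k] u ∈ P.phaseSpace := by
  cases k with
  | zero => exact hu
  | succ k => exact (h.step (Nat.lt_succ_self k)).mem

variable (P) in
theorem alive_succ_iff {k : ℕ} {u : ℂ × Circle} :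
    P.Alive (k + 1) u ↔ P.Alive k u ∧ ∃ v, P.Step (P.next^[k] u) v := by
  constructor
  · exact fun h => ⟨h.mono k.le_succ, h k k.lt_succ_self⟩
  · rintro ⟨h, h'⟩ l hl
    rcases Nat.lt_succ_iff_lt_or_eq.1 hl with hl | rfl
    · exact h l hl
    · exact h'

variable (P) in
theorem alive_add_iff {k l : ℕ} {u : ℂ × Circle} :
    P.Alive (k + l) u ↔ P.Alive k u ∧ P.Alive l (P.next^[k] u) := by
  constructor
  · refine fun h => ⟨h.mono (Nat.le_add_right k l), fun a ha => ?_⟩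
    rw [← Function.iterate_add_apply, add_comm]
    exact h _ (by omega)
  · rintro ⟨h, h'⟩ a ha
    by_cases hak : a < k
    · exact h a hak
    · have := h' (a - k) (by omega)
      rwa [← Function.iterate_add_apply, Nat.sub_add_cancel (not_lt.1 hak)] at this

theorem iterate_next_inj {k : ℕ} {u v : ℂ × Circle} (hu : u ∈ P.phaseSpace) (hv : v ∈ P.phaseSpace)
    (hku : P.Alive k u) (hkv : P.Alive k v) (h : P.next^[k] u = P.next^[k] v) : u = v := by
  induction k with
  | zero => exact h
  | succ k ih =>
    have h1 := hku.mono k.le_succ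
    have h2 := hkv.mono k.le_succ
    refine ih h1 h2 (Step.inj (h1.mem hu) (h2.mem hv) (hku.step k.lt_succ_self) ?_)
    rw [h]; exact hkv.step k.lt_succ_self

/-- By injectivity of the map, a coincidence between two orbits at times `k ≤ l` pulls back to a hit
after `l - k` steps. -/
theorem eq_iterate_sub {k l : ℕ} {u v : ℂ × Circle} (hu : u ∈ P.phaseSpace)
    (hv : v ∈ P.phaseSpace) (hkl : k ≤ l) (hku : P.Alive k u) (hlv : P.Alive l v)
    (h : P.next^[k] u = P.next^[l] v) : P.next^[l - k] v = u := by
  have e : l = (l - k) + k := by omega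
  rw [e] at hlv
  have h1 := P.alive_add_iff.1 hlv
  refine (iterate_next_inj hu (h1.1.mem hv) hku h1.2 ?_).symm
  rw [← Function.iterate_add_apply, h]
  congr 2; omega

/-! ### Strips of parallel trajectories and their returns -/

variable (P)

theorem add_mul_sub_mem_openSide {i : Fin n} {x x' : ℂ} (hx : x ∈ P.openSide i)
    (hx' : x' ∈ P.openSide i) {t : ℝ} (ht : t ∈ Icc (0 : ℝ) 1) :
    x + (t : ℂ) * (x' - x) ∈ P.openSide i := by
  have := (convex_openSegment (𝕜 := ℝ) (P.poly i) (P.poly (finRotate n i))).add_smul_sub_mem hx hx' ht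
  simpa [openSide] using this

theorem add_mul_mem_openSide {i : Fin n} {x d : ℂ} (hx : x ∈ P.openSide i)
    (hx' : x + d ∈ P.openSide i) {t : ℝ} (ht : t ∈ Icc (0 : ℝ) 1) :
    x + (t : ℂ) * d ∈ P.openSide i := by
  simpa using P.add_mul_sub_mem_openSide hx hx' ht

/-- The side that is hit depends locally constantly on the parameter, hence is the same for the
whole interval. Since `cross θ` is preserved, the landing point is affine in the parameter. -/
theorem step_strip {i : Fin n} {x x' : ℂ} {θ : Circle} (hx : x ∈ P.openSide i)
    (hx' : x' ∈ P.openSide i)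
    (h : ∀ t ∈ Icc (0 : ℝ) 1, ∃ v, P.Step (x + (t : ℂ) * (x' - x), θ) v) :
    ∃ j, ∃ y ∈ P.openSide j, ∃ y' ∈ P.openSide j,
      (∀ t ∈ Icc (0 : ℝ) 1, P.Step (x + (t : ℂ) * (x' - x), θ)
        (y + (t : ℂ) * (y' - y), P.reflect j θ)) ∧
      cross θ (y' - y) = cross θ (x' - x) := by
  choose! v hv using h
  have hv' : ∀ t : Icc (0 : ℝ) 1, ∃ j, (v t).1 ∈ P.openSide j := fun t => (hv t t.2).mem.1
  choose f hf using hv'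
  have hloc : IsLocallyConstant f := by
    rw [IsLocallyConstant.iff_eventually_eq]
    intro t
    obtain ⟨r, hr, H⟩ := P.step_local (hv t t.2) (P.add_mul_sub_mem_openSide hx hx' t.2) (hf t)
      one_pos
    have hcont : Continuous fun s : Icc (0 : ℝ) 1 => x + ((s : ℝ) : ℂ) * (x' - x) := by fun_prop
    filter_upwards [hcont.continuousAt (Metric.ball_mem_nhds _ hr)] with s hs
    obtain ⟨y', hy', -, hstep⟩ := H _ (P.add_mul_sub_mem_openSide hx hx' s.2) hs
    have e := congrArg Prod.fst ((hv s s.2).unique hstep)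
    exact P.openSide_inj (hf s) (by rw [e]; exact hy')
  have h0 : (0 : ℝ) ∈ Icc (0 : ℝ) 1 := by simp
  have h1 : (1 : ℝ) ∈ Icc (0 : ℝ) 1 := by simp
  have hconst : ∀ t (ht : t ∈ Icc (0 : ℝ) 1), (v t).1 ∈ P.openSide (f ⟨0, h0⟩) := by
    intro t ht
    rw [hloc.apply_eq_of_preconnectedSpace ⟨0, h0⟩ ⟨t, ht⟩]
    exact hf ⟨t, ht⟩
  set j := f ⟨0, h0⟩
  have hcr : ∀ t ∈ Icc (0 : ℝ) 1, cross θ (v t).1 = cross θ x + t * cross θ (x' - x) := by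
    intro t ht
    rw [(hv t ht).1.cross_eq, cross_add_right, cross_mul_right]
  refine ⟨j, _, hconst 0 h0, _, hconst 1 h1, fun t ht => ?_, ?_⟩
  · have hne : cross θ (P.edge j) ≠ 0 :=
      P.inward_ne_zero_iff.1 ((hv t ht).1.inward_neg (hconst t ht)).ne
    have e : (v t).1 = (v 0).1 + (t : ℂ) * ((v 1).1 - (v 0).1) := by
      refine eq_of_line_of_cross_eq (P.edge_ne_zero j) hne ?_ ?_
      · exact P.cross_edge_eq_zero (P.add_mul_sub_mem_openSide (hconst 0 h0) (hconst 1 h1) ht)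
          (hconst t ht)
      · rw [cross_sub_right, cross_add_right, cross_mul_right, cross_sub_right, hcr t ht,
          hcr 0 h0, hcr 1 h1]; ring
    rw [← e]
    exact (hv t ht).1.step (hconst t ht)
  · rw [cross_sub_right, hcr 0 h0, hcr 1 h1]; ring

theorem iterate_strip {i : Fin n} {x x' : ℂ} {θ : Circle} (hx : x ∈ P.openSide i)
    (hx' : x' ∈ P.openSide i) (hu : (x, θ) ∈ P.phaseSpace) (k : ℕ)
    (h : ∀ t ∈ Icc (0 : ℝ) 1, P.Alive k (x + (t : ℂ) * (x' - x), θ)) :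
    ∃ j, ∃ y ∈ P.openSide j, ∃ y' ∈ P.openSide j, ∃ φ, (y, φ) ∈ P.phaseSpace ∧
      (∀ t ∈ Icc (0 : ℝ) 1, P.next^[k] (x + (t : ℂ) * (x' - x), θ) = (y + (t : ℂ) * (y' - y), φ)) ∧
      cross φ (y' - y) = (-1) ^ k * cross θ (x' - x) := by
  induction k with
  | zero => exact ⟨i, x, hx, x', hx', θ, hu, fun t _ => rfl, by simp⟩
  | succ k ih =>
    obtain ⟨j, y, hy, y', hy', φ, hm, H, hc⟩ := ih fun t ht => (h t ht).mono k.le_succ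
    obtain ⟨l, z, hz, z', hz', H', hc'⟩ := P.step_strip (θ := φ) hy hy' fun t ht => by
      rw [← H t ht]; exact h t ht k k.lt_succ_self
    refine ⟨l, z, hz, z', hz', P.reflect l φ, ?_, fun t ht => ?_, ?_⟩
    · have := (H' 0 (by simp)).mem
      simpa using this
    · rw [Function.iterate_succ_apply', H t ht]
      exact (H' t ht).next_eq
    · rw [P.cross_reflect_sub hz hz', hc', hc, pow_succ]; ring

theorem alive_local {i : Fin n} {x : ℂ} {θ : Circle} (hx : x ∈ P.openSide i)
    {k : ℕ} (h : P.Alive k (x, θ)) :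
    ∃ j, (P.next^[k] (x, θ)).1 ∈ P.openSide j ∧ ∀ ε > 0, ∃ r > 0, ∀ x' ∈ P.openSide i,
      dist x' x < r → P.Alive k (x', θ) ∧ (P.next^[k] (x', θ)).1 ∈ P.openSide j ∧
        dist (P.next^[k] (x', θ)).1 (P.next^[k] (x, θ)).1 < ε ∧
        (P.next^[k] (x', θ)).2 = (P.next^[k] (x, θ)).2 := by
  induction k with
  | zero => exact ⟨i, hx, fun ε hε => ⟨ε, hε, fun x' hx' hd => ⟨P.alive_zero _, hx', hd, rfl⟩⟩⟩
  | succ k ih =>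
    obtain ⟨j, hj, H⟩ := ih (h.mono k.le_succ)
    have hs := h.step k.lt_succ_self
    obtain ⟨l, hl⟩ := hs.mem.1
    refine ⟨l, hl, fun ε hε => ?_⟩
    obtain ⟨r', hr', H'⟩ := P.step_local hs hj hl hε
    obtain ⟨r, hr, H⟩ := H r' hr'
    refine ⟨r, hr, fun x' hx' hd => ?_⟩
    obtain ⟨ha, hj', hd', he⟩ := H x' hx' hd
    obtain ⟨y', hy', hdy, hst⟩ := H' _ hj' hd'
    rw [← he] at hst
    have e := hst.next_eq
    refine ⟨P.alive_succ_iff.2 ⟨ha, _, hst⟩, ?_⟩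
    rw [Function.iterate_succ_apply' _ _ (x', θ), e]
    exact ⟨hy', hdy, rfl⟩

variable {P} in
theorem Alive.nhds {i : Fin n} {x : ℂ} {θ : Circle} (hx : x ∈ P.openSide i)
    {k : ℕ} (h : P.Alive k (x, θ)) :
    ∃ r > 0, ∀ x' ∈ P.openSide i, dist x' x < r → P.Alive k (x', θ) := by
  obtain ⟨j, -, H⟩ := P.alive_local hx h
  obtain ⟨r, hr, H⟩ := H 1 one_pos
  exact ⟨r, hr, fun x' hx' hd => (H x' hx' hd).1⟩

theorem mk_mem_phaseSpace_of {i : Fin n} {x x' : ℂ} {θ : Circle} (hx : x ∈ P.openSide i)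
    (hx' : x' ∈ P.openSide i) (hu : (x, θ) ∈ P.phaseSpace) : (x', θ) ∈ P.phaseSpace := by
  rw [P.mk_mem_phaseSpace_iff hx] at hu
  rwa [P.mk_mem_phaseSpace_iff hx']

/-- If the strip between two parallel trajectories is never cut, it returns to itself. -/
theorem exists_return_of_alive {i : Fin n} {x d : ℂ} {θ : Circle} (hx : x ∈ P.openSide i)
    (hxd : x + d ∈ P.openSide i) (hd : d ≠ 0) (hu : (x, θ) ∈ P.phaseSpace)
    (hfin : (range fun k => (P.next^[k] (x, θ)).2).Finite)
    (h : ∀ k, ∀ t ∈ Icc (0 : ℝ) 1, P.Alive k (x + (t : ℂ) * d, θ)) :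
    ∃ m, 0 < m ∧ ∃ t ∈ Ioo (0 : ℝ) 1,
      P.next^[m] (x + ((1 / 2 : ℝ) : ℂ) * d, θ) = (x + (t : ℂ) * d, θ) := by
  have hI0 : (0 : ℝ) ∈ Icc (0 : ℝ) 1 := by simp
  have hIh : (1 / 2 : ℝ) ∈ Icc (0 : ℝ) 1 := by constructor <;> norm_num
  have hstrip := fun k => P.iterate_strip hx hxd hu k (by simpa using h k)
  simp only [add_sub_cancel_left] at hstrip
  choose j y hy y' hy' φ hm H hc using hstrip
  set w : ℝ := |cross θ d| with hw
  have hdne : cross θ d ≠ 0 := by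
    obtain ⟨s, hs⟩ := exists_real_mul_of_cross_eq_zero (P.edge_ne_zero i)
      (P.cross_edge_eq_zero hx hxd)
    rw [add_sub_cancel_left] at hs
    have := P.inward_ne_zero_iff.1 ((P.mk_mem_phaseSpace_iff hx).1 hu).ne'
    rw [hs, cross_mul_right]
    refine mul_ne_zero ?_ this
    rintro rfl
    exact hd (by simpa using hs)
  have hw0 : 0 < w := abs_pos.2 hdne
  let q : ℕ → ℂ := fun k => y k + ((1 / 2 : ℝ) : ℂ) * (y' k - y k)
  have hq : ∀ k, q k ∈ P.openSide (j k) := fun k =>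
    P.add_mul_sub_mem_openSide (hy k) (hy' k) hIh
  obtain ⟨R, hR⟩ := P.isCompact_region.isBounded.exists_norm_le
  -- Pigeonhole on side, direction and the cell of size `w / 2` containing the transversal
  -- coordinate of the strip's midpoint, which is bounded because the table is compact.
  let f : ℕ → Fin n × Circle × ℤ := fun k => (j k, φ k, ⌊cross (φ k) (q k) / (w / 2)⌋)
  have hfr : ∀ k ∈ (univ : Set ℕ), f k ∈ (univ : Set (Fin n)) ×ˢ
      ((range fun k => (P.next^[k] (x, θ)).2) ×ˢ (Icc ⌊-(2 * R) / (w / 2)⌋ ⌊2 * R / (w / 2)⌋)) := by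
    intro k _
    refine ⟨mem_univ _, ⟨k, ?_⟩, ?_⟩
    · have := H k 0 hI0
      simp only [Complex.ofReal_zero, zero_mul, add_zero] at this
      simp only [this, f]
    · have h1 := abs_cross_le (φ k) (q k)
      rw [Circle.norm_coe, one_mul] at h1
      have h2 := hR (q k) (P.isClosed_region.frontier_subset (P.openSide_subset_frontier _ (hq k)))
      obtain ⟨h3, h4⟩ := abs_le.1 h1
      constructor
      · exact Int.floor_le_floor (div_le_div_of_nonneg_right (by linarith) (by positivity))
      · exact Int.floor_le_floor (div_le_div_of_nonneg_right (by linarith) (by positivity))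
  obtain ⟨k, -, l, -, hkl, he⟩ := exists_lt_map_eq_of_finite infinite_univ
    (finite_univ.prod (hfin.prod (finite_Icc _ _))) hfr
  simp only [f, Prod.mk.injEq] at he
  obtain ⟨he1, he2, he3⟩ := he
  have hab := Int.abs_sub_lt_one_of_floor_eq_floor he3
  rw [← sub_div, abs_div, abs_of_pos (show 0 < w / 2 by positivity), div_lt_one (by positivity),
    ← he2, ← cross_sub_right] at hab
  have hcne : cross (φ k) (y' k - y k) ≠ 0 := by
    rw [hc]; exact mul_ne_zero (pow_ne_zero _ (by norm_num)) hdne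
  have hcabs : |cross (φ k) (y' k - y k)| = w := by
    rw [hc, abs_mul, abs_pow, abs_neg, abs_one, one_pow, one_mul]
  -- The offset between the two midpoints in units of the strip's width. As `|a| < 1 / 2`, the later
  -- midpoint lies in the earlier image of the strip, and pulling back `k` steps gives the return.
  set a : ℝ := cross (φ k) (q l - q k) / cross (φ k) (y' k - y k) with ha
  have haa : |a| < 1 / 2 := by
    rw [ha, abs_div, hcabs, div_lt_iff₀ hw0, cross_sub_right, abs_sub_comm, ← cross_sub_right]
    linarith
  obtain ⟨ha1, ha2⟩ := abs_lt.1 haa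
  have ht : 1 / 2 + a ∈ Ioo (0 : ℝ) 1 := ⟨by linarith, by linarith⟩
  have hql : q l ∈ P.openSide (j k) := by rw [he1]; exact hq l
  have heq : q l = y k + ((1 / 2 + a : ℝ) : ℂ) * (y' k - y k) := by
    refine eq_of_line_of_cross_eq (P.edge_ne_zero (j k)) (θ := (φ k : ℂ))
      (P.inward_ne_zero_iff.1 ((P.mk_mem_phaseSpace_iff (hy k)).1 (hm k)).ne') ?_ ?_
    · exact P.cross_edge_eq_zero
        (P.add_mul_sub_mem_openSide (hy k) (hy' k) (Ioo_subset_Icc_self ht)) hql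
    · have : q l - (y k + ((1 / 2 + a : ℝ) : ℂ) * (y' k - y k)) =
          (q l - q k) - (a : ℝ) * (y' k - y k) := by
        simp only [q]; push_cast; ring
      rw [this, cross_sub_right, cross_mul_right, ha]
      field_simp
      ring
  refine ⟨l - k, by omega, 1 / 2 + a, ht, ?_⟩
  refine eq_iterate_sub (P.mk_mem_phaseSpace_of hx (P.add_mul_mem_openSide hx hxd
    (Ioo_subset_Icc_self ht)) hu) (P.mk_mem_phaseSpace_of hx
    (P.add_mul_mem_openSide hx hxd hIh) hu) hkl.le (h k _ (Ioo_subset_Icc_self ht)) (h l _ hIh) ?_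
  rw [H k _ (Ioo_subset_Icc_self ht), H l _ hIh, ← heq, he2]

/-- The strip issuing from a small interval at a point returns to that interval. -/
theorem exists_return {i : Fin n} {x d : ℂ} {θ : Circle} (hx : x ∈ P.openSide i)
    (hxd : x + d ∈ P.openSide i) (hd : d ≠ 0) (hu : (x, θ) ∈ P.phaseSpace)
    (hal : ∀ k, P.Alive k (x, θ))
    (hfin : (range fun k => (P.next^[k] (x, θ)).2).Finite) :
    ∃ m, 0 < m ∧ ∃ s ∈ Ioo (0 : ℝ) 1, ∃ s' ∈ Ioo (0 : ℝ) 1,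
      (∀ t ∈ Icc (0 : ℝ) s, P.Alive m (x + (t : ℂ) * d, θ)) ∧
      P.next^[m] (x + (s : ℂ) * d, θ) = (x + (s' : ℂ) * d, θ) := by
  have hmem : ∀ t ∈ Icc (0 : ℝ) 1, (x + (t : ℂ) * d, θ) ∈ P.phaseSpace := fun t ht =>
    P.mk_mem_phaseSpace_of hx (P.add_mul_mem_openSide hx hxd ht) hu
  by_cases hcase : ∃ s ∈ Ioo (0 : ℝ) 1, ∀ k, ∀ t ∈ Icc (0 : ℝ) s, P.Alive k (x + (t : ℂ) * d, θ)
  · obtain ⟨s, hs, H⟩ := hcase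
    have hsc : (s : ℂ) ≠ 0 := by exact_mod_cast hs.1.ne'
    obtain ⟨m, hm, t, ht, he⟩ := P.exists_return_of_alive hx (d := s * d) (θ := θ)
      (P.add_mul_mem_openSide hx hxd (Ioo_subset_Icc_self hs)) (mul_ne_zero hsc hd) hu hfin
      (fun k t ht => by
        have := H k (t * s) ⟨mul_nonneg ht.1 hs.1.le, by nlinarith [hs.1, ht.2]⟩
        rwa [Complex.ofReal_mul, mul_assoc] at this)
    refine ⟨m, hm, 1 / 2 * s, ⟨by linarith [hs.1], by linarith [hs.1, hs.2]⟩, t * s,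
      ⟨mul_pos ht.1 hs.1, by nlinarith [ht.1, ht.2, hs.1, hs.2]⟩, fun a ha => H m a
      ⟨ha.1, by linarith [ha.2, hs.1]⟩, ?_⟩
    rw [Complex.ofReal_mul, mul_assoc, he, Complex.ofReal_mul, mul_assoc]
  · push Not at hcase
    -- A strip so short that it survives `K` steps is still cut eventually. At its last uncut time
    -- some point of it, other than `x`, runs into a corner.
    have hcut : ∀ K, ∃ k ≥ K, ∃ t ∈ Ioo (0 : ℝ) 1,
        (∀ a ∈ Icc (0 : ℝ) t, P.Alive k (x + (a : ℂ) * d, θ)) ∧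
        ∃ c ∈ P.corners, P.IsChord (P.next^[k] (x + (t : ℂ) * d, θ)).1
          (P.next^[k] (x + (t : ℂ) * d, θ)).2 c := by
      intro K
      obtain ⟨r, hr, Hr⟩ := (hal K).nhds hx
      have hdn : 0 < ‖d‖ := norm_pos_iff.2 hd
      set s := min (1 / 2) (r / (2 * ‖d‖)) with hs
      have hs0 : 0 < s := by positivity
      have hs1 : s < 1 := (min_le_left _ _).trans_lt (by norm_num)
      have hsK : ∀ a ∈ Icc (0 : ℝ) s, P.Alive K (x + (a : ℂ) * d, θ) := by
        intro a ha
        refine Hr _ (P.add_mul_mem_openSide hx hxd ⟨ha.1, ha.2.trans hs1.le⟩) ?_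
        rw [dist_eq_norm, add_sub_cancel_left, norm_mul, Complex.norm_real, Real.norm_eq_abs,
          abs_of_nonneg ha.1]
        have h1 : a ≤ r / (2 * ‖d‖) := ha.2.trans (min_le_right _ _)
        have h2 : r / (2 * ‖d‖) * ‖d‖ = r / 2 := by field_simp
        nlinarith
      have hex := hcase s ⟨hs0, hs1⟩
      classical
      have hspec := Nat.find_spec hex
      have hmin := fun m (hm : m < Nat.find hex) => Nat.find_min hex hm
      set k := Nat.find hex
      push Not at hmin
      have hkK : K < k := by
        by_contra hcon
        obtain ⟨t, ht, hna⟩ := hspec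
        exact hna ((hsK t ht).mono (not_lt.1 hcon))
      obtain ⟨l, hl⟩ : ∃ l, k = l + 1 := ⟨k - 1, by omega⟩
      obtain ⟨t, ht, hna⟩ := hspec
      have hlal := hmin l (by omega)
      have ht0 : t ≠ 0 := by
        rintro rfl
        exact hna (by simpa using hal k)
      have htl := hlal t ht
      refine ⟨l, by omega, t, ⟨lt_of_le_of_ne ht.1 ht0.symm, ht.2.trans_lt hs1⟩,
        fun a ha => hlal a ⟨ha.1, ha.2.trans ht.2⟩, ?_⟩
      refine exists_corner_of_not_step (htl.mem (hmem t ⟨ht.1, ht.2.trans hs1.le⟩)) fun hv => hna ?_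
      rw [hl]
      exact P.alive_succ_iff.2 ⟨htl, hv⟩
    choose! g hg t ht hal' c hc hch using hcut
    -- An uncut strip keeps a common direction, so the directions at the cuts belong to the finite
    -- set of directions of the orbit of `x`.
    have hdir : ∀ K, (P.next^[g K] (x + (t K : ℂ) * d, θ)).2 = (P.next^[g K] (x, θ)).2 := by
      intro K
      obtain ⟨j, y, hy, y', hy', φ, -, H, -⟩ := P.iterate_strip hx
        (P.add_mul_mem_openSide hx hxd (Ioo_subset_Icc_self (ht K))) hu (g K) (fun a ha => by
          have := hal' K (a * t K) ⟨mul_nonneg ha.1 (ht K).1.le, by nlinarith [(ht K).1, ha.2]⟩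
          rwa [Complex.ofReal_mul, mul_assoc, ← add_sub_cancel_left x ((t K : ℂ) * d)] at this)
      have h0 := H 0 (by simp)
      have h1 := H 1 (by simp)
      simp only [Complex.ofReal_zero, zero_mul, add_zero, Complex.ofReal_one, one_mul,
        add_sub_cancel] at h0 h1
      rw [h0, h1]
    have hinf : (range g).Infinite := by
      rw [infinite_iff_exists_gt]
      intro a
      exact ⟨g (a + 1), mem_range_self _, hg (a + 1)⟩
    choose! S hS using fun k (hk : k ∈ range g) => hk
    -- Two cuts at the same corner in the same direction end with the same chord, so the iterates at
    -- times `k` and `l` coincide.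
    obtain ⟨k, hk, l, hl, hkl, he⟩ := exists_lt_map_eq_of_finite hinf
      (f := fun k => (c (S k), (P.next^[g (S k)] (x, θ)).2)) (P.finite_corners.prod hfin)
      (fun k _ => ⟨hc _, mem_range_self _⟩)
    simp only [Prod.mk.injEq] at he
    obtain ⟨he1, he2⟩ := he
    have hk' := hS k hk
    have hl' := hS l hl
    have hmk := hmem _ (Ioo_subset_Icc_self (ht (S k)))
    have hml := hmem _ (Ioo_subset_Icc_self (ht (S l)))
    have hak := hal' (S k) (t (S k)) ⟨(ht _).1.le, le_rfl⟩
    have hall := hal' (S l) (t (S l)) ⟨(ht _).1.le, le_rfl⟩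
    have e2 : (P.next^[g (S k)] (x + (t (S k) : ℂ) * d, θ)).2 =
        (P.next^[g (S l)] (x + (t (S l) : ℂ) * d, θ)).2 := by rw [hdir, hdir, he2]
    have h1 := hch (S k)
    have h2 := hch (S l)
    rw [e2, he1] at h1
    have e1 := h1.eq_of_frontier_left h2 (mem_frontier_of_mem (hak.mem hmk))
      (mem_frontier_of_mem (hall.mem hml))
    have e := Prod.ext e1 e2
    rw [hk', hl'] at e
    rw [hk'] at hak
    rw [hl'] at hall
    refine ⟨l - k, by omega, t (S l), ht _, t (S k), ht _, fun a ha => ?_,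
      eq_iterate_sub hmk hml hkl.le hak hall e⟩
    have := hal' (S l) a ha
    rw [hl'] at this
    exact this.mono (Nat.sub_le _ _)

/-- The strip issuing from a small interval at a point returns to that interval, isometrically. -/
theorem exists_isometric_return {i : Fin n} {x d : ℂ} {θ : Circle} (hx : x ∈ P.openSide i)
    (hxd : x + d ∈ P.openSide i) (hd : d ≠ 0) (hu : (x, θ) ∈ P.phaseSpace)
    (hal : ∀ k, P.Alive k (x, θ))
    (hfin : (range fun k => (P.next^[k] (x, θ)).2).Finite) :
    ∃ m, 0 < m ∧ ∃ s ∈ Ioo (0 : ℝ) 1, ∃ s' ∈ Ioo (0 : ℝ) 1,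
      ∀ t ∈ Icc (0 : ℝ) s, P.Alive m (x + (t : ℂ) * d, θ) ∧
        P.next^[m] (x + (t : ℂ) * d, θ) = (x + ((s' + (-1) ^ m * (t - s) : ℝ) : ℂ) * d, θ) := by
  obtain ⟨m, hm, s, hs, s', hs', H, he⟩ := P.exists_return hx hxd hd hu hal hfin
  refine ⟨m, hm, s, hs, s', hs', fun t ht => ⟨H t ht, ?_⟩⟩
  obtain ⟨j, y, hy, y', hy', φ, hm', H', hc⟩ := P.iterate_strip hx
    (P.add_mul_mem_openSide hx hxd (Ioo_subset_Icc_self hs)) hu m (fun a ha => by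
      have := H (a * s) ⟨mul_nonneg ha.1 hs.1.le, by nlinarith [hs.1, ha.2]⟩
      rwa [Complex.ofReal_mul, mul_assoc, ← add_sub_cancel_left x ((s : ℂ) * d)] at this)
  rw [add_sub_cancel_left] at H' hc
  have h1 := H' 1 (by simp)
  simp only [Complex.ofReal_one, one_mul, add_sub_cancel, he, Prod.mk.injEq] at h1
  obtain ⟨rfl, rfl⟩ := h1
  obtain rfl : i = j := P.openSide_inj (P.add_mul_mem_openSide hx hxd (Ioo_subset_Icc_self hs')) hy'
  have hts : t / s ∈ Icc (0 : ℝ) 1 := ⟨div_nonneg ht.1 hs.1.le, (div_le_one hs.1).2 ht.2⟩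
  have h2 := H' (t / s) hts
  have e : ((t / s : ℝ) : ℂ) * (s * d) = t * d := by
    have : (s : ℂ) ≠ 0 := by exact_mod_cast hs.1.ne'
    push_cast; field_simp
  rw [e] at h2
  rw [h2]
  refine Prod.ext ?_ rfl
  refine eq_of_line_of_cross_eq (P.edge_ne_zero i) (θ := (θ : ℂ))
    (P.inward_ne_zero_iff.1 ((P.mk_mem_phaseSpace_iff hx).1 hu).ne') ?_ ?_
  · have h3 := P.cross_edge_eq_zero hx (P.add_mul_sub_mem_openSide hy hy' hts)
    have h4 := P.cross_edge_eq_zero hx hxd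
    simp only at h3 ⊢
    rw [add_sub_cancel_left] at h4
    rw [cross_sub_right] at h3 ⊢
    rw [cross_add_right _ x, cross_mul_right _ _ d, h4]
    linarith
  · have e1 : y + ((t / s : ℝ) : ℂ) * (x + (s' : ℂ) * d - y) -
        (x + ((s' + (-1) ^ m * (t - s) : ℝ) : ℂ) * d) =
        ((t / s - 1 : ℝ) : ℂ) * (x + (s' : ℂ) * d - y) - (((-1) ^ m * (t - s) : ℝ) : ℂ) * d := by
      push_cast; ring
    simp only [e1]
    rw [cross_sub_right, cross_mul_right, cross_mul_right, hc, cross_mul_right]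
    have := hs.1.ne'
    field_simp
    ring

end BilliardTable

/-! ### Invariant sets and points adjacent to gaps -/

namespace BilliardTable

variable {n : ℕ} [NeZero n] (P : BilliardTable n)

/-- A subset of the phase space that is invariant under the billiard map in both directions. -/
structure IsInvariant (C : Set (ℂ × Circle)) : Prop where
  subset_phaseSpace : C ⊆ P.phaseSpace
  mem_iff : ∀ u ∈ P.phaseSpace, ∀ v ∈ P.phaseSpace, P.Step u v → (u ∈ C ↔ v ∈ C)

/-- An invariant set that lies in finitely many floors, is closed in each of them, and contains no
periodic points. -/
structure IsAperiodic (C : Set (ℂ × Circle)) : Prop extends P.IsInvariant C where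
  finite_dirs : (Prod.snd '' C).Finite
  closed : ∀ i, ∀ x ∈ P.openSide i, ∀ θ, (x, θ) ∈ P.phaseSpace →
    (∀ r > 0, ∃ x' ∈ P.openSide i, dist x' x < r ∧ (x', θ) ∈ C) → (x, θ) ∈ C
  aperiodic : ∀ u ∈ C, ∀ k, 0 < k → P.Alive k u → P.next^[k] u ≠ u

/-- The image of a subset of the phase space under time reversal. -/
def revSet (C : Set (ℂ × Circle)) : Set (ℂ × Circle) := {u | u ∈ P.phaseSpace ∧ P.rev u ∈ C}

variable {P} {C : Set (ℂ × Circle)}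

theorem IsInvariant.iterate_mem_iff (hC : P.IsInvariant C) {u : ℂ × Circle}
    (hu : u ∈ P.phaseSpace) {k : ℕ} (hk : P.Alive k u) : P.next^[k] u ∈ C ↔ u ∈ C := by
  induction k with
  | zero => rfl
  | succ k ih =>
    have h1 := hk.mono k.le_succ
    rw [← ih h1]
    exact (hC.mem_iff _ (h1.mem hu) _ (hk.mem hu) (hk.step k.lt_succ_self)).symm

theorem Alive.rev {k : ℕ} {u : ℂ × Circle} (hu : u ∈ P.phaseSpace) (h : P.Alive k u) :
    P.Alive k (P.rev (P.next^[k] u)) ∧ P.next^[k] (P.rev (P.next^[k] u)) = P.rev u := by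
  induction k generalizing u with
  | zero => exact ⟨P.alive_zero _, rfl⟩
  | succ k ih =>
    have h' : P.Alive (1 + k) u := by rwa [add_comm]
    obtain ⟨h1, h2⟩ := P.alive_add_iff.1 h'
    obtain ⟨h3, h4⟩ := ih (h1.mem hu) h2
    rw [← Function.iterate_add_apply] at h3 h4
    have hs : P.Step u (P.next^[1] u) := h1.step zero_lt_one
    have hs' := hs.rev hu
    refine ⟨P.alive_succ_iff.2 ⟨h3, ?_⟩, ?_⟩
    · rw [h4]; exact ⟨_, hs'⟩
    · rw [Function.iterate_succ_apply' P.next k (P.rev _), h4, hs'.next_eq]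

theorem IsInvariant.revSet (hC : P.IsInvariant C) : P.IsInvariant (P.revSet C) where
  subset_phaseSpace := fun _ h => h.1
  mem_iff := by
    intro u hu v hv h
    have := hC.mem_iff _ (P.rev_mem hv) _ (P.rev_mem hu) (h.rev hu)
    exact ⟨fun h => ⟨hv, this.2 h.2⟩, fun h => ⟨hu, this.1 h.2⟩⟩

theorem mk_mem_revSet_iff {x : ℂ} {θ : Circle} {i : Fin n} (hx : x ∈ P.openSide i) :
    (x, θ) ∈ P.revSet C ↔ (x, θ) ∈ P.phaseSpace ∧ (x, -P.reflect i θ) ∈ C := by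
  rw [BilliardTable.revSet, mem_ofPred_eq, P.rev_mk hx]

theorem IsAperiodic.revSet (hC : P.IsAperiodic C) : P.IsAperiodic (P.revSet C) where
  toIsInvariant := hC.toIsInvariant.revSet
  finite_dirs := by
    refine (finite_iUnion fun i : Fin n => (hC.finite_dirs.image fun θ => P.reflect i (-θ))).subset ?_
    rintro _ ⟨⟨x, θ⟩, h, rfl⟩
    obtain ⟨⟨i, hi⟩, -⟩ := h.1
    refine mem_iUnion.2 ⟨i, _, ⟨_, ((mk_mem_revSet_iff hi).1 h).2, rfl⟩, ?_⟩
    simp [reflect_reflect]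
  closed := by
    intro i x hx θ hu h
    have hru := P.rev_mem hu
    rw [P.rev_mk hx] at hru
    refine (mk_mem_revSet_iff hx).2 ⟨hu, hC.closed i x hx _ hru fun r hr => ?_⟩
    obtain ⟨x', hx', hd, h⟩ := h r hr
    exact ⟨x', hx', hd, ((mk_mem_revSet_iff hx').1 h).2⟩
  aperiodic := by
    intro u hu k hk hal he
    have h := hal.rev hu.1
    rw [he] at h
    exact hC.aperiodic _ hu.2 k hk h.1 h.2

theorem IsAperiodic.finite_orbit_dirs (hC : P.IsAperiodic C) {u : ℂ × Circle} (hu : u ∈ C)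
    (hal : ∀ k, P.Alive k u) : (range fun k => (P.next^[k] u).2).Finite := by
  refine hC.finite_dirs.subset ?_
  rintro _ ⟨k, rfl⟩
  exact ⟨_, (hC.iterate_mem_iff (hC.subset_phaseSpace hu) (hal k)).2 hu, rfl⟩

/-- A point with infinite forward orbit is not adjacent to a gap of an aperiodic set. -/
theorem IsAperiodic.exists_mem_of_alive (hC : P.IsAperiodic C) {i : Fin n} {x d : ℂ} {θ : Circle}
    (hx : x ∈ P.openSide i) (hxd : x + d ∈ P.openSide i) (hd : d ≠ 0) (hu : (x, θ) ∈ C)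
    (hal : ∀ k, P.Alive k (x, θ)) : ∃ t ∈ Ioc (0 : ℝ) 1, (x + (t : ℂ) * d, θ) ∈ C := by
  have hX := hC.subset_phaseSpace hu
  have hh : x + ((1 / 2 : ℝ) : ℂ) * d ∈ P.openSide i :=
    P.add_mul_mem_openSide hx hxd (by constructor <;> norm_num)
  obtain ⟨m, hm, s, hs, s', hs', H⟩ := P.exists_isometric_return hx hh
    (mul_ne_zero (by norm_num) hd) hX hal (hC.finite_orbit_dirs hu hal)
  have e : ∀ a : ℝ, x + (a : ℂ) * (((1 / 2 : ℝ) : ℂ) * d) = x + ((a / 2 : ℝ) : ℂ) * d := by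
    intro a; push_cast; ring
  have H0 := H 0 ⟨le_rfl, hs.1.le⟩
  simp only [e, Complex.ofReal_zero, zero_mul, add_zero, zero_sub] at H0
  have hmem := (hC.iterate_mem_iff hX H0.1).2 hu
  rw [H0.2] at hmem
  -- An even return is a translation by `s' - s`: it moves `x` into the interval, fixes `x`
  -- (excluded), or moves a point of the interval to `x`, which then lies in `C` by invariance. An
  -- odd return is a flip and sends `x` to parameter `s + s'`, which may exceed 1; hence the
  -- interval was halved beforehand.
  rcases Nat.even_or_odd m with hpar | hpar
  · simp only [hpar.neg_one_pow, one_mul] at hmem H H0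
    rcases lt_trichotomy s s' with hlt | rfl | hlt
    · exact ⟨_, ⟨by linarith, by linarith [hs.1, hs'.2]⟩, hmem⟩
    · exfalso
      refine hC.aperiodic _ hu m hm H0.1 ?_
      rw [H0.2]; simp
    · have H1 := H (s - s') ⟨by linarith, by linarith [hs'.1]⟩
      have ht : (s - s') / 2 ∈ Ioc (0 : ℝ) 1 := ⟨by linarith, by linarith [hs.2, hs'.1]⟩
      refine ⟨(s - s') / 2, ht, ?_⟩
      rw [e, e] at H1
      refine (hC.iterate_mem_iff (P.mk_mem_phaseSpace_of hx (P.add_mul_mem_openSide hx hxd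
        (Ioc_subset_Icc_self ht)) hX) H1.1).1 ?_
      rw [H1.2]
      simpa using hu
  · simp only [hpar.neg_one_pow] at hmem
    exact ⟨_, ⟨by linarith [hs.1, hs'.1], by linarith [hs.2, hs'.2]⟩, hmem⟩

variable (P) in
/-- A point of `C` next to which an interval of the same floor avoids `C`. -/
def IsGapAdjacent (C : Set (ℂ × Circle)) (u : ℂ × Circle) : Prop :=
  u ∈ C ∧ ∃ i, u.1 ∈ P.openSide i ∧ ∃ d, d ≠ 0 ∧ u.1 + d ∈ P.openSide i ∧
    ∀ t ∈ Ioc (0 : ℝ) 1, (u.1 + (t : ℂ) * d, u.2) ∉ C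

theorem IsGapAdjacent.not_alive (hC : P.IsAperiodic C) {u : ℂ × Circle}
    (h : P.IsGapAdjacent C u) : ¬ ∀ k, P.Alive k u := by
  obtain ⟨hu, i, hi, d, hd, hid, H⟩ := h
  intro hal
  obtain ⟨t, ht, h⟩ := hC.exists_mem_of_alive hi hid hd hu hal
  exact H t ht h

theorem IsGapAdjacent.rev (hC : P.IsInvariant C) {u : ℂ × Circle}
    (h : P.IsGapAdjacent C u) : P.IsGapAdjacent (P.revSet C) (P.rev u) := by
  obtain ⟨hu, i, hi, d, hd, hid, H⟩ := h
  have hX := hC.subset_phaseSpace hu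
  refine ⟨⟨P.rev_mem hX, by rwa [P.rev_rev hX]⟩, i, ?_⟩
  obtain ⟨x, θ⟩ := u
  rw [P.rev_mk hi]
  refine ⟨hi, d, hd, hid, fun t ht hmem => H t ht ?_⟩
  have := ((mk_mem_revSet_iff (P.add_mul_mem_openSide hi hid (Ioc_subset_Icc_self ht))).1 hmem).2
  rwa [reflect_neg, reflect_reflect, neg_neg] at this

theorem IsGapAdjacent.not_alive_rev (hC : P.IsAperiodic C) {u : ℂ × Circle}
    (h : P.IsGapAdjacent C u) : ¬ ∀ k, P.Alive k (P.rev u) :=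
  (h.rev hC.toIsInvariant).not_alive hC.revSet

theorem exists_alive_corner {u : ℂ × Circle} (hu : u ∈ P.phaseSpace) (h : ¬ ∀ k, P.Alive k u) :
    ∃ M, P.Alive M u ∧ ∃ c ∈ P.corners, P.IsChord (P.next^[M] u).1 (P.next^[M] u).2 c := by
  push Not at h
  classical
  have hspec := Nat.find_spec h
  have hmin := fun m (hm : m < Nat.find h) => Nat.find_min h hm
  have h0 : Nat.find h ≠ 0 := fun h0 => hspec (by rw [h0]; exact P.alive_zero u)
  obtain ⟨M, hM⟩ := Nat.exists_eq_succ_of_ne_zero h0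
  have hal := not_not.1 (hmin M (by omega))
  refine ⟨M, hal, exists_corner_of_not_step (hal.mem hu) fun hv => hspec ?_⟩
  rw [hM]
  exact P.alive_succ_iff.2 ⟨hal, hv⟩

/-- A point whose backward orbit ends in a corner is on a trajectory issuing from that corner. -/
theorem exists_step_of_corner {u : ℂ × Circle} (hu : u ∈ P.phaseSpace)
    (h : ¬ ∀ k, P.Alive k (P.rev u)) :
    ∃ a, ∃ v ∈ P.phaseSpace, P.Alive a v ∧ P.next^[a] v = u ∧
      ∃ c ∈ P.corners, ∃ φ, P.Step (c, φ) v := by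
  obtain ⟨a, ha, c, hc, hch⟩ := exists_alive_corner (P.rev_mem hu) h
  have hv := ha.mem (P.rev_mem hu)
  obtain ⟨h1, h2⟩ := ha.rev (P.rev_mem hu)
  rw [P.rev_rev hu] at h2
  refine ⟨a, _, P.rev_mem hv, h1, h2, c, hc, -(P.next^[a] (P.rev u)).2, ?_⟩
  obtain ⟨⟨j, hj⟩, -⟩ := hv
  set v := P.next^[a] (P.rev u)
  rw [show P.rev v = (v.1, P.reflect j (-v.2)) by
    rw [reflect_neg]; exact P.rev_mk hj v.2]
  exact hch.reverse.step hj

/-! ### Generalized diagonals -/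

namespace GeneralizedDiagonal

/-- The boundary points of a generalized diagonal, indexed by natural numbers. -/
def pos (d : P.GeneralizedDiagonal) (k : ℕ) : ℂ := if h : k < d.m + 2 then d.foot ⟨k, h⟩ else 0

/-- The directions of a generalized diagonal, indexed by natural numbers. -/
def vel (d : P.GeneralizedDiagonal) (k : ℕ) : Circle := if h : k < d.m + 1 then d.dir ⟨k, h⟩ else 1

variable (d : P.GeneralizedDiagonal)

theorem pos_eq (k : Fin (d.m + 2)) : d.pos k = d.foot k := by
  rw [pos, dif_pos k.2]

theorem vel_eq (k : Fin (d.m + 1)) : d.vel k = d.dir k := by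
  rw [vel, dif_pos k.2]

theorem pos_zero_mem : d.pos 0 ∈ P.corners := by
  have := d.foot_first
  rwa [← pos_eq] at this

theorem pos_last_mem : d.pos (d.m + 1) ∈ P.corners := by
  have := d.foot_last
  rwa [← pos_eq] at this

theorem isChord {k : ℕ} (hk : k ≤ d.m) : P.IsChord (d.pos k) (d.vel k) (d.pos (k + 1)) := by
  have := d.link ⟨k, by omega⟩
  rwa [← pos_eq, ← pos_eq, ← vel_eq] at this

theorem step {k : ℕ} (hk : k < d.m) :
    P.Step (d.pos k, d.vel k) (d.pos (k + 1), d.vel (k + 1)) := by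
  have := d.bounce ⟨k, hk⟩
  rw [← pos_eq, ← vel_eq, ← vel_eq] at this
  exact ⟨d.isChord hk.le, this⟩

theorem pos_mem_frontier {k : ℕ} (hk : k ≤ d.m + 1) : d.pos k ∈ frontier P.region := by
  rcases Nat.eq_zero_or_pos k with rfl | h0
  · exact P.corners_subset_frontier d.pos_zero_mem
  rcases hk.lt_or_eq with hlt | rfl
  · have := d.step (k := k - 1) (by omega)
    rw [Nat.sub_add_cancel h0] at this
    exact mem_frontier_of_mem this.mem
  · exact P.corners_subset_frontier d.pos_last_mem

theorem mem_phaseSpace {k : ℕ} (h0 : 0 < k) (hk : k ≤ d.m) : (d.pos k, d.vel k) ∈ P.phaseSpace := by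
  have := d.step (k := k - 1) (by omega)
  rw [Nat.sub_add_cancel h0] at this
  exact this.mem

theorem mem_trace_iff {p : ℂ × Circle} : p ∈ d.trace ↔
    ∃ k ≤ d.m, p.2 = d.vel k ∧ p.1 ∈ openSegment ℝ (d.pos k) (d.pos (k + 1)) := by
  constructor
  · rintro ⟨k, h1, h2⟩
    refine ⟨k, Nat.lt_succ_iff.1 k.2, by rw [vel_eq, h1], ?_⟩
    rw [← pos_eq, ← pos_eq] at h2
    exact h2
  · rintro ⟨k, hk, h1, h2⟩
    refine ⟨⟨k, by omega⟩, by rw [h1, ← vel_eq], ?_⟩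
    rw [← pos_eq, ← pos_eq]
    exact h2

theorem eq_of_le {d d' : P.GeneralizedDiagonal} (h0 : d.pos 0 = d'.pos 0)
    (h1 : d.vel 0 = d'.vel 0) {k : ℕ} (hk : k ≤ d.m) (hk' : k ≤ d'.m) :
    d.pos k = d'.pos k ∧ d.vel k = d'.vel k := by
  induction k with
  | zero => exact ⟨h0, h1⟩
  | succ k ih =>
    obtain ⟨h2, h3⟩ := ih (by omega) (by omega)
    have h4 := d.step (show k < d.m by omega)
    rw [h2, h3] at h4
    have := h4.unique (d'.step (show k < d'.m by omega))
    simpa using this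

/-- A longer diagonal with the same start would have to be reflected at the corner where the shorter
one ends. -/
theorem m_le {d d' : P.GeneralizedDiagonal} (h0 : d.pos 0 = d'.pos 0)
    (h1 : d.vel 0 = d'.vel 0) : d'.m ≤ d.m := by
  by_contra hlt
  obtain ⟨h2, h3⟩ := eq_of_le h0 h1 le_rfl (by omega)
  have h4 := d.isChord le_rfl
  have h5 := d'.step (k := d.m) (by omega)
  rw [h2, h3] at h4
  have h6 := h4.eq_of_frontier h5.1 (d.pos_mem_frontier le_rfl) (mem_frontier_of_mem h5.mem)
  obtain ⟨⟨i, hi⟩, -⟩ := h5.mem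
  simp only at hi h6
  exact P.not_mem_corners hi (h6 ▸ d.pos_last_mem)

/-- A generalized diagonal is determined by its starting point and its initial direction. -/
theorem ext_of_start {d d' : P.GeneralizedDiagonal} (h0 : d.pos 0 = d'.pos 0)
    (h1 : d.vel 0 = d'.vel 0) : d = d' := by
  have hm : d.m = d'.m := le_antisymm (m_le h0.symm h1.symm) (m_le h0 h1)
  have hvel : ∀ k ≤ d.m, d.vel k = d'.vel k := fun k hk => (eq_of_le h0 h1 hk (hm ▸ hk)).2
  have hpos : ∀ k ≤ d.m + 1, d.pos k = d'.pos k := by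
    intro k hk
    rcases hk.lt_or_eq with hlt | rfl
    · exact (eq_of_le h0 h1 (by omega) (by omega)).1
    · have h2 := d.isChord le_rfl
      have h3 := d'.isChord hm.le
      rw [(eq_of_le h0 h1 le_rfl hm.le).1, hvel _ le_rfl] at h2
      exact h2.eq_of_frontier h3 (d.pos_mem_frontier le_rfl) (d'.pos_mem_frontier (by omega))
  have hfoot : ∀ (k : Fin (d.m + 2)) (k' : Fin (d'.m + 2)), (k : ℕ) = k' → d.foot k = d'.foot k' := by
    intro k k' hk
    rw [← pos_eq, ← pos_eq, ← hk]
    exact hpos k (by omega)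
  have hdir : ∀ (k : Fin (d.m + 1)) (k' : Fin (d'.m + 1)), (k : ℕ) = k' → d.dir k = d'.dir k' := by
    intro k k' hk
    rw [← vel_eq, ← vel_eq, ← hk]
    exact hvel k (by omega)
  clear hvel hpos h0 h1
  obtain ⟨m, f, g, _, _, _, _⟩ := d
  obtain ⟨m', f', g', _, _, _, _⟩ := d'
  simp only at hm hfoot hdir
  subst hm
  obtain rfl : f = f' := funext fun k => hfoot k k rfl
  obtain rfl : g = g' := funext fun k => hdir k k rfl
  rfl

theorem finite_of_start {S : Set Circle} (hS : S.Finite) :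
    {d : P.GeneralizedDiagonal | d.vel 0 ∈ S}.Finite := by
  refine Set.Finite.of_injOn (f := fun d => (d.pos 0, d.vel 0)) (t := P.corners ×ˢ S)
    (fun d hd => ⟨d.pos_zero_mem, hd⟩) (fun d _ d' _ h => ?_) (P.finite_corners.prod hS)
  simp only [Prod.mk.injEq] at h
  exact ext_of_start h.1 h.2

/-- Invariance carries membership back only to index 1, since the starting corner is outside the
phase space. -/
theorem mem_of_mem {C : Set (ℂ × Circle)} (hC : P.IsInvariant C) {k : ℕ} (h0 : 0 < k)
    (hk : k ≤ d.m) (h : (d.pos k, d.vel k) ∈ C) : (d.pos 1, d.vel 1) ∈ C := by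
  induction k with
  | zero => omega
  | succ k ih =>
    rcases Nat.eq_zero_or_pos k with rfl | hk0
    · exact h
    · exact ih hk0 (by omega) ((hC.mem_iff _ (d.mem_phaseSpace hk0 (by omega)) _
        (d.mem_phaseSpace h0 hk) (d.step (by omega))).2 h)

/-- The generalized diagonal consisting of a trajectory from a corner to a corner. -/
def ofAlive {c c' : ℂ} {φ : Circle} {v : ℂ × Circle} {M : ℕ} (hc : c ∈ P.corners)
    (hc' : c' ∈ P.corners) (hs : P.Step (c, φ) v) (hal : P.Alive M v)
    (hch : P.IsChord (P.next^[M] v).1 (P.next^[M] v).2 c') : P.GeneralizedDiagonal where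
  m := M + 1
  -- Indices are shifted by one: foot `k + 1` is the position of the `k`-th iterate of `v` for `k ≤
  -- M`, and foot `M + 2` is the final corner.
  foot k := if (k : ℕ) = 0 then c else if (k : ℕ) = M + 2 then c' else (P.next^[(k : ℕ) - 1] v).1
  dir k := if (k : ℕ) = 0 then φ else (P.next^[(k : ℕ) - 1] v).2
  foot_first := by simpa using hc
  foot_last := by simpa using hc'
  link := by
    rintro ⟨k, hk⟩
    rcases k with _ | k
    · simpa using hs.1
    · rcases (show k ≤ M by omega).lt_or_eq with hlt | rfl
      · have := (hal.step hlt).1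
        have h1 : k + 1 ≠ M + 2 := by omega
        have h2 : k ≠ M := by omega
        have h3 : k ≠ M + 1 := by omega
        simpa [h1, h2, h3] using this
      · simpa using hch
  bounce := by
    rintro ⟨k, hk⟩
    rcases k with _ | k
    · simpa using hs.2
    · have := (hal.step (show k < M by omega)).2
      have h1 : k ≠ M := by omega
      simpa [h1] using this

theorem ofAlive_pos {c c' : ℂ} {φ : Circle} {v : ℂ × Circle} {M : ℕ} (hc : c ∈ P.corners)
    (hc' : c' ∈ P.corners) (hs : P.Step (c, φ) v) (hal : P.Alive M v)
    (hch : P.IsChord (P.next^[M] v).1 (P.next^[M] v).2 c') {k : ℕ} (hk : k ≤ M) :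
    (ofAlive hc hc' hs hal hch).pos (k + 1) = (P.next^[k] v).1 ∧
    (ofAlive hc hc' hs hal hch).vel (k + 1) = (P.next^[k] v).2 := by
  have h1 : k + 1 < M + 1 + 2 := by omega
  have h2 : k + 1 < M + 1 + 1 := by omega
  have h3 : k ≠ M + 1 := by omega
  constructor
  · simp only [pos, ofAlive]
    rw [dif_pos h1]; simp [h3]
  · simp only [vel, ofAlive]
    rw [dif_pos h2]; simp

theorem ofAlive_pos_zero {c c' : ℂ} {φ : Circle} {v : ℂ × Circle} {M : ℕ} (hc : c ∈ P.corners)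
    (hc' : c' ∈ P.corners) (hs : P.Step (c, φ) v) (hal : P.Alive M v)
    (hch : P.IsChord (P.next^[M] v).1 (P.next^[M] v).2 c') :
    (ofAlive hc hc' hs hal hch).pos 0 = c ∧ (ofAlive hc hc' hs hal hch).vel 0 = φ := by
  simp [pos, vel, ofAlive]

end GeneralizedDiagonal

/-! ### Boundary points lie on generalized diagonals -/

/-- A link that is neither part of an infinite forward nor of an infinite backward trajectory
belongs to a generalized diagonal. -/
theorem exists_diagonal {x y : ℂ} {θ : Circle} (hx : x ∈ frontier P.region)
    (hy : y ∈ frontier P.region) (h : P.IsChord x θ y)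
    (hf : ∀ j, y ∈ P.openSide j → ¬ ∀ k, P.Alive k (y, P.reflect j θ))
    (hb : ∀ i, x ∈ P.openSide i → ¬ ∀ k, P.Alive k (P.rev (x, θ))) :
    ∃ (d : P.GeneralizedDiagonal) (k : ℕ), k ≤ d.m ∧ d.pos k = x ∧ d.vel k = θ ∧
      d.pos (k + 1) = y := by
  suffices H : ∃ (d : P.GeneralizedDiagonal) (k : ℕ), k ≤ d.m ∧ d.pos k = x ∧ d.vel k = θ by
    obtain ⟨d, k, hk, h1, h2⟩ := H
    refine ⟨d, k, hk, h1, h2, ?_⟩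
    have := d.isChord hk
    rw [h1, h2] at this
    exact this.eq_of_frontier h (d.pos_mem_frontier (by omega)) hy
  rcases P.mem_frontier_iff.1 hx with ⟨i, hi⟩ | hxc
  · have hX : (x, θ) ∈ P.phaseSpace := (P.mk_mem_phaseSpace_iff hi).2 (h.inward_pos hi)
    obtain ⟨a, v, hv, hav, hva, c, hc, φ, hs⟩ := exists_step_of_corner hX (hb i hi)
    have hfw : ¬ ∀ k, P.Alive k (x, θ) := by
      intro hal
      rcases P.mem_frontier_iff.1 hy with ⟨j, hj⟩ | hyc
      · refine hf j hj fun k => ?_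
        have := (P.alive_add_iff.1 (hal (1 + k))).2
        rwa [Function.iterate_one, (h.step hj).next_eq] at this
      · have hs := (hal 1).step zero_lt_one
        have := h.eq_of_frontier hs.1 hy (mem_frontier_of_mem hs.mem)
        obtain ⟨⟨j, hj⟩, -⟩ := hs.mem
        rw [← this] at hj
        exact P.not_mem_corners hj hyc
    obtain ⟨M, hM, c', hc', hch⟩ := exists_alive_corner hX hfw
    have hal : P.Alive (a + M) v := P.alive_add_iff.2 ⟨hav, by rwa [hva]⟩
    rw [← hva, ← Function.iterate_add_apply, add_comm] at hch
    obtain ⟨h1, h2⟩ := GeneralizedDiagonal.ofAlive_pos hc hc' hs hal hch (Nat.le_add_right a M)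
    rw [hva] at h1 h2
    exact ⟨_, a + 1, show a + 1 ≤ a + M + 1 by omega, h1, h2⟩
  · rcases P.mem_frontier_iff.1 hy with ⟨j, hj⟩ | hyc
    · have hs := h.step hj
      obtain ⟨M, hM, c', hc', hch⟩ := exists_alive_corner hs.mem (hf j hj)
      obtain ⟨h1, h2⟩ := GeneralizedDiagonal.ofAlive_pos_zero hxc hc' hs hM hch
      exact ⟨_, 0, Nat.zero_le _, h1, h2⟩
    · refine ⟨{ m := 0, foot := ![x, y], dir := ![θ], foot_first := hxc, foot_last := hyc,
                link := ?_, bounce := fun k => k.elim0 }, 0, le_rfl, by simp [GeneralizedDiagonal.pos],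
                by simp [GeneralizedDiagonal.vel]⟩
      intro k
      fin_cases k
      exact h

/-- Forward and backward orbits of such a point both end in corners, so it is a bounce of a
generalized diagonal. The first bounce of that diagonal is in `C`, so its initial direction is a
side reflection of a direction of `C`. This leaves finitely many diagonals, each with finitely many
bounces. -/
theorem IsAperiodic.finite_gapAdjacent (hC : P.IsAperiodic C) :
    {u | P.IsGapAdjacent C u}.Finite := by
  have hS : (⋃ j : Fin n, P.reflect j '' (Prod.snd '' C)).Finite :=
    finite_iUnion fun j => hC.finite_dirs.image _
  refine ((GeneralizedDiagonal.finite_of_start (P := P) hS).biUnion fun d _ =>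
    (finite_Iic d.m).image fun k => (d.pos k, d.vel k)).subset ?_
  intro u hu
  have hX := hC.subset_phaseSpace hu.1
  obtain ⟨y, hy, hch⟩ := P.exists_chord_of_phaseSpace hX
  obtain ⟨d, k, hk, h1, h2, -⟩ := exists_diagonal (mem_frontier_of_mem hX) hy hch
    (by
      intro j hj hal
      have hs := hch.step hj
      refine hu.not_alive hC fun k => ?_
      cases k with
      | zero => exact P.alive_zero u
      | succ k =>
        rw [add_comm]
        refine P.alive_add_iff.2 ⟨fun l hl => ?_, ?_⟩
        · obtain rfl : l = 0 := by omega
          exact ⟨_, hs⟩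
        · rw [Function.iterate_one, show P.next u = _ from hs.next_eq]; exact hal k)
    (fun i _ => hu.not_alive_rev hC)
  have hk0 : 0 < k := by
    rcases Nat.eq_zero_or_pos k with rfl | h0
    · obtain ⟨⟨i, hi⟩, -⟩ := hX
      exact absurd (h1 ▸ d.pos_zero_mem) (P.not_mem_corners hi)
    · exact h0
  have hmem := d.mem_of_mem hC.toIsInvariant hk0 hk (by rw [h1, h2]; exact hu.1)
  refine mem_biUnion (x := d) ?_ ⟨k, hk, Prod.ext h1 h2⟩
  have hs := d.step (k := 0) (by omega)
  obtain ⟨⟨j, hj⟩, -⟩ := hs.mem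
  refine mem_iUnion.2 ⟨j, _, ⟨_, hmem, rfl⟩, ?_⟩
  rw [show d.vel (0 + 1) = _ from hs.eq_reflect hj, reflect_reflect]

variable (P) in
/-- A boundary point of `C` in its floor of the phase space. -/
def IsBoundaryPoint (C : Set (ℂ × Circle)) (u : ℂ × Circle) : Prop :=
  u ∈ P.phaseSpace ∧ ∃ i, u.1 ∈ P.openSide i ∧
    (∀ r > 0, ∃ x' ∈ P.openSide i, dist x' u.1 < r ∧ (x', u.2) ∈ C) ∧
    (∀ r > 0, ∃ x' ∈ P.openSide i, dist x' u.1 < r ∧ (x', u.2) ∉ C)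

/-- Between a point of an aperiodic set and a point outside it there is a point adjacent to a
gap. -/
theorem IsAperiodic.exists_gapAdjacent (hC : P.IsAperiodic C) {i : Fin n} {x x' : ℂ} {θ : Circle}
    (hx : x ∈ P.openSide i) (hx' : x' ∈ P.openSide i) (hu : (x, θ) ∈ C) (hu' : (x', θ) ∉ C) :
    ∃ z, dist z x ≤ dist x' x ∧ P.IsGapAdjacent C (z, θ) := by
  have hX := hC.subset_phaseSpace hu
  set f : ℝ → ℂ := fun t => x + (t : ℂ) * (x' - x) with hf
  have hfs : ∀ t ∈ Icc (0 : ℝ) 1, f t ∈ P.openSide i := fun t ht =>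
    P.add_mul_sub_mem_openSide hx hx' ht
  have hfc : Continuous f := by fun_prop
  -- The maximal parameter in `C` on the way from `x` to `x'` exists because `C` is floorwise
  -- closed; everything after it up to `x'` is a gap.
  set Z : Set ℝ := {t | t ∈ Icc (0 : ℝ) 1 ∧ (f t, θ) ∈ C} with hZ
  have h0 : (0 : ℝ) ∈ Z := ⟨by simp, by simpa [hf] using hu⟩
  have hbd : BddAbove Z := ⟨1, fun t ht => ht.1.2⟩
  have hclosed : IsClosed Z := by
    refine isClosed_of_closure_subset fun t ht => ?_
    have htI : t ∈ Icc (0 : ℝ) 1 := closure_minimal (fun s hs => hs.1) isClosed_Icc ht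
    refine ⟨htI, hC.closed i _ (hfs t htI) θ (P.mk_mem_phaseSpace_of hx (hfs t htI) hX) ?_⟩
    intro r hr
    obtain ⟨δ, hδ, hδ'⟩ := Metric.continuousAt_iff.1 (hfc.continuousAt (x := t)) r hr
    obtain ⟨s, hs, hst⟩ := Metric.mem_closure_iff.1 ht δ hδ
    rw [dist_comm] at hst
    exact ⟨f s, hfs s hs.1, hδ' hst, hs.2⟩
  have hτ := hclosed.csSup_mem ⟨0, h0⟩ hbd
  set τ := sSup Z
  have hτ1 : τ < 1 := by
    refine lt_of_le_of_ne hτ.1.2 fun h1 => hu' ?_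
    have := hτ.2
    rw [h1] at this
    simpa [hf] using this
  have hxx : x' - x ≠ 0 := by
    rw [sub_ne_zero]
    rintro rfl
    exact hu' hu
  refine ⟨f τ, ?_, hτ.2, i, hfs τ hτ.1, ((1 - τ : ℝ) : ℂ) * (x' - x),
    mul_ne_zero (by exact_mod_cast (by linarith : (1 - τ) ≠ 0)) hxx, ?_, fun t ht hmem => ?_⟩
  · rw [dist_eq_norm, dist_eq_norm, hf]
    simp only [add_sub_cancel_left, norm_mul, Complex.norm_real, Real.norm_eq_abs]
    rw [abs_of_nonneg hτ.1.1]
    exact mul_le_of_le_one_left (norm_nonneg _) hτ.1.2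
  · convert hx' using 1
    simp only [hf]; push_cast; ring
  · have e : f τ + (t : ℂ) * (((1 - τ : ℝ) : ℂ) * (x' - x)) = f (τ + t * (1 - τ)) := by
      simp only [hf]; push_cast; ring
    simp only [e] at hmem
    have h1 : 0 < t * (1 - τ) := mul_pos ht.1 (by linarith)
    have := le_csSup hbd (show τ + t * (1 - τ) ∈ Z from
      ⟨⟨by linarith [hτ.1.1], by nlinarith [ht.2]⟩, hmem⟩)
    linarith

/-- A boundary point is a limit of gap-adjacent points in its floor, and a finite set is closed. -/
theorem IsAperiodic.gapAdjacent_of_boundary (hC : P.IsAperiodic C) {u : ℂ × Circle}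
    (h : P.IsBoundaryPoint C u) : P.IsGapAdjacent C u := by
  obtain ⟨x, θ⟩ := u
  obtain ⟨hX, i, hi, h1, h2⟩ := h
  have hu := hC.closed i x hi θ hX h1
  have hcl : IsClosed {z | P.IsGapAdjacent C (z, θ)} :=
    ((hC.finite_gapAdjacent).preimage (f := fun z => (z, θ)) (by
      intro a _ b _ hab; simpa using hab)).isClosed
  refine hcl.closure_subset (Metric.mem_closure_iff.2 fun ε hε => ?_)
  obtain ⟨x', hx', hd, hn⟩ := h2 ε hε
  obtain ⟨z, hz, hg⟩ := hC.exists_gapAdjacent hi hx' hu hn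
  exact ⟨z, hg, by rw [dist_comm]; exact hz.trans_lt hd⟩

end BilliardTable

/-- Transports the flow boundary along the motion. It suffices that the two sets correspond locally
up to closure, as the exact correspondence can fail on trajectories meeting corners. -/
theorem mem_frontier_closure_iff_of_homeomorph {X : Type*} [TopologicalSpace X] (h : X ≃ₜ X)
    {A B U : Set X} (hU : IsOpen U) (hA : ∀ z ∈ U, z ∈ A → h z ∈ closure B)
    (hB : ∀ z ∈ U, h z ∈ B → z ∈ closure A) {z : X} (hz : z ∈ U) :
    z ∈ frontier (closure A) ↔ h z ∈ frontier (closure B) := by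
  have e : closure A ∩ U = h ⁻¹' closure B ∩ U := by
    ext w
    constructor
    · rintro ⟨hw, hwU⟩
      refine ⟨?_, hwU⟩
      rw [h.preimage_closure]
      refine closure_minimal (s := U ∩ A) ?_ isClosed_closure (hU.inter_closure ⟨hwU, hw⟩)
      rintro v ⟨hv, hvA⟩
      rw [← h.preimage_closure]
      exact hA v hv hvA
    · rintro ⟨hw, hwU⟩
      refine ⟨?_, hwU⟩
      rw [h.preimage_closure] at hw
      refine closure_minimal (s := U ∩ h ⁻¹' B) ?_ isClosed_closure (hU.inter_closure ⟨hwU, hw⟩)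
      rintro v ⟨hv, hvB⟩
      exact hB v hv hvB
  have h1 := frontier_inter_open_inter (s := closure A) hU
  have h2 := frontier_inter_open_inter (s := h ⁻¹' closure B) hU
  rw [e, h2, ← h.preimage_frontier] at h1
  have := Set.ext_iff.1 h1 z
  simp only [mem_inter_iff, hz, and_true, mem_preimage] at this
  exact this.symm

/-- A linear isometry of the plane is a rotation or a reflection, and within each kind it is
determined by the image of one direction. -/
theorem LinearIsometryEquiv.finite_setOf_apply_mem (θ : Circle) {S : Set Circle} (hS : S.Finite) :
    {g : ℂ ≃ₗᵢ[ℝ] ℂ | ∃ φ ∈ S, (φ : ℂ) = g θ}.Finite := by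
  refine ((hS.image fun φ => rotation (φ * θ⁻¹)).union
    (hS.image fun φ => Complex.conjLIE.trans (rotation (φ * θ)))).subset ?_
  rintro g ⟨φ, hφ, hg⟩
  obtain ⟨a, rfl | rfl⟩ := linear_isometry_complex g
  · refine Or.inl ⟨φ, hφ, ?_⟩
    rw [rotation_apply, ← Circle.coe_mul, Circle.coe_inj] at hg
    rw [hg]; simp
  · refine Or.inr ⟨φ, hφ, ?_⟩
    rw [LinearIsometryEquiv.trans_apply, rotation_apply, Complex.conjLIE_apply,
      ← Circle.coe_inv_eq_conj, ← Circle.coe_mul, Circle.coe_inj] at hg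
    simp only
    rw [hg]; simp

/-! ### The flow boundary of a tame set -/

namespace BilliardTable

variable {n : ℕ} [NeZero n] (P : BilliardTable n)

/-- An invariant set in finitely many floors, without isolated points in the floors, whose boundary
points have finite trajectories. -/
structure IsTame (C : Set (ℂ × Circle)) : Prop extends P.IsInvariant C where
  finite_dirs : (Prod.snd '' C).Finite
  perfect : ∀ i, ∀ x ∈ P.openSide i, ∀ θ, (x, θ) ∈ C →
    ∀ r > 0, ∃ x' ∈ P.openSide i, x' ≠ x ∧ dist x' x < r ∧ (x', θ) ∈ C
  not_alive : ∀ u, P.IsBoundaryPoint C u → ¬ ∀ k, P.Alive k u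
  not_alive_rev : ∀ u, P.IsBoundaryPoint C u → ¬ ∀ k, P.Alive k (P.rev u)

/-- The part of the flow set of `C` over the direction `θ`. -/
def slice (C : Set (ℂ × Circle)) (θ : Circle) : Set ℂ := {z | (z, θ) ∈ P.flowSet C}

theorem mem_flowBoundary_iff {C : Set (ℂ × Circle)} {z : ℂ} {θ : Circle} :
    (z, θ) ∈ P.flowBoundary C ↔ z ∈ interior P.region ∧ z ∈ frontier (closure (P.slice C θ)) :=
  Iff.rfl

/-- Only finitely many lines of direction `ψ` pass through corners, so near `z` the only one to
avoid is the line through `z` itself. -/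
theorem exists_ball_generic (ψ : Circle) (z : ℂ) : ∃ δ > 0, ∀ z', dist z' z < δ →
    cross ψ z' ≠ cross ψ z → ∀ c ∈ P.corners, cross ψ z' ≠ cross ψ c := by
  have hF : (cross ψ '' P.corners \ {cross ψ z}).Finite := (P.finite_corners.image _).subset sdiff_subset
  have hO := hF.isClosed.isOpen_compl.preimage (continuous_cross ψ)
  obtain ⟨δ, hδ, H⟩ := Metric.isOpen_iff.1 hO z (by simp)
  refine ⟨δ, hδ, fun z' hd hne c hc he => ?_⟩
  exact H (Metric.mem_ball.2 hd) ⟨⟨c, hc, he.symm⟩, hne⟩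

theorem exists_generic_near (ψ : Circle) (z : ℂ) {ε : ℝ} (hε : 0 < ε) :
    ∃ z', dist z' z < ε ∧ ∀ c ∈ P.corners, cross ψ z' ≠ cross ψ c := by
  obtain ⟨δ, hδ, H⟩ := P.exists_ball_generic ψ z
  obtain ⟨z', hd, hc⟩ := exists_dist_lt_cross ψ z (by simp) (lt_min hε hδ) 1 one_ne_zero
  refine ⟨z', hd.trans_le (min_le_left _ _), H z' (hd.trans_le (min_le_right _ _)) fun he => ?_⟩
  rw [cross_sub_right, he] at hc
  simp at hc

variable {P} {C : Set (ℂ × Circle)}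

theorem IsChord.neg_reverse {x y : ℂ} {θ : Circle} (h : P.IsChord x (-θ) y) : P.IsChord y θ x := by
  simpa using h.reverse

theorem IsChord.cancel {x y z : ℂ} {θ : Circle} (h : P.IsChord x θ z) (h' : P.IsChord y θ z)
    (hx : x ∉ interior P.region) (hy : y ∈ interior P.region) : P.IsChord x θ y := by
  obtain ⟨a, ha, rfl, H⟩ := h
  obtain ⟨b, hb, e, H'⟩ := h'
  have ey : y = x + ((a - b : ℝ) : ℂ) * (θ : ℂ) := by push_cast; linear_combination -e
  rcases lt_trichotomy a b with hlt | rfl | hlt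
  · refine absurd ?_ hx
    convert H' (b - a) ⟨by linarith, by linarith⟩ using 1
    rw [ey]; push_cast; ring
  · refine absurd hy ?_
    rw [ey]; simpa using hx
  · exact ⟨a - b, by linarith, ey, fun s hs => H s ⟨hs.1, by linarith [hs.2]⟩⟩

/-- Perfectness supplies members of `C` off the line of direction `ψ` through `y`; transversality of
`ψ` to the side ensures that a different side point is off that line. -/
theorem IsTame.exists_generic_mem (hC : P.IsTame C) {j : Fin n} {y : ℂ} {φ ψ : Circle}
    (hy : y ∈ P.openSide j) (h : (y, φ) ∈ C) (hψ : cross ψ (P.edge j) ≠ 0) {ε : ℝ} (hε : 0 < ε) :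
    ∃ y' ∈ P.openSide j, dist y' y < ε ∧ (y', φ) ∈ C ∧ ∀ c ∈ P.corners, cross ψ y' ≠ cross ψ c := by
  obtain ⟨δ, hδ, H⟩ := P.exists_ball_generic ψ y
  obtain ⟨y', hy', hne, hd, h'⟩ := hC.perfect j y hy φ h _ (lt_min hε hδ)
  refine ⟨y', hy', hd.trans_le (min_le_left _ _), h', H y' (hd.trans_le (min_le_right _ _)) ?_⟩
  intro he
  refine hne (eq_of_line_of_cross_eq (P.edge_ne_zero j) hψ (P.cross_edge_eq_zero hy hy') ?_)
  rw [cross_sub_right, he, sub_self]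

theorem mem_slice_of_chord {x z : ℂ} {θ : Circle} (hz : z ∈ interior P.region)
    (hx : (x, θ) ∈ C) (h : P.IsChord x θ z) : z ∈ P.slice C θ := ⟨x, hx, h, hz⟩

theorem IsInvariant.mem_of_mem_slice (hC : P.IsInvariant C) {x z : ℂ} {θ : Circle} {i : Fin n}
    (hx : x ∈ P.openSide i) (h : P.IsChord x θ z) (hz : z ∈ P.slice C θ) : (x, θ) ∈ C := by
  obtain ⟨x', hx', h', -⟩ := hz
  rwa [h.eq_of_frontier_left h' (P.openSide_subset_frontier i hx)
    (mem_frontier_of_mem (hC.subset_phaseSpace hx'))]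

theorem IsInvariant.reflect_mem_of_mem_slice (hC : P.IsInvariant C) {z y : ℂ} {θ : Circle}
    {j : Fin n} (hy : y ∈ P.openSide j) (h : P.IsChord z θ y) (hz : z ∈ P.slice C θ) :
    (y, P.reflect j θ) ∈ C := by
  obtain ⟨x, hx, h', hzi⟩ := hz
  have hs := (h'.trans h hzi).step hy
  exact (hC.mem_iff _ (hC.subset_phaseSpace hx) _ hs.mem hs).1 hx

/-- Genericity makes the backward ray from `z` end on an open side rather than in a corner, so that
there is a preimage to which invariance applies. -/
theorem IsInvariant.mem_slice_of_reflect_mem (hC : P.IsInvariant C) {z y : ℂ} {θ : Circle}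
    {j : Fin n} (hzi : z ∈ interior P.region) (hy : y ∈ P.openSide j) (h : P.IsChord z θ y)
    (hmem : (y, P.reflect j θ) ∈ C) (hgen : ∀ c ∈ P.corners, cross θ z ≠ cross θ c) :
    z ∈ P.slice C θ := by
  obtain ⟨x, hx, hch⟩ := P.exists_chord_of_interior hzi (-θ)
  have hch := hch.neg_reverse
  rcases P.mem_frontier_iff.1 hx with ⟨i, hi⟩ | hxc
  · have hs := (hch.trans h hzi).step hy
    exact ⟨x, (hC.mem_iff _ ((P.mk_mem_phaseSpace_iff hi).2 (hch.inward_pos hi)) _ hs.mem hs).2 hmem,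
      hch, hzi⟩
  · exact absurd hch.cross_eq (hgen x hxc)

/-- Slice points near `z` flow to points of `C` near `y`. If conversely all nearby side points were
in `C`, every generic point near `z` would be in the slice, and `z` would be interior to its
closure. -/
theorem IsInvariant.isBoundaryPoint_forward (hC : P.IsInvariant C) {z y : ℂ} {θ : Circle}
    {j : Fin n} (hy : y ∈ P.openSide j) (h : P.IsChord z θ y) (hz : (z, θ) ∈ P.flowBoundary C) :
    P.IsBoundaryPoint C (y, P.reflect j θ) := by
  obtain ⟨hzi, hzf⟩ := P.mem_flowBoundary_iff.1 hz
  refine ⟨(h.step hy).mem, j, hy, fun r hr => ?_, fun r hr => ?_⟩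
  · obtain ⟨δ, hδ, H⟩ := P.chord_local h (P.startsAt_interior hzi θ) hy hr
    obtain ⟨z', hz', hd⟩ := Metric.mem_closure_iff.1 (isClosed_closure.frontier_subset hzf) δ hδ
    rw [dist_comm] at hd
    obtain ⟨y', hy', hdy, hch⟩ := H z' hz'.choose_spec.2.2 hd
    exact ⟨y', hy', hdy, hC.reflect_mem_of_mem_slice hy' hch hz'⟩
  · by_contra! hcon
    obtain ⟨δ, hδ, H⟩ := P.chord_local h (P.startsAt_interior hzi θ) hy hr
    refine hzf.2 (mem_interior.2 ⟨interior P.region ∩ Metric.ball z δ, ?_,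
      isOpen_interior.inter Metric.isOpen_ball, hzi, Metric.mem_ball_self hδ⟩)
    rintro z' ⟨hz'i, hz'd⟩
    refine Metric.mem_closure_iff.2 fun ε hε => ?_
    obtain ⟨ε', hε', hball⟩ := Metric.isOpen_iff.1
      ((isOpen_interior (s := P.region)).inter (Metric.isOpen_ball (x := z) (ε := δ))) z' ⟨hz'i, hz'd⟩
    obtain ⟨z'', hd, hgen⟩ := P.exists_generic_near θ z' (lt_min hε hε')
    obtain ⟨h1, h2⟩ := hball (Metric.mem_ball.2 (hd.trans_le (min_le_right _ _)))
    obtain ⟨y', hy', hdy, hch⟩ := H z'' h1 h2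
    exact ⟨z'', hC.mem_slice_of_reflect_mem h1 hy' hch (hcon y' hy' hdy) hgen,
      by rw [dist_comm]; exact hd.trans_le (min_le_left _ _)⟩

theorem IsInvariant.isBoundaryPoint_backward (hC : P.IsInvariant C) {x z : ℂ} {θ : Circle}
    {i : Fin n} (hx : x ∈ P.openSide i) (h : P.IsChord x θ z) (hz : (z, θ) ∈ P.flowBoundary C) :
    P.IsBoundaryPoint C (x, θ) := by
  obtain ⟨hzi, hzf⟩ := P.mem_flowBoundary_iff.1 hz
  refine ⟨(P.mk_mem_phaseSpace_iff hx).2 (h.inward_pos hx), i, hx, fun r hr => ?_, fun r hr => ?_⟩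
  · obtain ⟨δ, hδ, H⟩ := P.chord_local h.reverse (P.startsAt_interior hzi (-θ)) hx hr
    obtain ⟨z', hz', hd⟩ := Metric.mem_closure_iff.1 (isClosed_closure.frontier_subset hzf) δ hδ
    rw [dist_comm] at hd
    obtain ⟨x', hx', hdx, hch⟩ := H z' hz'.choose_spec.2.2 hd
    exact ⟨x', hx', hdx, hC.mem_of_mem_slice hx' hch.neg_reverse hz'⟩
  · by_contra! hcon
    obtain ⟨δ, hδ, H⟩ := P.chord_local h.reverse (P.startsAt_interior hzi (-θ)) hx hr
    refine hzf.2 (mem_interior.2 ⟨interior P.region ∩ Metric.ball z δ, ?_,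
      isOpen_interior.inter Metric.isOpen_ball, hzi, Metric.mem_ball_self hδ⟩)
    rintro z' ⟨hz'i, hz'd⟩
    obtain ⟨x', hx', hdx, hch⟩ := H z' hz'i hz'd
    exact subset_closure (mem_slice_of_chord hz'i (hcon x' hx' hdx) hch.neg_reverse)

/-- Every point of the flow boundary of a tame set lies on a generalized diagonal. -/
theorem IsTame.exists_diagonal_of_flowBoundary (hC : P.IsTame C) {z : ℂ} {θ : Circle}
    (hz : (z, θ) ∈ P.flowBoundary C) :
    ∃ (d : P.GeneralizedDiagonal) (k : ℕ), k ≤ d.m ∧ θ = d.vel k ∧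
      z ∈ openSegment ℝ (d.pos k) (d.pos (k + 1)) := by
  have hzi := hz.1
  obtain ⟨y, hy, hzy⟩ := P.exists_chord_of_interior hzi θ
  obtain ⟨x, hx, hxz⟩ := P.exists_chord_of_interior hzi (-θ)
  have hxz := hxz.neg_reverse
  obtain ⟨d, k, hk, h1, h2, h3⟩ := exists_diagonal hx hy (hxz.trans hzy hzi)
    (fun j hj => hC.not_alive _ (hC.isBoundaryPoint_forward hj hzy hz))
    (fun i hi => hC.not_alive_rev _ (hC.isBoundaryPoint_backward hi hxz hz))
  refine ⟨d, k, hk, h2.symm, ?_⟩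
  rw [h1, h3]
  exact hxz.mem_openSegment hzy

/-- Translation along the chord matches the slice near `z` with the slice near `z'`. -/
theorem IsInvariant.flowBoundary_iff_of_chord (hC : P.IsInvariant C) {z z' : ℂ} {θ : Circle}
    (hz : z ∈ interior P.region) (hz' : z' ∈ interior P.region) (h : P.IsChord z θ z') :
    (z, θ) ∈ P.flowBoundary C ↔ (z', θ) ∈ P.flowBoundary C := by
  obtain ⟨r, hr, H⟩ := P.chord_stable h (P.startsAt_interior hz θ) (P.startsAt_interior hz' (-θ))
  set v := z' - z with hv
  have hcv : cross θ v = 0 := by rw [hv, cross_sub_right, h.cross_eq, sub_self]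
  let Φ : ℂ ≃ₜ ℂ := Homeomorph.addRight v
  have hΦ : ∀ w, Φ w = w + v := fun w => rfl
  have hΦc : Continuous fun w : ℂ => w + v := by fun_prop
  let U : Set ℂ := (interior P.region ∩ Metric.ball z r) ∩ (fun w => w + v) ⁻¹' interior P.region
  have hU : IsOpen U := (isOpen_interior.inter Metric.isOpen_ball).inter
    (isOpen_interior.preimage hΦc)
  have hzU : z ∈ U := ⟨⟨hz, Metric.mem_ball_self hr⟩, by simpa [hv] using hz'⟩
  have hchord : ∀ w ∈ U, P.IsChord w θ (w + v) := by
    rintro w ⟨⟨hw1, hw2⟩, hw3⟩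
    refine H w hw1 _ hw3 hw2 ?_ ?_
    · rw [Metric.mem_ball, dist_eq_norm] at hw2
      rw [dist_eq_norm, hv]
      convert hw2 using 2; ring
    · rw [cross_add_right, hcv, add_zero]
  have := mem_frontier_closure_iff_of_homeomorph Φ (A := P.slice C θ) (B := P.slice C θ) hU
    (fun w hw hwA => by
      obtain ⟨x, hx, hch, hwi⟩ := hwA
      exact subset_closure ⟨x, hx, hch.trans (hchord w hw) hwi, hw.2⟩)
    (fun w hw hwB => by
      obtain ⟨x, hx, hch, hwi⟩ := hwB
      exact subset_closure ⟨x, hx, hch.cancel (hchord w hw)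
        (P.not_mem_interior_of_mem_frontier (mem_frontier_of_mem (hC.subset_phaseSpace hx)))
        hw.1.1, hw.1.1⟩) hzU
  rw [hΦ, hv, add_sub_cancel] at this
  rw [mem_flowBoundary_iff, mem_flowBoundary_iff, this]
  simp [hz, hz']

theorem sideReflection_sub {j : Fin n} {y y' : ℂ} (hy : y ∈ P.openSide j) (hy' : y' ∈ P.openSide j) :
    P.sideReflection j (y' - y) = y' - y := by
  obtain ⟨t, ht⟩ := exists_real_mul_of_cross_eq_zero (P.edge_ne_zero j) (P.cross_edge_eq_zero hy hy')
  refine Submodule.reflection_mem_subspace_eq_self (Submodule.mem_span_singleton.2 ⟨t, ?_⟩)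
  rw [ht, Complex.real_smul]; rfl

theorem sideReflection_mul (j : Fin n) (t : ℝ) (v : ℂ) :
    P.sideReflection j (t * v) = t * P.sideReflection j v := by
  rw [← Complex.real_smul, map_smul, Complex.real_smul]

/-- Forward in time the slices match exactly. Backward, the ray may come from a corner; then the
bounce point is replaced by nearby generic members of `C`, so the match holds up to closure. -/
theorem IsTame.flowBoundary_iff_of_bounce (hC : P.IsTame C) {z y z' : ℂ} {θ : Circle} {j : Fin n}
    (hz : z ∈ interior P.region) (hy : y ∈ P.openSide j) (hz' : z' ∈ interior P.region)
    (h : P.IsChord z θ y) (h' : P.IsChord y (P.reflect j θ) z') :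
    (z, θ) ∈ P.flowBoundary C ↔ (z', P.reflect j θ) ∈ P.flowBoundary C := by
  set θ' := P.reflect j θ with hθ'
  have hcθ : cross θ (P.edge j) ≠ 0 := P.inward_ne_zero_iff.1 (h.inward_neg hy).ne
  obtain ⟨r₁, hr₁, H₁⟩ := P.chord_stable h' (P.startsAt_openSide hy (h'.inward_pos hy))
    (P.startsAt_interior hz' (-θ'))
  obtain ⟨r₂, hr₂, H₂⟩ := P.chord_local h (P.startsAt_interior hz θ) hy hr₁
  obtain ⟨a, ha, eya, -⟩ := id h
  obtain ⟨b, hb, ezb, -⟩ := id h'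
  -- The flow for time `a + b` through the bounce: move straight on by `(a + b) θ`, then reflect in
  -- the line of the side through `y`.
  let Φ : ℂ ≃ₜ ℂ := ((Homeomorph.addRight (((a + b : ℝ) : ℂ) * (θ : ℂ) - y)).trans
    (P.sideReflection j).toHomeomorph).trans (Homeomorph.addRight y)
  have hΦ : ∀ w, Φ w = P.sideReflection j (w + (((a + b : ℝ) : ℂ) * (θ : ℂ) - y)) + y := fun w => rfl
  have hΦz : Φ z = z' := by
    have : z + (((a + b : ℝ) : ℂ) * (θ : ℂ) - y) = (b : ℂ) * (θ : ℂ) := by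
      rw [eya]; push_cast; ring
    rw [hΦ, this, sideReflection_mul, ← coe_reflect, ← hθ', ezb]; ring
  have hΦd : ∀ w, dist (Φ w) z' = dist w z := by
    intro w
    rw [← hΦz, hΦ, hΦ, dist_add_right, LinearIsometryEquiv.dist_map, dist_add_right]
  let U : Set ℂ := (interior P.region ∩ Metric.ball z (min r₁ r₂)) ∩ Φ ⁻¹' interior P.region
  have hU : IsOpen U := (isOpen_interior.inter Metric.isOpen_ball).inter
    (isOpen_interior.preimage Φ.continuous)
  have hzU : z ∈ U := ⟨⟨hz, Metric.mem_ball_self (lt_min hr₁ hr₂)⟩, by simpa [hΦz] using hz'⟩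
  have hbounce : ∀ w ∈ U, ∃ y' ∈ P.openSide j, P.IsChord w θ y' ∧ P.IsChord y' θ' (Φ w) := by
    rintro w ⟨⟨hw1, hw2⟩, hw3⟩
    rw [Metric.mem_ball] at hw2
    obtain ⟨y', hy', hdy, hch⟩ := H₂ w hw1 (hw2.trans_le (min_le_right _ _))
    refine ⟨y', hy', hch, H₁ y' hy' _ hw3 hdy ?_ ?_⟩
    · rw [hΦd]; exact hw2.trans_le (min_le_left _ _)
    · obtain ⟨t, -, e, -⟩ := hch
      have e1 : w + (((a + b : ℝ) : ℂ) * (θ : ℂ) - y) = (y' - y) + ((a + b - t : ℝ) : ℂ) * (θ : ℂ) := by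
        rw [e]; push_cast; ring
      have e2 : Φ w = y' + ((a + b - t : ℝ) : ℂ) * (θ' : ℂ) := by
        rw [hΦ, e1, map_add, sideReflection_sub hy hy', sideReflection_mul, ← coe_reflect]; ring
      rw [e2, cross_add_right, cross_mul_right, cross_same]; ring
  have := mem_frontier_closure_iff_of_homeomorph Φ (A := P.slice C θ) (B := P.slice C θ') hU
    (fun w hw hwA => by
      obtain ⟨y', hy', h1, h2⟩ := hbounce w hw
      exact subset_closure (mem_slice_of_chord hw.2 (hC.reflect_mem_of_mem_slice hy' h1 hwA) h2))
    (fun w hw hwB => by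
      obtain ⟨y', hy', h1, h2⟩ := hbounce w hw
      have hmem := hC.mem_of_mem_slice hy' h2 hwB
      refine Metric.mem_closure_iff.2 fun ε hε => ?_
      obtain ⟨r₃, hr₃, H₃⟩ := P.chord_stable h1 (P.startsAt_interior hw.1.1 θ)
        (P.startsAt_openSide hy' (θ := -θ) (h1.reverse.inward_pos hy'))
      obtain ⟨r₄, hr₄, hball⟩ := Metric.isOpen_iff.1 isOpen_interior w hw.1.1
      obtain ⟨y'', hy'', hd, hm, hgen⟩ := hC.exists_generic_mem hy' hmem hcθ
        (lt_min hε (lt_min hr₃ hr₄))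
      have hd1 := hd.trans_le (min_le_left _ _)
      have hd2 := hd.trans_le ((min_le_right _ _).trans (min_le_left _ _))
      have hd3 := hd.trans_le ((min_le_right _ _).trans (min_le_right _ _))
      have hdw : dist (w + (y'' - y')) w = dist y'' y' := by
        rw [dist_eq_norm, add_sub_cancel_left, dist_eq_norm]
      have hwi : w + (y'' - y') ∈ interior P.region := hball (by rw [Metric.mem_ball, hdw]; exact hd3)
      have hcr : cross θ (w + (y'' - y')) = cross θ y'' := by
        rw [cross_add_right, cross_sub_right, h1.cross_eq]; ring
      refine ⟨w + (y'' - y'), hC.mem_slice_of_reflect_mem hwi hy''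
        (H₃ _ hwi _ hy'' (by rw [hdw]; exact hd2) hd2 hcr) hm (by rw [hcr]; exact hgen), ?_⟩
      rw [dist_comm, hdw]; exact hd1) hzU
  rw [hΦz] at this
  rw [mem_flowBoundary_iff, mem_flowBoundary_iff, this]
  simp [hz, hz']

theorem IsInvariant.flowBoundary_of_mem_openSegment (hC : P.IsInvariant C) {x y z z' : ℂ}
    {θ : Circle} (h : P.IsChord x θ y) (hz : z ∈ openSegment ℝ x y) (hz' : z' ∈ openSegment ℝ x y)
    (hb : (z, θ) ∈ P.flowBoundary C) : (z', θ) ∈ P.flowBoundary C := by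
  obtain ⟨⟨s, hs, ez, H⟩, -, hzi⟩ := h.of_mem_openSegment hz
  obtain ⟨⟨s', hs', ez', H'⟩, -, hzi'⟩ := h.of_mem_openSegment hz'
  rcases lt_trichotomy s s' with hlt | rfl | hlt
  · refine (hC.flowBoundary_iff_of_chord hzi hzi' ⟨s' - s, by linarith, ?_, fun a ha => ?_⟩).1 hb
    · rw [ez, ez']; push_cast; ring
    · convert H' (s + a) ⟨by linarith [ha.1], by linarith [ha.2]⟩ using 1
      rw [ez]; push_cast; ring
  · rwa [ez', ← ez]
  · refine (hC.flowBoundary_iff_of_chord hzi' hzi ⟨s - s', by linarith, ?_, fun a ha => ?_⟩).2 hb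
    · rw [ez, ez']; push_cast; ring
    · convert H (s' + a) ⟨by linarith [ha.1], by linarith [ha.2]⟩ using 1
      rw [ez']; push_cast; ring

theorem half_smul_add_half_smul_mem_openSegment (x y : ℂ) :
    ((1 / 2 : ℝ) • x + (1 / 2 : ℝ) • y) ∈ openSegment ℝ x y :=
  ⟨1 / 2, 1 / 2, by norm_num, by norm_num, by norm_num, rfl⟩

/-- Membership of one point spreads over its link, and through the bounces, in both directions, to
all other links. -/
theorem IsTame.trace_subset_flowBoundary (hC : P.IsTame C) (d : P.GeneralizedDiagonal) {z : ℂ}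
    {k : ℕ} (hk : k ≤ d.m) (hz : z ∈ openSegment ℝ (d.pos k) (d.pos (k + 1)))
    (hb : (z, d.vel k) ∈ P.flowBoundary C) : d.trace ⊆ P.flowBoundary C := by
  let Q : ℕ → Prop := fun k => ∀ z ∈ openSegment ℝ (d.pos k) (d.pos (k + 1)),
    (z, d.vel k) ∈ P.flowBoundary C
  have hlink : ∀ k ≤ d.m, ∀ z ∈ openSegment ℝ (d.pos k) (d.pos (k + 1)),
      (z, d.vel k) ∈ P.flowBoundary C → Q k := fun k hk z hz hb z' hz' =>
    hC.flowBoundary_of_mem_openSegment (d.isChord hk) hz hz' hb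
  have hstep : ∀ k < d.m, Q k ↔ Q (k + 1) := by
    intro k hk
    set z := (1 / 2 : ℝ) • d.pos k + (1 / 2 : ℝ) • d.pos (k + 1) with hz
    set z' := (1 / 2 : ℝ) • d.pos (k + 1) + (1 / 2 : ℝ) • d.pos (k + 1 + 1) with hz'
    have hzm := half_smul_add_half_smul_mem_openSegment (d.pos k) (d.pos (k + 1))
    have hzm' := half_smul_add_half_smul_mem_openSegment (d.pos (k + 1)) (d.pos (k + 1 + 1))
    rw [← hz] at hzm
    rw [← hz'] at hzm'
    obtain ⟨-, h1, h2⟩ := (d.isChord hk.le).of_mem_openSegment hzm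
    obtain ⟨h3, -, h4⟩ := (d.isChord (show k + 1 ≤ d.m from hk)).of_mem_openSegment hzm'
    have hs := d.step hk
    obtain ⟨⟨j, hj⟩, -⟩ := hs.mem
    have ev : d.vel (k + 1) = P.reflect j (d.vel k) := hs.eq_reflect hj
    have hiff := hC.flowBoundary_iff_of_bounce h2 hj h4 h1 (by rw [← ev]; exact h3)
    rw [← ev] at hiff
    exact ⟨fun hQ => hlink _ hk _ hzm' (hiff.1 (hQ _ hzm)),
      fun hQ => hlink _ hk.le _ hzm (hiff.2 (hQ _ hzm'))⟩
  have hall : ∀ l ≤ d.m, Q l ↔ Q 0 := by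
    intro l hl
    induction l with
    | zero => rfl
    | succ l ih => rw [← hstep l hl, ih (by omega)]
  rintro ⟨w, ψ⟩ hw
  obtain ⟨l, hl, h1, h2⟩ := d.mem_trace_iff.1 hw
  simp only at h1 h2
  rw [h1]
  exact ((hall l hl).2 ((hall k hk).1 (hlink k hk z hz hb))) w h2

theorem mem_dirs_of_flowBoundary {z : ℂ} {θ : Circle} (hz : (z, θ) ∈ P.flowBoundary C) :
    θ ∈ Prod.snd '' C := by
  have h := isClosed_closure.frontier_subset (P.mem_flowBoundary_iff.1 hz).2
  have hne : (P.slice C θ).Nonempty := closure_nonempty_iff.1 ⟨z, h⟩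
  obtain ⟨w, x, hx, -⟩ := hne
  exact ⟨_, hx, rfl⟩

/-- The flow boundary of a tame set is a finite union of generalized diagonals. -/
theorem IsTame.flowBoundary_eq (hC : P.IsTame C) :
    ∃ S : Set P.GeneralizedDiagonal, S.Finite ∧ P.flowBoundary C = ⋃ d ∈ S, d.trace := by
  refine ⟨{d | d.trace ⊆ P.flowBoundary C}, ?_, ?_⟩
  · refine (GeneralizedDiagonal.finite_of_start (P := P) hC.finite_dirs).subset fun d hd => ?_
    exact mem_dirs_of_flowBoundary (hd (d.mem_trace_iff.2
      ⟨0, Nat.zero_le _, rfl, half_smul_add_half_smul_mem_openSegment _ _⟩))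
  · refine Subset.antisymm ?_ (iUnion₂_subset fun d hd => hd)
    rintro ⟨z, θ⟩ hz
    obtain ⟨d, k, hk, rfl, h2⟩ := hC.exists_diagonal_of_flowBoundary hz
    exact mem_biUnion (x := d) (hC.trace_subset_flowBoundary d hk h2 hz)
      (d.mem_trace_iff.2 ⟨k, hk, rfl, h2⟩)

/-! ### Irrationality forces a flow boundary -/

theorem exists_interior_chord {x : ℂ} {θ : Circle} {i : Fin n} (hx : x ∈ P.openSide i)
    (h : 0 < P.inward i θ) : ∃ z ∈ interior P.region, P.IsChord x θ z := by
  obtain ⟨r, hr, H⟩ := P.startsAt_openSide hx h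
  have H := H x hx (by simpa using hr)
  exact ⟨_, H (r / 2) ⟨by linarith, by linarith⟩, r / 2, by linarith, rfl,
    fun s hs => H s ⟨hs.1, by linarith [hs.2]⟩⟩

theorem interior_subset_of_flowBoundary_eq_empty (hC : P.IsInvariant C)
    (he : P.flowBoundary C = ∅) {θ : Circle} (hθ : θ ∈ Prod.snd '' C) :
    interior P.region ⊆ closure (P.slice C θ) := by
  have hfr : ∀ z ∈ interior P.region, z ∉ frontier (closure (P.slice C θ)) := by
    intro z hz hf
    have : (z, θ) ∈ P.flowBoundary C := ⟨hz, hf⟩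
    rw [he] at this
    exact this
  rcases P.isConnected_interior_region.isPreconnected.subset_interior_or_subset_compl hfr with h | h
  · exact h.trans interior_subset
  · obtain ⟨⟨x, φ⟩, hx, rfl⟩ := hθ
    obtain ⟨i, hi, hin⟩ := P.mem_phaseSpace_iff.1 (hC.subset_phaseSpace hx)
    obtain ⟨z, hz, hch⟩ := exists_interior_chord hi hin
    exact absurd (subset_closure (mem_slice_of_chord hz hx hch)) (h hz)

/-- All slices in play are dense. If `θ` arrives at side `i`, a slice point bounces there; if `θ` is
parallel to it, reflection fixes `θ`. If `θ` leaves the side, `C` has a point there in direction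
`θ`, and after a perturbation avoiding corners its preimage has the reflected direction. -/
theorem IsTame.reflect_mem_dirs (hC : P.IsTame C) (he : P.flowBoundary C = ∅) {θ : Circle}
    (hθ : θ ∈ Prod.snd '' C) (i : Fin n) : P.reflect i θ ∈ Prod.snd '' C := by
  have hK := interior_subset_of_flowBoundary_eq_empty hC.toIsInvariant he hθ
  obtain ⟨y, hy⟩ : ∃ y, y ∈ P.openSide i := ⟨_, half_smul_add_half_smul_mem_openSegment _ _⟩
  rcases lt_trichotomy (P.inward i θ) 0 with hneg | hzero | hpos
  · obtain ⟨z, hz, hch⟩ := exists_interior_chord (θ := -θ) hy (by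
      rw [Circle.coe_neg, inward_neg]; linarith)
    obtain ⟨r, hr, H⟩ := P.chord_local hch.neg_reverse (P.startsAt_interior hz θ) hy one_pos
    obtain ⟨z', hz', hd⟩ := Metric.mem_closure_iff.1 (hK hz) r hr
    rw [dist_comm] at hd
    obtain ⟨y', hy', -, hch'⟩ := H z' hz'.choose_spec.2.2 hd
    exact ⟨_, hC.reflect_mem_of_mem_slice hy' hch' hz', rfl⟩
  · have hc : cross (P.edge i) θ = 0 := by
      by_contra hne
      exact mul_ne_zero (P.sign_ne_zero i) hne hzero
    obtain ⟨t, ht⟩ := exists_real_mul_of_cross_eq_zero (P.edge_ne_zero i) hc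
    have : P.reflect i θ = θ := by
      apply Circle.ext
      rw [coe_reflect]
      refine Submodule.reflection_mem_subspace_eq_self (Submodule.mem_span_singleton.2 ⟨t, ?_⟩)
      rw [ht, Complex.real_smul]; rfl
    rwa [this]
  · obtain ⟨z, hz, hch⟩ := exists_interior_chord hy hpos
    obtain ⟨r, hr, H⟩ := P.chord_local hch.reverse (P.startsAt_interior hz (-θ)) hy one_pos
    obtain ⟨z', hz', hd⟩ := Metric.mem_closure_iff.1 (hK hz) r hr
    rw [dist_comm] at hd
    obtain ⟨y', hy', -, hch'⟩ := H z' hz'.choose_spec.2.2 hd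
    have hmem := hC.mem_of_mem_slice hy' hch'.neg_reverse hz'
    set ψ := P.reflect i θ with hψ
    have hψin : P.inward i ψ = -P.inward i θ := P.inward_reflect i θ
    have hψc : cross ψ (P.edge i) ≠ 0 := P.inward_ne_zero_iff.1 (by linarith : P.inward i ψ < 0).ne
    obtain ⟨y'', hy'', -, hm, hgen⟩ := hC.exists_generic_mem hy' hmem hψc one_pos
    have hrev : (y'', -ψ) ∈ P.phaseSpace := (P.mk_mem_phaseSpace_iff hy'').2 (by
      rw [Circle.coe_neg, inward_neg]; linarith)
    obtain ⟨x, hx, hxch⟩ := P.exists_chord_of_phaseSpace hrev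
    have hxch := hxch.neg_reverse
    rcases P.mem_frontier_iff.1 hx with ⟨l, hl⟩ | hxc
    · have hs := hxch.step hy''
      rw [hψ, reflect_reflect, ← hψ] at hs
      exact ⟨_, (hC.mem_iff _ ((P.mk_mem_phaseSpace_iff hl).2 (hxch.inward_pos hl)) _ hs.mem hs).2 hm,
        rfl⟩
    · exact absurd hxch.cross_eq (hgen x hxc)

/-- In an irrational table, a non-empty tame set has a non-empty flow boundary. -/
theorem IsTame.flowBoundary_nonempty (hC : P.IsTame C) (hP : P.IsIrrational) (hne : C.Nonempty) :
    (P.flowBoundary C).Nonempty := by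
  by_contra hcon
  have he := not_nonempty_iff_eq_empty.1 hcon
  set S := Prod.snd '' C with hS
  -- Stability under all of `D`, proved for `g` and `g⁻¹` together so that the closure induction
  -- handles inverses.
  let p : (ℂ ≃ₗᵢ[ℝ] ℂ) → Prop := fun g => ∀ θ ∈ S, ∃ θ' ∈ S, (θ' : ℂ) = g θ
  have hD : ∀ g ∈ P.dihedralGroup, p g ∧ p g⁻¹ := by
    intro g hg
    induction hg using Subgroup.closure_induction with
    | mem g hg =>
      obtain ⟨i, rfl⟩ := hg
      have hp : p (P.sideReflection i) := fun θ hθ => ⟨_, hC.reflect_mem_dirs he hθ i, rfl⟩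
      refine ⟨hp, ?_⟩
      rwa [sideReflection, Submodule.reflection_inv]
    | one => simpa using fun θ hθ => ⟨θ, hθ, rfl⟩
    | mul g h _ _ ihg ihh =>
      have hmul : ∀ a b, p a → p b → p (a * b) := by
        intro a b ha hb θ hθ
        obtain ⟨θ', hθ', e⟩ := hb θ hθ
        obtain ⟨θ'', hθ'', e'⟩ := ha θ' hθ'
        exact ⟨θ'', hθ'', by rw [e', e]; rfl⟩
      rw [mul_inv_rev]
      exact ⟨hmul _ _ ihg.1 ihh.1, hmul _ _ ihh.2 ihg.2⟩
    | inv g _ ih => rw [inv_inv]; exact ih.symm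
  obtain ⟨u, hu⟩ := hne
  have hfin : (P.dihedralGroup : Set (ℂ ≃ₗᵢ[ℝ] ℂ)).Finite :=
    (LinearIsometryEquiv.finite_setOf_apply_mem u.2 hC.finite_dirs).subset fun g hg =>
      (hD g hg).1 _ ⟨u, hu, rfl⟩
  exact hP.not_finite hfin.to_subtype

end BilliardTable

/-! ### Iterates near a point -/

namespace BilliardTable

variable {n : ℕ} [NeZero n] {P : BilliardTable n} {C : Set (ℂ × Circle)}

theorem IsAperiodic.isTame (hC : P.IsAperiodic C)
    (h : ∀ i, ∀ x ∈ P.openSide i, ∀ θ, (x, θ) ∈ C →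
      ∀ r > 0, ∃ x' ∈ P.openSide i, x' ≠ x ∧ dist x' x < r ∧ (x', θ) ∈ C) : P.IsTame C where
  toIsInvariant := hC.toIsInvariant
  finite_dirs := hC.finite_dirs
  perfect := h
  not_alive := fun _ hu => (hC.gapAdjacent_of_boundary hu).not_alive hC
  not_alive_rev := fun _ hu => (hC.gapAdjacent_of_boundary hu).not_alive_rev hC

theorem IsForwardOrbit.eq_iterate {u : ℂ × Circle} {o : ℕ → ℂ × Circle}
    (ho : P.IsForwardOrbit u o) : o = fun k => P.next^[k] u := by
  funext k
  induction k with
  | zero => exact ho.2.1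
  | succ k ih => rw [Function.iterate_succ_apply', ← ih, (ho.2.2 k).next_eq]

theorem IsForwardOrbit.alive {u : ℂ × Circle} {o : ℕ → ℂ × Circle}
    (ho : P.IsForwardOrbit u o) (k : ℕ) : P.Alive k u := by
  intro l _
  have := ho.2.2 l
  rw [ho.eq_iterate] at this
  exact ⟨_, this⟩

theorem mem_openSide_of_near {x : ℂ} {i : Fin n} (hx : x ∈ P.openSide i) :
    ∃ r > 0, ∀ z, dist z x < r → z ∈ frontier P.region → z ∈ P.openSide i := by
  obtain ⟨r, hr, H⟩ := P.exists_ball_frontier hx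
  exact ⟨r, hr, fun z hz => (H z hz).1⟩

theorem exists_small_add_mem_openSide {x : ℂ} {i : Fin n} (hx : x ∈ P.openSide i) {ε : ℝ}
    (hε : 0 < ε) : ∃ d, d ≠ 0 ∧ ‖d‖ < ε ∧ x + d ∈ P.openSide i := by
  obtain ⟨r, hr, H⟩ := P.exists_ball_frontier hx
  have hen : 0 < ‖P.edge i‖ := norm_pos_iff.2 (P.edge_ne_zero i)
  set t : ℝ := min ε r / (2 * ‖P.edge i‖) with ht
  have hm : 0 < min ε r := lt_min hε hr
  have ht0 : 0 < t := by positivity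
  have hnorm : ‖(t : ℂ) * P.edge i‖ < min ε r := by
    rw [norm_mul, Complex.norm_real, Real.norm_eq_abs, abs_of_pos ht0, ht]
    have : min ε r / (2 * ‖P.edge i‖) * ‖P.edge i‖ = min ε r / 2 := by field_simp
    rw [this]; linarith
  refine ⟨t * P.edge i, mul_ne_zero (by exact_mod_cast ht0.ne') (P.edge_ne_zero i),
    hnorm.trans_le (min_le_left _ _), (H _ ?_).2 ?_⟩
  · rw [dist_eq_norm, add_sub_cancel_left]; exact hnorm.trans_le (min_le_right _ _)
  · rw [add_sub_cancel_left, cross_mul_right, cross_same, mul_zero]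

/-- An even iterate of the billiard map is locally a translation in the transversal direction, hence
it fixes a point if and only if it fixes the nearby points. -/
theorem iterate_eq_self_local {x : ℂ} {θ : Circle} {i : Fin n} (hx : x ∈ P.openSide i)
    (hu : (x, θ) ∈ P.phaseSpace) {m : ℕ} (hm : Even m) (h : P.Alive m (x, θ)) :
    ∃ r > 0, ∀ x' ∈ P.openSide i, dist x' x < r → P.Alive m (x', θ) ∧
      (P.next^[m] (x', θ) = (x', θ) ↔ P.next^[m] (x, θ) = (x, θ)) := by
  obtain ⟨r, hr, H⟩ := h.nhds hx
  refine ⟨r, hr, fun x' hx' hd => ⟨H x' hx' hd, ?_⟩⟩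
  obtain ⟨j, y, hy, y', hy', φ, hφ, Hs, hc⟩ := P.iterate_strip hx hx' hu m (fun t ht => by
    refine H _ (P.add_mul_sub_mem_openSide hx hx' ht) ?_
    rw [dist_eq_norm, add_sub_cancel_left, norm_mul, Complex.norm_real, Real.norm_eq_abs,
      abs_of_nonneg ht.1]
    rw [dist_eq_norm] at hd
    exact (mul_le_of_le_one_left (norm_nonneg _) ht.2).trans_lt hd)
  have h0 := Hs 0 (by simp)
  have h1 := Hs 1 (by simp)
  simp only [Complex.ofReal_zero, zero_mul, add_zero, Complex.ofReal_one, one_mul,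
    add_sub_cancel] at h0 h1
  rw [h0, h1]
  rw [hm.neg_one_pow, one_mul] at hc
  have hne : cross θ (P.edge i) ≠ 0 :=
    P.inward_ne_zero_iff.1 ((P.mk_mem_phaseSpace_iff hx).1 hu).ne'
  simp only [Prod.mk.injEq]
  constructor
  · rintro ⟨rfl, rfl⟩
    obtain rfl := P.openSide_inj hx' hy'
    refine ⟨eq_of_line_of_cross_eq (P.edge_ne_zero i) hne (P.cross_edge_eq_zero hx hy) ?_, rfl⟩
    rw [cross_sub_right] at hc ⊢
    rw [cross_sub_right] at hc
    linarith
  · rintro ⟨rfl, rfl⟩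
    obtain rfl := P.openSide_inj hx hy
    refine ⟨eq_of_line_of_cross_eq (P.edge_ne_zero i) hne (P.cross_edge_eq_zero hx' hy') ?_, rfl⟩
    rw [cross_sub_right] at hc ⊢
    rw [cross_sub_right] at hc
    linarith

theorem iterate_dir_local {x : ℂ} {θ : Circle} {i : Fin n} (hx : x ∈ P.openSide i) {m : ℕ}
    (h : P.Alive m (x, θ)) : ∃ r > 0, ∀ x' ∈ P.openSide i, dist x' x < r →
      ∀ j ≤ m, (P.next^[j] (x', θ)).2 = (P.next^[j] (x, θ)).2 := by
  induction m with
  | zero =>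
    refine ⟨1, one_pos, fun x' _ _ j hj => ?_⟩
    obtain rfl : j = 0 := by omega
    rfl
  | succ m ih =>
    obtain ⟨r, hr, H⟩ := ih (h.mono m.le_succ)
    obtain ⟨l, -, H'⟩ := P.alive_local hx h
    obtain ⟨r', hr', H'⟩ := H' 1 one_pos
    refine ⟨min r r', lt_min hr hr', fun x' hx' hd j hj => ?_⟩
    rcases hj.lt_or_eq with hlt | rfl
    · exact H x' hx' (hd.trans_le (min_le_left _ _)) j (by omega)
    · exact (H' x' hx' (hd.trans_le (min_le_right _ _))).2.2.2

theorem Alive.of_iterate_eq_self {u : ℂ × Circle} {m : ℕ} (hm : 0 < m) (h : P.Alive m u)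
    (he : P.next^[m] u = u) (k : ℕ) : P.Alive k u := by
  have : ∀ l, P.Alive (m * l) u := by
    intro l
    induction l with
    | zero => exact P.alive_zero u
    | succ l ih =>
      rw [Nat.mul_succ, add_comm]
      exact P.alive_add_iff.2 ⟨h, by rwa [he]⟩
  exact (this k).mono (Nat.le_mul_of_pos_left k hm)

/-! ### The closure of an orbit -/

variable (P) in
/-- The floorwise closure in the phase space of the forward orbit of `u`. -/
def orbitClosure (u : ℂ × Circle) : Set (ℂ × Circle) :=
  {p | p ∈ P.phaseSpace ∧ ∀ r > 0, ∃ k, (P.next^[k] u).2 = p.2 ∧ dist (P.next^[k] u).1 p.1 < r}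

/-- With finitely many directions, orbit points close enough to `(x, θ)` have direction exactly `θ`.
-/
theorem orbitClosure_eq {u : ℂ × Circle} (hfin : (range fun k => (P.next^[k] u).2).Finite) :
    P.orbitClosure u = P.phaseSpace ∩ closure (range fun k => P.next^[k] u) := by
  ext ⟨x, θ⟩
  constructor
  · rintro ⟨hX, H⟩
    refine ⟨hX, Metric.mem_closure_iff.2 fun ε hε => ?_⟩
    obtain ⟨k, h1, h2⟩ := H ε hε
    refine ⟨_, ⟨k, rfl⟩, ?_⟩
    rw [Prod.dist_eq, dist_comm, max_lt_iff]
    simp only at h1 h2 ⊢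
    rw [h1, dist_self]
    exact ⟨h2, hε⟩
  · rintro ⟨hX, hcl⟩
    refine ⟨hX, fun r hr => ?_⟩
    have hF : ((range fun k => (P.next^[k] u).2) \ {θ}).Finite := hfin.subset sdiff_subset
    obtain ⟨δ, hδ, Hδ⟩ := Metric.isOpen_iff.1 hF.isClosed.isOpen_compl θ (by simp)
    obtain ⟨_, ⟨k, rfl⟩, hd⟩ := Metric.mem_closure_iff.1 hcl (min r δ) (lt_min hr hδ)
    rw [Prod.dist_eq, max_lt_iff] at hd
    refine ⟨k, ?_, ?_⟩
    · by_contra hne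
      refine Hδ (Metric.mem_ball.2 ?_) ⟨⟨k, rfl⟩, hne⟩
      rw [dist_comm]; exact hd.2.trans_le (min_le_right _ _)
    · rw [dist_comm]; exact hd.1.trans_le (min_le_left _ _)

theorem iterate_mem_orbitClosure {u : ℂ × Circle} (hu : u ∈ P.phaseSpace) (hal : ∀ k, P.Alive k u)
    (k : ℕ) : P.next^[k] u ∈ P.orbitClosure u :=
  ⟨(hal k).mem hu, fun r hr => ⟨k, rfl, by simpa using hr⟩⟩

theorem alive_iterate {u : ℂ × Circle} (hal : ∀ k, P.Alive k u) (j k : ℕ) :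
    P.Alive k (P.next^[j] u) := (P.alive_add_iff.1 (hal (j + k))).2

theorem iterate_ne_of_not_periodic {u : ℂ × Circle} (hu : u ∈ P.phaseSpace)
    (hal : ∀ k, P.Alive k u) (hper : ∀ k, 0 < k → P.next^[k] u ≠ u) (j : ℕ) {k : ℕ} (hk : 0 < k) :
    P.next^[k] (P.next^[j] u) ≠ P.next^[j] u := by
  intro he
  rw [← Function.iterate_add_apply, add_comm, Function.iterate_add_apply] at he
  exact hper k hk (iterate_next_inj ((hal k).mem hu) hu (alive_iterate hal k j) (hal j) he)

theorem finite_iterate_dirs {u : ℂ × Circle} (hfin : (range fun k => (P.next^[k] u).2).Finite)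
    (j : ℕ) : (range fun k => (P.next^[k] (P.next^[j] u)).2).Finite := by
  refine hfin.subset ?_
  rintro _ ⟨k, rfl⟩
  exact ⟨k + j, by simp only [Function.iterate_add_apply]⟩

/-- An infinite forward orbit in finitely many floors returns close to its initial point. -/
theorem exists_return_near {u : ℂ × Circle} (hu : u ∈ P.phaseSpace) (hal : ∀ k, P.Alive k u)
    (hfin : (range fun k => (P.next^[k] u).2).Finite) {ε : ℝ} (hε : 0 < ε) :
    ∃ m, 0 < m ∧ (P.next^[m] u).2 = u.2 ∧ dist (P.next^[m] u).1 u.1 < ε := by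
  obtain ⟨x, θ⟩ := u
  obtain ⟨⟨i, hi⟩, -⟩ := id hu
  obtain ⟨d, hd, hdn, hid⟩ := exists_small_add_mem_openSide hi (half_pos hε)
  obtain ⟨m, hm, s, hs, s', hs', H⟩ := P.exists_isometric_return hi hid hd hu hal hfin
  have h0 := (H 0 ⟨le_rfl, hs.1.le⟩).2
  simp only [Complex.ofReal_zero, zero_mul, add_zero, zero_sub] at h0
  refine ⟨m, hm, by rw [h0], ?_⟩
  rw [h0, dist_eq_norm]
  simp only [add_sub_cancel_left]
  rw [norm_mul, Complex.norm_real, Real.norm_eq_abs]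
  have : |s' + (-1) ^ m * -s| ≤ 2 := by
    rcases neg_one_pow_eq_or ℝ m with h | h <;> rw [h, abs_le] <;>
      constructor <;> linarith [hs.1, hs.2, hs'.1, hs'.2]
  have := mul_le_mul_of_nonneg_right this (norm_nonneg d)
  linarith

theorem isRecurrentOrbit_iterate {u : ℂ × Circle} (hu : u ∈ P.phaseSpace) (hal : ∀ k, P.Alive k u)
    (hfin : (range fun k => (P.next^[k] u).2).Finite)
    (hper : ∀ k, 0 < k → P.next^[k] u ≠ u) : IsRecurrentOrbit fun k => P.next^[k] u := by
  unfold IsRecurrentOrbit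
  rw [mapClusterPt_iff_frequently]
  intro U hU
  rw [frequently_atTop]
  intro N
  -- Non-periodicity keeps `u` away from its finitely many early iterates; removing them from the
  -- neighbourhood forces the return time to be at least `N`.
  have hF : ((fun k => P.next^[k] u) '' (Ioo 0 N)).Finite := (finite_Ioo 0 N).image _
  have hnot : u ∉ (fun k => P.next^[k] u) '' (Ioo 0 N) := by
    rintro ⟨k, hk, he⟩
    exact hper k hk.1 he
  obtain ⟨ε, hε, H⟩ := Metric.mem_nhds_iff.1 (inter_mem hU (hF.isClosed.isOpen_compl.mem_nhds hnot))
  obtain ⟨m, hm, h1, h2⟩ := exists_return_near hu hal hfin hε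
  have hmem := H (Metric.mem_ball.2 (show dist (P.next^[m] u) u < ε by
    rw [Prod.dist_eq, h1, dist_self]; exact max_lt h2 hε))
  refine ⟨m, ?_, hmem.1⟩
  by_contra hlt
  exact hmem.2 ⟨m, ⟨hm, not_le.1 hlt⟩, rfl⟩

/-- A positive index guarantees a predecessor in the orbit, needed for backward invariance of the
closure. Index 0 is replaced by a return to `u`. -/
theorem exists_pos_of_mem_orbitClosure {u p : ℂ × Circle} (hu : u ∈ P.phaseSpace)
    (hal : ∀ k, P.Alive k u) (hfin : (range fun k => (P.next^[k] u).2).Finite)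
    (hp : p ∈ P.orbitClosure u) {r : ℝ} (hr : 0 < r) :
    ∃ k, 0 < k ∧ (P.next^[k] u).2 = p.2 ∧ dist (P.next^[k] u).1 p.1 < r := by
  obtain ⟨k, h1, h2⟩ := hp.2 (r / 2) (half_pos hr)
  rcases Nat.eq_zero_or_pos k with rfl | hk
  · obtain ⟨m, hm, h3, h4⟩ := exists_return_near hu hal hfin (half_pos hr)
    refine ⟨m, hm, h3.trans h1, ?_⟩
    have := dist_triangle (P.next^[m] u).1 u.1 p.1
    simp only [Function.iterate_zero, id] at h2
    linarith
  · exact ⟨k, hk, h1, by linarith⟩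

theorem isAperiodic_orbitClosure {u : ℂ × Circle} (hu : u ∈ P.phaseSpace)
    (hal : ∀ k, P.Alive k u) (hfin : (range fun k => (P.next^[k] u).2).Finite)
    (hper : ∀ k, 0 < k → P.next^[k] u ≠ u) : P.IsAperiodic (P.orbitClosure u) where
  subset_phaseSpace := fun _ h => h.1
  finite_dirs := by
    refine hfin.subset ?_
    rintro _ ⟨p, hp, rfl⟩
    obtain ⟨k, h, -⟩ := hp.2 1 one_pos
    exact ⟨k, h⟩
  mem_iff := by
    rintro ⟨x, θ⟩ hX ⟨y, θ'⟩ hX' hs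
    obtain ⟨⟨i, hi⟩, -⟩ := id hX
    obtain ⟨⟨j, hj⟩, -⟩ := id hX'
    simp only at hi hj
    constructor
    · intro hmem
      refine ⟨hX', fun r hr => ?_⟩
      obtain ⟨δ, hδ, H⟩ := P.step_local hs hi hj hr
      obtain ⟨ρ, hρ, Hρ⟩ := mem_openSide_of_near hi
      obtain ⟨k, h1, h2⟩ := hmem.2 _ (lt_min hδ hρ)
      simp only at h1 h2
      obtain ⟨y', -, hd, hs'⟩ := H _ (Hρ _ (h2.trans_le (min_le_right _ _))
        (mem_frontier_of_mem ((hal k).mem hu))) (h2.trans_le (min_le_left _ _))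
      rw [← h1] at hs'
      refine ⟨k + 1, ?_, ?_⟩ <;>
        rw [Function.iterate_succ_apply', show P.next (P.next^[k] u) = (y', θ') from hs'.next_eq]
      exact hd
    · intro hmem
      refine ⟨hX, fun r hr => ?_⟩
      obtain ⟨δ, hδ, H⟩ := P.step_local_backward hs hi hj hr
      obtain ⟨ρ, hρ, Hρ⟩ := mem_openSide_of_near hj
      obtain ⟨k, hk, h1, h2⟩ := exists_pos_of_mem_orbitClosure hu hal hfin hmem (lt_min hδ hρ)
      simp only at h1 h2
      obtain ⟨x', hx', hd, hs'⟩ := H _ (Hρ _ (h2.trans_le (min_le_right _ _))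
        (mem_frontier_of_mem ((hal k).mem hu))) (h2.trans_le (min_le_left _ _))
      rw [← h1] at hs'
      have hs'' := (hal k).step (l := k - 1) (by omega)
      rw [Nat.sub_add_cancel hk] at hs''
      have e := Step.inj ((hal (k - 1)).mem hu) (P.mk_mem_phaseSpace_of hi hx' hX) hs'' hs'
      exact ⟨k - 1, by rw [e], by rw [e]; exact hd⟩
  closed := by
    intro i x hx θ hX H
    refine ⟨hX, fun r hr => ?_⟩
    obtain ⟨x', -, hd, hmem⟩ := H (r / 2) (half_pos hr)
    obtain ⟨k, h1, h2⟩ := hmem.2 (r / 2) (half_pos hr)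
    exact ⟨k, h1, by simp only at h2 ⊢; linarith [dist_triangle (P.next^[k] u).1 x' x]⟩
  aperiodic := by
    rintro ⟨x, θ⟩ hmem k hk halk he
    obtain ⟨⟨i, hi⟩, -⟩ := id hmem.1
    -- Doubling the period makes the iterate locally a translation, so orbit points of `u` close to
    -- `(x, θ)` would be periodic too.
    have hal2 : P.Alive (k + k) (x, θ) := halk.of_iterate_eq_self hk he _
    have he2 : P.next^[k + k] (x, θ) = (x, θ) := by rw [Function.iterate_add_apply, he, he]
    obtain ⟨r, hr, H⟩ := iterate_eq_self_local hi hmem.1 ⟨k, rfl⟩ hal2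
    obtain ⟨ρ, hρ, Hρ⟩ := mem_openSide_of_near hi
    obtain ⟨j, h1, h2⟩ := hmem.2 _ (lt_min hr hρ)
    simp only at h1 h2
    have h3 := ((H _ (Hρ _ (h2.trans_le (min_le_right _ _))
      (mem_frontier_of_mem ((hal j).mem hu))) (h2.trans_le (min_le_left _ _))).2).2 he2
    rw [← h1] at h3
    exact iterate_ne_of_not_periodic hu hal hper j (by omega) h3

/-- If the approximating orbit point sits at `x` itself, a later return of it comes close again and
differs from it, as the orbit is not periodic. -/
theorem orbitClosure_perfect {u : ℂ × Circle} (hu : u ∈ P.phaseSpace)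
    (hal : ∀ k, P.Alive k u) (hfin : (range fun k => (P.next^[k] u).2).Finite)
    (hper : ∀ k, 0 < k → P.next^[k] u ≠ u) (i : Fin n) (x : ℂ) (hx : x ∈ P.openSide i) (θ : Circle)
    (hmem : (x, θ) ∈ P.orbitClosure u) (r : ℝ) (hr : 0 < r) :
    ∃ x' ∈ P.openSide i, x' ≠ x ∧ dist x' x < r ∧ (x', θ) ∈ P.orbitClosure u := by
  obtain ⟨ρ, hρ, Hρ⟩ := mem_openSide_of_near hx
  suffices H : ∃ k, (P.next^[k] u).2 = θ ∧ dist (P.next^[k] u).1 x < min r ρ ∧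
      (P.next^[k] u).1 ≠ x by
    obtain ⟨k, h1, h2, h3⟩ := H
    refine ⟨_, Hρ _ (h2.trans_le (min_le_right _ _)) (mem_frontier_of_mem ((hal k).mem hu)), h3,
      h2.trans_le (min_le_left _ _), ?_⟩
    rw [← h1]
    exact iterate_mem_orbitClosure hu hal k
  obtain ⟨k, h1, h2⟩ := hmem.2 _ (lt_min hr hρ)
  simp only at h1 h2
  by_cases he : (P.next^[k] u).1 = x
  · obtain ⟨m, hm, h3, h4⟩ := exists_return_near ((hal k).mem hu) (alive_iterate hal k)
      (finite_iterate_dirs hfin k) (lt_min hr hρ)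
    refine ⟨m + k, ?_, ?_, fun h5 => ?_⟩
    · rw [Function.iterate_add_apply, h3, h1]
    · rw [Function.iterate_add_apply, ← he]; exact h4
    · refine iterate_ne_of_not_periodic hu hal hper k hm (Prod.ext ?_ h3)
      rw [← Function.iterate_add_apply, h5, he]
  · exact ⟨k, h1, h2, he⟩

theorem isTame_orbitClosure {u : ℂ × Circle} (hu : u ∈ P.phaseSpace)
    (hal : ∀ k, P.Alive k u) (hfin : (range fun k => (P.next^[k] u).2).Finite)
    (hper : ∀ k, 0 < k → P.next^[k] u ≠ u) : P.IsTame (P.orbitClosure u) :=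
  (isAperiodic_orbitClosure hu hal hfin hper).isTame (orbitClosure_perfect hu hal hfin hper)

/-- A closed invariant set contains the closures of its orbits. -/
theorem IsAperiodic.orbitClosure_subset (hC : P.IsAperiodic C) {u : ℂ × Circle}
    (hal : ∀ k, P.Alive k u) (hu : u ∈ C) : P.orbitClosure u ⊆ C := by
  have hX := hC.subset_phaseSpace hu
  rintro ⟨x, θ⟩ ⟨hp, H⟩
  obtain ⟨⟨i, hi⟩, -⟩ := id hp
  refine hC.closed i x hi θ hp fun r hr => ?_
  obtain ⟨ρ, hρ, Hρ⟩ := mem_openSide_of_near hi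
  obtain ⟨k, h1, h2⟩ := H _ (lt_min hr hρ)
  simp only at h1 h2
  refine ⟨_, Hρ _ (h2.trans_le (min_le_right _ _)) (mem_frontier_of_mem ((hal k).mem hX)),
    h2.trans_le (min_le_left _ _), ?_⟩
  rw [← h1]
  exact (hC.iterate_mem_iff hX (hal k)).2 hu

/-- Every infinite forward orbit in the closure of a non-periodic orbit is dense in it. -/
theorem orbitClosure_minimal {u v : ℂ × Circle} (hu : u ∈ P.phaseSpace)
    (hal : ∀ k, P.Alive k u) (hfin : (range fun k => (P.next^[k] u).2).Finite)
    (hper : ∀ k, 0 < k → P.next^[k] u ≠ u) (hv : v ∈ P.orbitClosure u)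
    (halv : ∀ k, P.Alive k v) :
    P.orbitClosure u ⊆ P.orbitClosure v ∧ (range fun k => (P.next^[k] v).2).Finite := by
  have hA := isAperiodic_orbitClosure hu hal hfin hper
  have hfinv := hA.finite_orbit_dirs hv halv
  refine ⟨?_, hfinv⟩
  have hvX := hA.subset_phaseSpace hv
  have hA' := isAperiodic_orbitClosure hvX halv hfinv
    fun k hk => hA.aperiodic v hv k hk (halv k)
  have hvA' : v ∈ P.orbitClosure v := iterate_mem_orbitClosure hvX halv 0
  obtain ⟨⟨i, hi⟩, -⟩ := id hvX
  -- Otherwise `v` would be a boundary point of its own orbit closure, hence gap-adjacent, and could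
  -- not have an infinite forward orbit.
  have hint : ∃ r > 0, ∀ x' ∈ P.openSide i, dist x' v.1 < r → (x', v.2) ∈ P.orbitClosure v := by
    by_contra! hcon
    refine (hA'.gapAdjacent_of_boundary ⟨hvX, i, hi, fun r hr => ⟨v.1, hi, by simpa using hr, hvA'⟩,
      hcon⟩).not_alive hA' halv
  obtain ⟨r, hr, H⟩ := hint
  obtain ⟨ρ, hρ, Hρ⟩ := mem_openSide_of_near hi
  obtain ⟨k, h1, h2⟩ := hv.2 _ (lt_min hr hρ)
  have hk := H _ (Hρ _ (h2.trans_le (min_le_right _ _)) (mem_frontier_of_mem ((hal k).mem hu)))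
    (h2.trans_le (min_le_left _ _))
  rw [← h1] at hk
  exact hA'.orbitClosure_subset hal ((hA'.iterate_mem_iff hu (hal k)).1 hk)

theorem isFlatStrip_orbitClosure (hP : P.IsIrrational) {u : ℂ × Circle} (hu : u ∈ P.phaseSpace)
    (hal : ∀ k, P.Alive k u) (hfin : (range fun k => (P.next^[k] u).2).Finite)
    (hper : ∀ k, 0 < k → P.next^[k] u ≠ u) : P.IsFlatStrip (P.orbitClosure u) := by
  have hT := isTame_orbitClosure hu hal hfin hper
  exact {
    subset_phaseSpace := hT.subset_phaseSpace
    invariant := hT.mem_iff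
    finite_floors := hT.finite_dirs
    minimal := by
      intro v hv o ho
      obtain ⟨h1, h2⟩ := orbitClosure_minimal hu hal hfin hper hv ho.alive
      rw [ho.eq_iterate]
      rw [orbitClosure_eq h2] at h1
      exact h1.trans inter_subset_right
    boundary := ⟨hT.flowBoundary_nonempty hP ⟨u, iterate_mem_orbitClosure hu hal 0⟩,
      hT.flowBoundary_eq⟩ }

/-! ### Periodic orbits -/

variable (P) in
/-- The points of period `m` whose orbits have directions in `Θ`. -/
def periodicSet (m : ℕ) (Θ : Set Circle) : Set (ℂ × Circle) :=
  {q | q ∈ P.phaseSpace ∧ P.Alive m q ∧ P.next^[m] q = q ∧ ∀ j, (P.next^[j] q).2 ∈ Θ}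

theorem iterate_mem_periodicSet {m : ℕ} (hm : 0 < m) {Θ : Set Circle} {q : ℂ × Circle}
    (hq : q ∈ P.periodicSet m Θ) (j : ℕ) : P.next^[j] q ∈ P.periodicSet m Θ := by
  obtain ⟨hX, hal, he, hd⟩ := hq
  have halA := hal.of_iterate_eq_self hm he
  refine ⟨(halA j).mem hX, alive_iterate halA j m, ?_, fun k => ?_⟩
  · rw [← Function.iterate_add_apply, add_comm, Function.iterate_add_apply, he]
  · rw [← Function.iterate_add_apply]; exact hd _

theorem isInvariant_periodicSet {m : ℕ} (hm : 0 < m) (Θ : Set Circle) :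
    P.IsInvariant (P.periodicSet m Θ) where
  subset_phaseSpace := fun _ h => h.1
  mem_iff := by
    intro a ha b hb hs
    constructor
    · intro hmem
      rw [← hs.next_eq]
      exact iterate_mem_periodicSet hm hmem 1
    · intro hmem
      have hmem' := iterate_mem_periodicSet hm hmem (m - 1)
      have hs' := hmem.2.1.step (l := m - 1) (by omega)
      rw [Nat.sub_add_cancel hm, hmem.2.2.1] at hs'
      rwa [Step.inj ha hmem'.1 hs hs']

/-- Even iterates are local translations and nearby points share the directions of the first `m`
steps, which periodicity extends to all times. So membership is locally constant wherever `m` steps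
are defined. -/
theorem mem_periodicSet_local {m : ℕ} (hm : 0 < m) (hme : Even m) (Θ : Set Circle) {x : ℂ}
    {θ : Circle} {i : Fin n} (hx : x ∈ P.openSide i) (hu : (x, θ) ∈ P.phaseSpace)
    (hal : P.Alive m (x, θ)) : ∃ r > 0, ∀ x' ∈ P.openSide i, dist x' x < r →
      ((x', θ) ∈ P.periodicSet m Θ ↔ (x, θ) ∈ P.periodicSet m Θ) := by
  obtain ⟨r₁, hr₁, H₁⟩ := iterate_eq_self_local hx hu hme hal
  obtain ⟨r₂, hr₂, H₂⟩ := iterate_dir_local hx hal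
  refine ⟨min r₁ r₂, lt_min hr₁ hr₂, fun x' hx' hd => ?_⟩
  obtain ⟨hal', hiff⟩ := H₁ x' hx' (hd.trans_le (min_le_left _ _))
  have hdir := H₂ x' hx' (hd.trans_le (min_le_right _ _))
  have hu' := P.mk_mem_phaseSpace_of hx hx' hu
  have hall : P.next^[m] (x, θ) = (x, θ) → ∀ j,
      (P.next^[j] (x', θ)).2 = (P.next^[j] (x, θ)).2 := by
    intro he j
    have e1 : P.next^[j % m] (x, θ) = P.next^[j] (x, θ) :=
      Function.IsPeriodicPt.iterate_mod_apply he j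
    have e2 : P.next^[j % m] (x', θ) = P.next^[j] (x', θ) :=
      Function.IsPeriodicPt.iterate_mod_apply (hiff.2 he) j
    rw [← e1, ← e2]
    exact hdir _ (Nat.mod_lt _ hm).le
  constructor
  · rintro ⟨-, -, he, hd⟩
    have he' := hiff.1 he
    exact ⟨hu, hal, he', fun j => by rw [← hall he' j]; exact hd j⟩
  · rintro ⟨-, -, he, hd⟩
    exact ⟨hu', hal', hiff.2 he, fun j => by rw [hall he j]; exact hd j⟩

theorem IsInvariant.isBoundaryPoint_of_step (hC : P.IsInvariant C) {u v : ℂ × Circle}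
    (hu : u ∈ P.phaseSpace) (hs : P.Step u v) (hv : P.IsBoundaryPoint C v) :
    P.IsBoundaryPoint C u := by
  obtain ⟨x, θ⟩ := u
  obtain ⟨y, θ'⟩ := v
  obtain ⟨hvX, j, hj, h1, h2⟩ := hv
  obtain ⟨⟨i, hi⟩, -⟩ := id hu
  simp only at hi hj h1 h2
  refine ⟨hu, i, hi, fun r hr => ?_, fun r hr => ?_⟩
  · obtain ⟨δ, hδ, H⟩ := P.step_local_backward hs hi hj hr
    obtain ⟨y', hy', hd, hmem⟩ := h1 δ hδ
    obtain ⟨x', hx', hdx, hs'⟩ := H y' hy' hd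
    exact ⟨x', hx', hdx, (hC.mem_iff _ (P.mk_mem_phaseSpace_of hi hx' hu) _ hs'.mem hs').2 hmem⟩
  · obtain ⟨δ, hδ, H⟩ := P.step_local_backward hs hi hj hr
    obtain ⟨y', hy', hd, hmem⟩ := h2 δ hδ
    obtain ⟨x', hx', hdx, hs'⟩ := H y' hy' hd
    exact ⟨x', hx', hdx, fun h =>
      hmem ((hC.mem_iff _ (P.mk_mem_phaseSpace_of hi hx' hu) _ hs'.mem hs').1 h)⟩

theorem IsInvariant.isBoundaryPoint_of_iterate (hC : P.IsInvariant C) {u : ℂ × Circle}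
    (hu : u ∈ P.phaseSpace) {k : ℕ} (hal : P.Alive k u)
    (h : P.IsBoundaryPoint C (P.next^[k] u)) : P.IsBoundaryPoint C u := by
  induction k with
  | zero => exact h
  | succ k ih =>
    have hal' := hal.mono k.le_succ
    exact ih hal' (hC.isBoundaryPoint_of_step (hal'.mem hu) (hal.step k.lt_succ_self) h)

/-- Local constancy gives perfectness and shows that no boundary point admits `m` forward steps. -/
theorem isTame_periodicSet {m : ℕ} (hm : 0 < m) (hme : Even m) {Θ : Set Circle} (hΘ : Θ.Finite) :
    P.IsTame (P.periodicSet m Θ) := by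
  have hinv : P.IsInvariant (P.periodicSet m Θ) := isInvariant_periodicSet hm Θ
  have hbd : ∀ u, P.IsBoundaryPoint (P.periodicSet m Θ) u → ¬ P.Alive m u := by
    rintro ⟨x, θ⟩ ⟨hX, i, hi, h1, h2⟩ hal
    obtain ⟨r, hr, H⟩ := mem_periodicSet_local hm hme Θ hi hX hal
    obtain ⟨x', hx', hd, hmem⟩ := h1 r hr
    obtain ⟨x'', hx'', hd', hnot⟩ := h2 r hr
    exact hnot ((H x'' hx'' hd').2 ((H x' hx' hd).1 hmem))
  refine { toIsInvariant := hinv, finite_dirs := hΘ.subset ?_, perfect := ?_,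
           not_alive := fun u hu hal => hbd u hu (hal m), not_alive_rev := ?_ }
  · rintro _ ⟨q, hq, rfl⟩
    exact hq.2.2.2 0
  · intro i x hx θ hmem r hr
    obtain ⟨ρ, hρ, H⟩ := mem_periodicSet_local hm hme Θ hx hmem.1 hmem.2.1
    obtain ⟨d, hd, hdn, hxd⟩ := exists_small_add_mem_openSide hx (lt_min hr hρ)
    have hdist : dist (x + d) x = ‖d‖ := by rw [dist_eq_norm, add_sub_cancel_left]
    refine ⟨x + d, hxd, by simpa using hd, ?_, (H _ hxd ?_).2 hmem⟩ <;> rw [hdist]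
    · exact hdn.trans_le (min_le_left _ _)
    · exact hdn.trans_le (min_le_right _ _)
  -- Were `m` backward steps possible, the point reached would again be a boundary point, yet it
  -- admits `m` forward steps.
  · intro u hu hal
    have hr := P.rev_mem hu.1
    obtain ⟨h1, h2⟩ := (hal m).rev hr
    rw [P.rev_rev hu.1] at h2
    have hX := P.rev_mem ((hal m).mem hr)
    exact hbd _ (hinv.isBoundaryPoint_of_iterate hX h1 (by rwa [h2])) h1

/-! ### Directions -/

theorem exists_dihedral_iterate {u : ℂ × Circle} {k : ℕ} (hal : P.Alive k u) :
    ∃ g ∈ P.dihedralGroup, ((P.next^[k] u).2 : ℂ) = g u.2 := by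
  induction k with
  | zero => exact ⟨1, one_mem _, rfl⟩
  | succ k ih =>
    obtain ⟨g, hg, e⟩ := ih (hal.mono k.le_succ)
    have hs := hal.step k.lt_succ_self
    obtain ⟨⟨j, hj⟩, -⟩ := hs.mem
    refine ⟨P.sideReflection j * g, mul_mem (Subgroup.subset_closure ⟨j, rfl⟩) hg, ?_⟩
    rw [hs.eq_reflect hj, coe_reflect, e]; rfl

theorem IsTame.isExceptional (hC : P.IsTame C) (hP : P.IsIrrational) (hne : C.Nonempty)
    {θ : Circle} (h : ∀ φ ∈ Prod.snd '' C, ∃ g ∈ P.dihedralGroup, (φ : ℂ) = g θ) :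
    P.IsExceptional θ := by
  obtain ⟨⟨z, φ⟩, hz⟩ := hC.flowBoundary_nonempty hP hne
  obtain ⟨d, k, hk, e, -⟩ := hC.exists_diagonal_of_flowBoundary hz
  obtain ⟨g, hg, e'⟩ := h φ (mem_dirs_of_flowBoundary hz)
  refine ⟨d, ⟨k, by omega⟩, g, hg, ?_⟩
  rw [← e', e, ← d.vel_eq]

/-- A forward orbit with finitely many directions has an exceptional direction. -/
theorem isExceptional_of_finite (hP : P.IsIrrational) {u : ℂ × Circle} (hu : u ∈ P.phaseSpace)
    (hal : ∀ k, P.Alive k u) (hfin : (range fun k => (P.next^[k] u).2).Finite) :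
    P.IsExceptional u.2 := by
  have hdir : ∀ φ ∈ range fun k => (P.next^[k] u).2, ∃ g ∈ P.dihedralGroup, (φ : ℂ) = g u.2 := by
    rintro _ ⟨k, rfl⟩
    exact exists_dihedral_iterate (hal k)
  by_cases hper : ∃ k, 0 < k ∧ P.next^[k] u = u
  · obtain ⟨k, hk, he⟩ := hper
    -- The doubled period is even, as tameness requires.
    have hT := isTame_periodicSet (P := P) (m := k + k) (by omega) ⟨k, rfl⟩ hfin
    refine hT.isExceptional hP ⟨u, hu, hal _, ?_, fun j => ⟨j, rfl⟩⟩ ?_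
    · rw [Function.iterate_add_apply, he, he]
    · rintro _ ⟨q, hq, rfl⟩
      exact hdir _ (hq.2.2.2 0)
  · push Not at hper
    refine (isTame_orbitClosure hu hal hfin hper).isExceptional hP
      ⟨u, iterate_mem_orbitClosure hu hal 0⟩ ?_
    rintro _ ⟨q, hq, rfl⟩
    obtain ⟨k, h, -⟩ := hq.2 1 one_pos
    exact hdir _ ⟨k, h⟩

end BilliardTable

end

theorem theorem4p1 {n : ℕ} [NeZero n] (P : BilliardTable n) (hP : P.IsIrrational)
    (u : ℂ × Circle) (o : ℕ → ℂ × Circle) (ho : P.IsForwardOrbit u o) :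
    (¬ P.IsExceptional u.2 → (range fun k => (o k).2).Infinite) ∧
    (¬ BilliardTable.IsPeriodicOrbit o → (range fun k => (o k).2).Finite →
      BilliardTable.IsRecurrentOrbit o ∧ P.IsFlatStrip (P.phaseSpace ∩ closure (range o))) := by
  have hal := ho.alive
  have hu := ho.1
  obtain rfl := ho.eq_iterate
  refine ⟨fun hex hfin => hex (BilliardTable.isExceptional_of_finite hP hu hal hfin),
    fun hper hfin => ?_⟩
  have hper' : ∀ k, 0 < k → P.next^[k] u ≠ u := fun k hk he => hper ⟨k, hk, he⟩
  refine ⟨BilliardTable.isRecurrentOrbit_iterate hu hal hfin hper', ?_⟩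
  rw [← BilliardTable.orbitClosure_eq hfin]
  exact BilliardTable.isFlatStrip_orbitClosure hP hu hal hfin hper'
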